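/- Let $F$ be a finite field with $q$ elements and $A=F[T]$; put $|f|=q^{\deg f}$ for $0\ne f\in A$. By a prime of $A$ we mean a monic irreducible polynomial. A Dirichlet character $\chi$ modulo $Q\in A$ is a homomorphism $(A/QA)^\times\to\mathbb C^\times$, extended by zero to the non-units of $A/QA$ and regarded as a function on $A$. It is primitive if it does not factor through $(A/DA)^\times$ for any proper divisor $D$ of $Q$. Let $\varphi^*(Q)$ denote the number of primitive characters modulo $Q$. Let $L(s,\chi)=\sum_{f\ \mathrm{monic}}\chi(f)|f|^{-s}$ for $\Re(s)>1$; for non-principal $\chi$ this extends to an entire function (a polynomial in $q^{-s}$, obtained by grouping the series according to $\deg f$). Proposition. For every real $k\ge 0$ there is a constant $c_k>0$, depending only on $k$, such that the following holds. For every finite field $F$ with $q$ elements there is $X_0=X_0(k,F)$ such that for every prime $Q\in F[T]$ with $|Q|\ge X_0$, $$\sum_{\substack{\chi \bmod Q\\ \chi\ \mathrm{primitive}}}\bigl|L(\tfrac12,\chi)\bigr|^{2k}\ \ge\ c_k\,\varphi^*(Q)\,(\log_q|Q|)^{k^2}.$$ Here $0^0=1$, so that for $k=0$ the left side is $\varphi^*(Q)$.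 -/

import Mathlib

open Polynomial

noncomputable section

namespace FFMoments

universe u

variable {F : Type u} [Field F]

/-- The norm `|f| = q ^ deg f` on `A = F[T]`, with `q = #F` and `|0| = 0`. -/
def polyNorm (f : F[X]) : ℝ :=
  open Classical in if f = 0 then 0 else (Nat.card F : ℝ) ^ f.natDegree

/-- A Dirichlet character modulo `Q`: a homomorphism `(A/QA)ˣ → ℂ`, extended by zero to the
non-units of `A/QA`. -/
abbrev DirChar (Q : F[X]) : Type u := MulChar (F[X] ⧸ Ideal.span {Q}) ℂ

/-- The value of a Dirichlet character modulo `Q` at a polynomial. -/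
def DirChar.val {Q : F[X]} (χ : DirChar Q) (f : F[X]) : ℂ :=
  χ (Ideal.Quotient.mk (Ideal.span {Q}) f)

/-- The character `χ` modulo `Q` factors through `(A/DA)ˣ`. -/
def DirChar.FactorsThrough {Q : F[X]} (χ : DirChar Q) (D : F[X]) : Prop :=
  ∃ ψ : DirChar D, ∀ g : F[X], IsCoprime g Q → χ.val g = ψ.val g

/-- `χ` modulo `Q` is primitive: it factors through `(A/DA)ˣ` for no proper divisor `D` of `Q`. -/
def DirChar.IsPrimitive {Q : F[X]} (χ : DirChar Q) : Prop :=
  ∀ D : F[X], D ∣ Q → ¬ Q ∣ D → ¬ χ.FactorsThrough D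

/-- The monic polynomials of degree `n`. -/
abbrev MonicDeg (F : Type u) [Field F] (n : ℕ) : Type u :=
  {f : F[X] // f.Monic ∧ f.natDegree = n}

/-- The sum of `χ(f)` over the (finitely many) monic `f` of degree `n`, that is, the coefficient of
`u ^ n` in `𝓛(u, χ) = ∑_{f monic} χ(f) u ^ deg f`. -/
def DirChar.coeffL {Q : F[X]} (χ : DirChar Q) (n : ℕ) : ℂ :=
  ∑ᶠ f : MonicDeg F n, χ.val f.1

/-- The Dirichlet `L`-function `L(s, χ) = 𝓛(q ^ (-s), χ)`, with the series over monic `f` arranged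
by degree. For `Re s > 1` this is the absolutely convergent Dirichlet series of `χ`
(`hasSum_L`). For `χ` non-principal only finitely many terms are nonzero (`coeffL_eq_zero`), so
that it is an entire function of `s` (`differentiable_L`), the analytic continuation of that
series. -/
def DirChar.L {Q : F[X]} (χ : DirChar Q) (s : ℂ) : ℂ :=
  ∑' n : ℕ, χ.coeffL n * ((Nat.card F : ℂ) ^ (-s)) ^ n

/-- The set of primitive characters modulo `Q`. -/
def primitiveChars (Q : F[X]) : Set (DirChar Q) := {χ | χ.IsPrimitive}

/-- `φ*(Q)`, the number of primitive characters modulo `Q`. -/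
def phiStar (Q : F[X]) : ℕ := (primitiveChars Q).ncard

/-- The moment `∑* |L(1/2, χ)| ^ (2k)` over the (finitely many, see `finite_dirChar`) primitive
characters modulo `Q`. -/
def moment (Q : F[X]) (k : ℝ) : ℝ :=
  ∑ᶠ χ ∈ primitiveChars Q, ‖χ.L (1 / 2)‖ ^ (2 * k)

/-! ### The definitions are meaningful -/

instance finite_degreeLT [Finite F] (n : ℕ) : Finite (degreeLT F n) :=
  Finite.of_equiv _ (degreeLTEquiv F n).toEquiv.symm

instance finite_monicDeg [Finite F] (n : ℕ) : Finite (MonicDeg F n) :=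
  Finite.of_equiv _ (monicEquivDegreeLT (R := F) n).symm

theorem card_monicDeg (n : ℕ) : Nat.card (MonicDeg F n) = Nat.card F ^ n := by
  rw [Nat.card_congr ((monicEquivDegreeLT (R := F) n).trans (degreeLTEquiv F n).toEquiv),
    Nat.card_fun, Nat.card_fin]

theorem exists_degree_lt {Q : F[X]} (hQ : Q ≠ 0) (a : F[X] ⧸ Ideal.span {Q}) :
    ∃ r : F[X], r.degree < Q.degree ∧ Ideal.Quotient.mk (Ideal.span {Q}) r = a := by
  obtain ⟨g, rfl⟩ := Ideal.Quotient.mk_surjective a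
  refine ⟨g % Q, EuclideanDomain.mod_lt g hQ, ?_⟩
  rw [Ideal.Quotient.eq, Ideal.mem_span_singleton]
  exact ⟨-(g / Q), by linear_combination EuclideanDomain.div_add_mod g Q⟩

theorem finite_quotient [Finite F] {Q : F[X]} (hQ : Q ≠ 0) : Finite (F[X] ⧸ Ideal.span {Q}) := by
  refine Finite.of_surjective
    (fun r : degreeLT F Q.natDegree => Ideal.Quotient.mk (Ideal.span {Q}) r.1) fun a => ?_
  obtain ⟨r, hr, rfl⟩ := exists_degree_lt hQ a
  exact ⟨⟨r, mem_degreeLT.2 (by rwa [← degree_eq_natDegree hQ])⟩, rfl⟩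

theorem finite_dirChar [Finite F] {Q : F[X]} (hQ : Q ≠ 0) : Finite (DirChar Q) := by
  have := finite_quotient hQ
  infer_instance

/-- For `Q` irreducible the primitive characters are exactly the non-principal ones. -/
theorem isPrimitive_iff_ne_one {Q : F[X]} (hQ : Irreducible Q) (χ : DirChar Q) :
    χ.IsPrimitive ↔ χ ≠ 1 := by
  have unit_iff : ∀ g : F[X], IsUnit (Ideal.Quotient.mk (Ideal.span {Q}) g) → IsCoprime g Q := by
    intro g hg
    obtain ⟨b, hb⟩ := hg.exists_right_inv
    obtain ⟨b, rfl⟩ := Ideal.Quotient.mk_surjective b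
    rw [← map_mul, ← map_one (Ideal.Quotient.mk (Ideal.span {Q})), Ideal.Quotient.eq,
      Ideal.mem_span_singleton] at hb
    obtain ⟨c, hc⟩ := hb
    exact ⟨b, -c, by linear_combination hc⟩
  have cop : ∀ (D g : F[X]), IsCoprime g D → IsUnit (Ideal.Quotient.mk (Ideal.span {D}) g) := by
    rintro D g ⟨a, b, hab⟩
    refine IsUnit.of_mul_eq_one (Ideal.Quotient.mk _ a) ?_
    rw [← map_mul, ← map_one (Ideal.Quotient.mk (Ideal.span {D})), Ideal.Quotient.eq,
      Ideal.mem_span_singleton]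
    exact ⟨-b, by linear_combination hab⟩
  constructor
  · rintro h rfl
    refine h 1 (one_dvd _) (fun h1 => hQ.not_isUnit (isUnit_of_dvd_one h1)) ⟨1, fun g hg => ?_⟩
    rw [DirChar.val, DirChar.val, MulChar.one_apply (cop _ _ hg),
      MulChar.one_apply (cop _ _ isCoprime_one_right)]
  · rintro hχ D hDQ hQD ⟨ψ, hψ⟩
    have hD : IsUnit D := by
      obtain ⟨c, hc⟩ := hDQ
      rcases hQ.isUnit_or_isUnit hc with h | h
      · exact h
      · exact absurd (by rw [hc]; exact h.mul_right_dvd.2 dvd_rfl) hQD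
    have triv : ∀ x : F[X], Ideal.Quotient.mk (Ideal.span {D}) x = 1 := fun x => by
      rw [← map_one (Ideal.Quotient.mk (Ideal.span {D})), Ideal.Quotient.eq,
        Ideal.mem_span_singleton]
      exact hD.dvd
    refine hχ (MulChar.ext fun a => ?_)
    obtain ⟨g, hg⟩ := Ideal.Quotient.mk_surjective (a : F[X] ⧸ Ideal.span {Q})
    have := hψ g (unit_iff g (hg ▸ a.isUnit))
    rw [DirChar.val, DirChar.val, hg, triv, map_one] at this
    rw [this, MulChar.one_apply a.isUnit]

theorem norm_val_le_one [Finite F] {Q : F[X]} (hQ : Q ≠ 0) (χ : DirChar Q) (f : F[X]) : ‖χ.val f‖ ≤ 1 := by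
  have := finite_quotient hQ
  unfold DirChar.val
  by_cases h : IsUnit (Ideal.Quotient.mk (Ideal.span {Q}) f)
  · obtain ⟨v, hv⟩ := h
    rw [← hv]
    refine ((pow_eq_one_iff_of_nonneg (norm_nonneg _)
      (Nat.card_pos (α := (F[X] ⧸ Ideal.span {Q})ˣ)).ne').mp ?_).le
    rw [← norm_pow, ← map_pow, ← Units.val_pow_eq_pow_val, pow_card_eq_one', Units.val_one,
      map_one, norm_one]
  · rw [χ.map_nonunit h, norm_zero]
    exact zero_le_one

/-- For `χ` non-principal modulo `Q`, the `L`-function is a polynomial in `q ^ (-s)` of degree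
less than `deg Q`. -/
theorem coeffL_eq_zero [Finite F] {Q : F[X]} (hQ : Q ≠ 0) {χ : DirChar Q} (hχ : χ ≠ 1) {n : ℕ}
    (hn : Q.natDegree ≤ n) : χ.coeffL n = 0 := by
  have := finite_quotient hQ
  have := Fintype.ofFinite (F[X] ⧸ Ideal.span {Q})
  have := Fintype.ofFinite (MonicDeg F n)
  have shift : ∀ a : F[X] ⧸ Ideal.span {Q},
      χ.coeffL n = ∑ f : MonicDeg F n, χ (Ideal.Quotient.mk _ f.1 + a) := by
    intro a
    obtain ⟨r, hr, rfl⟩ := exists_degree_lt hQ a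
    have hrn : r ∈ degreeLT F n := by
      rw [mem_degreeLT]
      exact hr.trans_le (degree_le_natDegree.trans (by exact_mod_cast hn))
    let e : MonicDeg F n ≃ MonicDeg F n :=
      (monicEquivDegreeLT (R := F) n).trans
        ((Equiv.addRight (⟨r, hrn⟩ : degreeLT F n)).trans (monicEquivDegreeLT (R := F) n).symm)
    have he : ∀ f, (e f).1 = f.1 + r := by
      rintro ⟨f, hf, rfl⟩
      have h : X ^ f.natDegree + f.eraseLead = f := by
        have := f.eraseLead_add_monomial_natDegree_leadingCoeff
        rw [hf.leadingCoeff, monomial_one_right_eq_X_pow] at this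
        rw [add_comm]; exact this
      change X ^ f.natDegree + (f.eraseLead + r) = f + r
      rw [← add_assoc, h]
    rw [DirChar.coeffL, finsum_eq_sum_of_fintype, ← e.sum_comp]
    simp only [he, DirChar.val, map_add]
  have key : (Fintype.card (F[X] ⧸ Ideal.span {Q}) : ℂ) * χ.coeffL n = 0 := by
    calc _ = ∑ _a : F[X] ⧸ Ideal.span {Q}, χ.coeffL n := by simp
      _ = ∑ a, ∑ f : MonicDeg F n, χ (Ideal.Quotient.mk _ f.1 + a) :=
        Finset.sum_congr rfl fun a _ => shift a
      _ = ∑ f : MonicDeg F n, ∑ a, χ (Ideal.Quotient.mk _ f.1 + a) := Finset.sum_comm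
      _ = 0 := Finset.sum_eq_zero fun f _ => by
        rw [← MulChar.sum_eq_zero_of_ne_one hχ]
        exact Equiv.sum_comp (Equiv.addLeft (Ideal.Quotient.mk (Ideal.span {Q}) f.1)) fun x => χ x
  exact (mul_eq_zero.1 key).resolve_left (by exact_mod_cast Fintype.card_ne_zero)

theorem L_eq_sum [Finite F] {Q : F[X]} (hQ : Q ≠ 0) {χ : DirChar Q} (hχ : χ ≠ 1) (s : ℂ) :
    χ.L s = ∑ n ∈ Finset.range Q.natDegree, χ.coeffL n * ((Nat.card F : ℂ) ^ (-s)) ^ n :=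
  tsum_eq_sum fun n hn => by
    rw [coeffL_eq_zero hQ hχ (by simpa using hn), zero_mul]

theorem differentiable_L [Finite F] {Q : F[X]} (hQ : Q ≠ 0) {χ : DirChar Q} (hχ : χ ≠ 1) :
    Differentiable ℂ χ.L := by
  have hq : (Nat.card F : ℂ) ≠ 0 := by exact_mod_cast Nat.card_pos.ne'
  have h : χ.L = fun s => ∑ n ∈ Finset.range Q.natDegree,
      χ.coeffL n * ((Nat.card F : ℂ) ^ (-s)) ^ n := funext (L_eq_sum hQ hχ)
  rw [h]
  refine Differentiable.fun_sum fun n _ => ?_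
  exact ((differentiable_neg.const_cpow (Or.inl hq)).pow n).const_mul _

/-- For `Re s > 1`, `L(s, χ)` is the sum of the series of `χ(f) / |f| ^ s` over monic `f`. -/
theorem hasSum_L [Finite F] {Q : F[X]} (hQ : Q ≠ 0) (χ : DirChar Q) {s : ℂ} (hs : 1 < s.re) :
    HasSum (fun f : {f : F[X] // f.Monic} => χ.val f.1 / (polyNorm f.1 : ℂ) ^ s) (χ.L s) := by
  have hq1 : 1 < Nat.card F := Finite.one_lt_card
  have hq0 : (0 : ℝ) < Nat.card F := by positivity
  have hqC : (Nat.card F : ℂ) ≠ 0 := by exact_mod_cast hq0.ne'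
  let e : (Σ n, MonicDeg F n) ≃ {f : F[X] // f.Monic} :=
    { toFun := fun x => ⟨x.2.1, x.2.2.1⟩
      invFun := fun f => ⟨f.1.natDegree, f.1, f.2, rfl⟩
      left_inv := by rintro ⟨n, f, hf, rfl⟩; rfl
      right_inv := fun f => rfl }
  have hterm : ∀ n (f : MonicDeg F n), χ.val f.1 / (polyNorm f.1 : ℂ) ^ s =
      χ.val f.1 * ((Nat.card F : ℂ) ^ (-s)) ^ n := by
    rintro n ⟨f, hf, rfl⟩
    rw [polyNorm, if_neg hf.ne_zero, Complex.ofReal_pow, Complex.ofReal_natCast,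
      div_eq_mul_inv, ← Complex.cpow_neg, ← Complex.cpow_nat_mul, Complex.natCast_cpow_natCast_mul]
  set z : ℂ := (Nat.card F : ℂ) ^ (-s) with hz
  have hznorm : ‖z‖ = (Nat.card F : ℝ) ^ (-s.re) := by
    rw [hz, Complex.norm_natCast_cpow_of_pos (by omega), Complex.neg_re]
  have hqz : (Nat.card F : ℝ) * ‖z‖ < 1 := by
    rw [hznorm, ← Real.rpow_one_add' hq0.le (by linarith)]
    exact Real.rpow_lt_one_of_one_lt_of_neg (by exact_mod_cast hq1) (by linarith)
  rw [← e.hasSum_iff]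
  have hsum : Summable fun x : Σ n, MonicDeg F n =>
      χ.val x.2.1 * z ^ x.1 := by
    refine Summable.of_norm ((summable_sigma_of_nonneg fun _ => norm_nonneg _).2
      ⟨fun n => Summable.of_finite, ?_⟩)
    refine Summable.of_nonneg_of_le (fun n => tsum_nonneg fun _ => norm_nonneg _) (fun n => ?_)
      (summable_geometric_of_lt_one (by positivity) hqz)
    have := Fintype.ofFinite (MonicDeg F n)
    rw [tsum_fintype]
    calc _ ≤ ∑ _f : MonicDeg F n, ‖z‖ ^ n := Finset.sum_le_sum fun f _ => by
          rw [norm_mul, norm_pow]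
          exact mul_le_of_le_one_left (by positivity) (norm_val_le_one hQ χ _)
      _ = ((Nat.card F : ℝ) * ‖z‖) ^ n := by
          rw [Finset.sum_const, Finset.card_univ, ← Nat.card_eq_fintype_card, card_monicDeg,
            nsmul_eq_mul, mul_pow, Nat.cast_pow]
  have h1 := hsum.hasSum
  have h2 := h1.sigma (g := fun n => χ.coeffL n * z ^ n) fun n => by
    have := Fintype.ofFinite (MonicDeg F n)
    rw [DirChar.coeffL, finsum_eq_sum_of_fintype, Finset.sum_mul]
    exact hasSum_fintype _
  rw [DirChar.L, h2.tsum_eq]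
  convert h1 using 1
  funext x
  exact hterm x.1 x.2

end FFMoments

end

open FFMoments

/-!
The bound comes from comparing `L(1/2, χ)` with two short Dirichlet polynomials, or resonators,
`R` and `S` which imitate `L(1/2, χ) ^ k` and `L(1/2, χ) ^ (k - 1)` (the method of Heap and
Soundararajan). They are products over dyadic blocks of primes `P` of degree less than a small
fraction of `N = deg Q`, each factor being a truncation of the exponential of
`k ∑ χ(P) / |P| ^ (1/2)` or `(k - 1) ∑ χ(P) / |P| ^ (1/2)` over the block. With `Φ` the number of
characters, three moments are estimated up to constants:

* the first moment `∑ L(1/2, χ) S(χ) conj (R(χ))` is at least of size `Φ N ^ (k ^ 2)`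
  (`le_norm_sum_lPoly_dyadicResonator`);
* for `k ≤ 1` the second moment `∑ |L(1/2, χ) S(χ)| ^ 2` is at most of size `Φ N ^ (k ^ 2)`
  (`sum_lPoly_sq_dyadicResonator_sq_le`);
* the mixed moments `∑ |R(χ)| ^ a |S(χ)| ^ b` with `a k + b (k - 1) = 2 k` are at most of size
  `Φ N ^ (k ^ 2)` (`sum_dyadicResonator_rpow_mul_rpow_le`).

For `k ≥ 1`, Young's inequality with exponent `2 k` bounds the first moment by the `2 k`-th moment
of `L(1/2, χ)` and the mixed moment with `a = b = 2 k / (2 k - 1)`. For `0 < k ≤ 1`, the weighted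
inequality of the means bounds it by the `2 k`-th moment, the second moment and the mixed moment
with `a = 2 / k`, `b = 2`. Either way the `2 k`-th moment cannot be small.

No functional equation is needed, because `L(1/2, χ)` is a polynomial in `q ^ (-1/2)` of degree
less than `N`. Orthogonality reduces its moments, twisted by `χ(f) conj (χ(g))`, to counting monic
solutions of `h f ≡ g` and of `h f ≡ h' g` modulo `Q` in degrees less than `N`. In the second case
the condition is exactly equidistributed as soon as the polynomials `u f - w g` of the degrees
allowed fill a complete system of residues, which Bézout's identity provides (`solCount_mul_eq`);
in low degrees it is an equality (`solCount_of_lt`). The diagonal terms are truncated Euler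
products, which Rankin's trick compares with full ones (`abs_sum_prod_sub_prod_sum_le`). In the
mixed moments, `|R| ^ a |S| ^ b` is dominated pointwise in each block by `|R| ^ 2` plus a very
high power of the sum over primes (`norm_expTrunc_rpow_mul_le`), and the blocks behave as if
independent (`sum_prod_norm_sq_le`). Mertens' theorem for `F[T]` gives `exp (k ^ 2 ∑ 1 / |P|)` the
size `N ^ (k ^ 2)`.
-/

noncomputable section

namespace FFMoments

universe u

/-! ### Truncated exponentials -/

/-- The exponential series truncated after the term of order `ℓ`. -/
def expTrunc (ℓ : ℕ) (w : ℂ) : ℂ := ∑ r ∈ Finset.range (ℓ + 1), w ^ r / (r.factorial : ℂ)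

/-- Rankin's trick for the tail of the exponential series. -/
theorem exp_sub_sum_le_rankin {y R : ℝ} (hy : 0 ≤ y) (hR : 1 ≤ R) (n : ℕ) :
    R ^ n * (Real.exp y - ∑ m ∈ Finset.range n, y ^ m / m.factorial) ≤ Real.exp (R * y) := by
  have hs : ∀ x : ℝ, HasSum (fun m : ℕ => x ^ m / m.factorial) (Real.exp x) := fun x => by
    rw [Real.exp_eq_exp_ℝ]; exact NormedSpace.expSeries_div_hasSum_exp x
  have h1 := (hasSum_nat_add_iff' n).2 (hs y)
  have h2 := (hasSum_nat_add_iff' n).2 (hs (R * y))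
  have h3 : R ^ n * (Real.exp y - ∑ m ∈ Finset.range n, y ^ m / m.factorial) ≤
      Real.exp (R * y) - ∑ m ∈ Finset.range n, (R * y) ^ m / m.factorial := by
    refine hasSum_le (fun m => ?_) (h1.mul_left (R ^ n)) h2
    rw [mul_pow, mul_div_assoc]
    have : R ^ n ≤ R ^ (m + n) := pow_le_pow_right₀ hR (by omega)
    gcongr
  refine h3.trans (sub_le_self _ (Finset.sum_nonneg fun m _ => by positivity))

theorem norm_exp_sub_expTrunc_le {ℓ : ℕ} {w : ℂ} (hw : 64 * ‖w‖ ≤ ℓ) :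
    ‖Complex.exp w - expTrunc ℓ w‖ ≤ Real.exp (-ℓ) * Real.exp w.re := by
  refine (Complex.norm_exp_sub_sum_le_exp_norm_sub_sum w (ℓ + 1)).trans ?_
  have h := exp_sub_sum_le_rankin (norm_nonneg w) (by norm_num : (1:ℝ) ≤ 64) (ℓ + 1)
  -- the constant `64` is any number at least `exp 3`
  have h64 : Real.exp (3 * (ℓ : ℝ)) ≤ 64 ^ (ℓ + 1) := by
    have : Real.exp 3 ≤ 64 := by
      have h1 : Real.exp 3 = Real.exp 1 ^ 3 := by rw [← Real.exp_nat_mul]; norm_num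
      rw [h1]
      have := Real.exp_one_lt_d9
      calc Real.exp 1 ^ 3 ≤ 3 ^ 3 := by gcongr; linarith
        _ ≤ 64 := by norm_num
    calc Real.exp (3 * (ℓ : ℝ)) = Real.exp 3 ^ ℓ := by rw [← Real.exp_nat_mul]; ring_nf
      _ ≤ 64 ^ ℓ := by gcongr
      _ ≤ 64 ^ (ℓ + 1) := pow_le_pow_right₀ (by norm_num) (by omega)
  have hre : -‖w‖ ≤ w.re := (abs_le.1 (Complex.abs_re_le_norm w)).1
  set t := Real.exp ‖w‖ - ∑ m ∈ Finset.range (ℓ + 1), ‖w‖ ^ m / m.factorial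
  have ht : 0 ≤ t := sub_nonneg.2 (Real.sum_le_exp_of_nonneg (norm_nonneg _) _)
  have h5 : Real.exp (3 * (ℓ : ℝ)) * t ≤ Real.exp ℓ :=
    (mul_le_mul_of_nonneg_right h64 ht).trans (h.trans (Real.exp_le_exp.2 hw))
  have h6 : t ≤ Real.exp (-(2 * (ℓ : ℝ))) := by
    rw [mul_comm, ← le_div_iff₀ (Real.exp_pos _), ← Real.exp_sub] at h5
    refine h5.trans (Real.exp_le_exp.2 (by linarith))
  rw [← Real.exp_add]
  have hl : (0:ℝ) ≤ ℓ := Nat.cast_nonneg _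
  exact h6.trans (Real.exp_le_exp.2 (by linarith))

theorem norm_expTrunc_le {ℓ : ℕ} {w : ℂ} (hw : 64 * ‖w‖ ≤ ℓ) :
    ‖expTrunc ℓ w‖ ≤ Real.exp (Real.exp (-ℓ)) * Real.exp w.re := by
  have h := norm_exp_sub_expTrunc_le hw
  have h1 := norm_sub_norm_le (expTrunc ℓ w) (Complex.exp w)
  rw [norm_sub_rev, Complex.norm_exp] at h1
  have h2 := Real.add_one_le_exp (Real.exp (-(ℓ:ℝ)))
  nlinarith [Real.exp_pos w.re]

theorem le_norm_expTrunc {ℓ : ℕ} (hℓ : 1 ≤ ℓ) {w : ℂ} (hw : 64 * ‖w‖ ≤ ℓ) :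
    Real.exp w.re ≤ Real.exp (2 * Real.exp (-ℓ)) * ‖expTrunc ℓ w‖ := by
  have h := norm_exp_sub_expTrunc_le hw
  have h1 := norm_sub_norm_le (Complex.exp w) (expTrunc ℓ w)
  rw [Complex.norm_exp] at h1
  set x := Real.exp (-(ℓ:ℝ)) with hx
  have hx0 : 0 < x := Real.exp_pos _
  have hx1 : x ≤ 1 / 2 := by
    have : x ≤ Real.exp (-1) := Real.exp_le_exp.2 (by
      have : (1:ℝ) ≤ ℓ := by exact_mod_cast hℓ
      linarith)
    refine this.trans ?_
    rw [Real.exp_neg, inv_le_comm₀ (Real.exp_pos _) (by norm_num)]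
    have := Real.add_one_le_exp (1:ℝ)
    norm_num at this ⊢
    linarith
  have h2 : (1 - x) * Real.exp w.re ≤ ‖expTrunc ℓ w‖ := by linarith
  have h3 : 1 ≤ Real.exp (2 * x) * (1 - x) := by
    have := Real.add_one_le_exp (2 * x)
    nlinarith
  calc Real.exp w.re ≤ Real.exp (2 * x) * (1 - x) * Real.exp w.re :=
        le_mul_of_one_le_left (Real.exp_pos _).le h3
    _ = Real.exp (2 * x) * ((1 - x) * Real.exp w.re) := by ring
    _ ≤ _ := by gcongr

/-- A bound for the truncated exponential that does not need `w` to be small. -/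
theorem norm_expTrunc_le_pow {ℓ : ℕ} {w : ℂ} {t : ℝ} (ht : 1 ≤ t) :
    ‖expTrunc ℓ w‖ ≤ t ^ ℓ * Real.exp (‖w‖ / t) := by
  have ht0 : 0 < t := by linarith
  calc ‖expTrunc ℓ w‖ ≤ ∑ r ∈ Finset.range (ℓ + 1), ‖w‖ ^ r / r.factorial := by
        refine (norm_sum_le _ _).trans (Finset.sum_le_sum fun r _ => ?_)
        rw [norm_div, norm_pow, Complex.norm_natCast]
    _ ≤ ∑ r ∈ Finset.range (ℓ + 1), t ^ ℓ * ((‖w‖ / t) ^ r / r.factorial) := by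
        refine Finset.sum_le_sum fun r hr => ?_
        have h1 : t ^ r ≤ t ^ ℓ := pow_le_pow_right₀ ht (by simpa [Nat.lt_succ_iff] using hr)
        calc ‖w‖ ^ r / r.factorial = t ^ r * ((‖w‖ / t) ^ r / r.factorial) := by
              rw [div_pow]; field_simp
          _ ≤ _ := by gcongr
    _ = t ^ ℓ * ∑ r ∈ Finset.range (ℓ + 1), (‖w‖ / t) ^ r / r.factorial := by
        rw [Finset.mul_sum]
    _ ≤ _ := by
        gcongr
        exact Real.sum_le_exp_of_nonneg (by positivity) _

/-- Where `|z|` is small compared with `ℓ` the truncated exponentials behave like `exp`, and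
`a k + b (k - 1) = 2 k` turns the product into `|exp (k z)| ^ 2`; elsewhere a high power of `|z|`
dominates. -/
theorem norm_expTrunc_rpow_mul_le {k a b : ℝ} (hk : 0 ≤ k) (ha : 0 ≤ a) (hb : 0 ≤ b)
    (hab : a * k + b * (k - 1) = 2 * k) {m : ℕ} (hm : a + b ≤ 2 * m) {ℓ : ℕ} (hℓ : 1 ≤ ℓ) (z : ℂ) :
    ‖expTrunc ℓ (k * z)‖ ^ a * ‖expTrunc ℓ ((k - 1 : ℝ) * z)‖ ^ b ≤
      Real.exp ((a + b + 4) * Real.exp (-ℓ)) * ‖expTrunc ℓ (k * z)‖ ^ 2 +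
        (Real.exp 1 * (64 * (k + 1)) * ‖z‖ / ℓ) ^ (2 * (m * ℓ)) := by
  have hℓ0 : (0 : ℝ) < ℓ := by exact_mod_cast hℓ
  have hkk : |k - 1| ≤ k + 1 := by rw [abs_le]; constructor <;> linarith
  have hn1 : ‖(k : ℂ) * z‖ = k * ‖z‖ := by
    rw [norm_mul, Complex.norm_real, Real.norm_of_nonneg hk]
  have hn2 : ‖((k - 1 : ℝ) : ℂ) * z‖ = |k - 1| * ‖z‖ := by
    rw [norm_mul, Complex.norm_real, Real.norm_eq_abs]
  rcases le_or_gt (64 * (k + 1) * ‖z‖) ℓ with h | h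
  · have h1 : 64 * ‖(k : ℂ) * z‖ ≤ ℓ := by rw [hn1]; nlinarith [norm_nonneg z]
    have h2 : 64 * ‖((k - 1 : ℝ) : ℂ) * z‖ ≤ ℓ := by rw [hn2]; nlinarith [norm_nonneg z]
    have e1 := norm_expTrunc_le h1
    have e2 := norm_expTrunc_le h2
    have e3 := le_norm_expTrunc hℓ h1
    set x := Real.exp (-(ℓ:ℝ)) with hx
    have r1 : ((k : ℂ) * z).re = k * z.re := Complex.re_ofReal_mul _ _
    have r2 : (((k - 1 : ℝ) : ℂ) * z).re = (k - 1) * z.re := Complex.re_ofReal_mul _ _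
    rw [r1] at e1 e3
    rw [r2] at e2
    rw [← Real.exp_add] at e1 e2
    refine le_add_of_le_of_nonneg ?_ (by rw [pow_mul]; positivity)
    calc _ ≤ Real.exp (x + k * z.re) ^ a * Real.exp (x + (k - 1) * z.re) ^ b := by gcongr
      _ = Real.exp ((a + b) * x) * Real.exp (k * z.re) ^ 2 := by
        rw [← Real.exp_mul, ← Real.exp_mul, ← Real.exp_add, ← Real.exp_nat_mul, ← Real.exp_add]
        congr 1
        push_cast
        linear_combination z.re * hab
      _ ≤ Real.exp ((a + b) * x) * (Real.exp (2 * x) * ‖expTrunc ℓ (k * z)‖) ^ 2 := by gcongr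
      _ = _ := by
        rw [mul_pow, ← Real.exp_nat_mul, ← mul_assoc, ← Real.exp_add]
        congr 2
        push_cast
        ring
  · refine le_add_of_nonneg_of_le (by positivity) ?_
    set t := 64 * (k + 1) * ‖z‖ / ℓ with ht
    have ht1 : 1 ≤ t := by rw [ht, le_div_iff₀ hℓ0]; linarith
    have ht0 : 0 < t := by linarith
    have htz : 64 * (k + 1) * ‖z‖ = t * ℓ := by rw [ht]; field_simp
    have bd : ∀ w : ℂ, ‖w‖ ≤ (k + 1) * ‖z‖ → ‖expTrunc ℓ w‖ ≤ t ^ (ℓ : ℝ) * Real.exp ℓ := by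
      intro w hw
      rw [Real.rpow_natCast]
      refine (norm_expTrunc_le_pow ht1).trans ?_
      gcongr
      rw [div_le_iff₀ ht0]
      nlinarith
    have b1 := bd _ (hn1.le.trans (by nlinarith [norm_nonneg z]))
    have b2 := bd _ (hn2.le.trans (by nlinarith [norm_nonneg z]))
    have hte : 1 ≤ t ^ (ℓ : ℝ) * Real.exp ℓ :=
      one_le_mul_of_one_le_of_one_le (Real.one_le_rpow ht1 hℓ0.le) (Real.one_le_exp hℓ0.le)
    calc _ ≤ (t ^ (ℓ : ℝ) * Real.exp ℓ) ^ a * (t ^ (ℓ : ℝ) * Real.exp ℓ) ^ b := by gcongr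
      _ = (t ^ (ℓ : ℝ) * Real.exp ℓ) ^ (a + b) := by rw [Real.rpow_add (by positivity)]
      _ ≤ (t ^ (ℓ : ℝ) * Real.exp ℓ) ^ ((2 * m : ℕ) : ℝ) :=
        Real.rpow_le_rpow_of_exponent_le hte (by push_cast; exact hm)
      _ = _ := by
        rw [Real.rpow_natCast, Real.rpow_natCast]
        have h1 : Real.exp 1 * (64 * (k + 1)) * ‖z‖ / ℓ = t * Real.exp 1 := by rw [ht]; ring
        have h2 : Real.exp ℓ = Real.exp 1 ^ ℓ := by rw [← Real.exp_nat_mul, mul_one]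
        rw [h1, h2, ← mul_pow, ← pow_mul]
        ring_nf

/-- The mean of the dominating power of `norm_expTrunc_rpow_mul_le` is small once `ℓ` is large. -/
theorem rankin_pow_mul_factorial_le {c V : ℝ} (hV : 0 ≤ V) (hV1 : V ≤ 1) {m ℓ : ℕ} (hm : 1 ≤ m)
    (hℓ1 : 1 ≤ ℓ) (hℓ : Real.exp 1 * c ^ 2 * m ≤ ℓ) :
    ((c / ℓ) ^ (m * ℓ)) ^ 2 * ((m * ℓ).factorial * V ^ (m * ℓ)) ≤ Real.exp (-ℓ) := by
  have hℓ0 : (0 : ℝ) < ℓ := by exact_mod_cast hℓ1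
  have hf : ((m * ℓ).factorial : ℝ) ≤ ((m * ℓ : ℕ) : ℝ) ^ (m * ℓ) := by
    exact_mod_cast Nat.factorial_le_pow _
  have hV2 : V ^ (m * ℓ) ≤ 1 := pow_le_one₀ hV hV1
  have h1 : (c / ℓ) ^ 2 * (m * ℓ) ≤ Real.exp (-1) := by
    rw [Real.exp_neg, ← one_div, le_div_iff₀ (Real.exp_pos _), div_pow]
    have : c ^ 2 / (ℓ:ℝ) ^ 2 * (m * ℓ) * Real.exp 1 = Real.exp 1 * c ^ 2 * m / ℓ := by
      field_simp
    rw [this, div_le_one hℓ0]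
    exact hℓ
  calc _ ≤ ((c / ℓ) ^ (m * ℓ)) ^ 2 * (((m * ℓ : ℕ) : ℝ) ^ (m * ℓ) * 1) := by gcongr
    _ = ((c / ℓ) ^ 2 * (m * ℓ)) ^ (m * ℓ) := by
      rw [mul_one, ← pow_mul, mul_pow, ← pow_mul]; push_cast; ring
    _ ≤ Real.exp (-1) ^ (m * ℓ) := by gcongr
    _ ≤ Real.exp (-1) ^ ℓ := by
      refine pow_le_pow_of_le_one (Real.exp_pos _).le (Real.exp_le_one_iff.2 (by norm_num)) ?_
      exact Nat.le_mul_of_pos_left _ hm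
    _ = Real.exp (-ℓ) := by rw [← Real.exp_nat_mul]; simp

/-! ### Counting primes by degree -/

section Primes

variable (F : Type u) [Field F]

theorem finite_primesDeg [Finite F] (d : ℕ) :
    {P : F[X] | P.Monic ∧ Irreducible P ∧ P.natDegree = d}.Finite := by
  refine (Set.toFinite (Set.range fun f : MonicDeg F d => f.1)).subset ?_
  rintro P ⟨h1, -, h3⟩
  exact ⟨⟨P, h1, h3⟩, rfl⟩

/-- The monic irreducible polynomials of degree `d`. -/
def primesDeg [Finite F] (d : ℕ) : Finset F[X] := (finite_primesDeg F d).toFinset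

variable {F}

theorem mem_primesDeg [Finite F] {d : ℕ} {P : F[X]} :
    P ∈ primesDeg F d ↔ P.Monic ∧ Irreducible P ∧ P.natDegree = d := by
  simp [primesDeg]

theorem isCoprime_of_monic_irreducible {P R : F[X]} (hP : P.Monic) (hP' : Irreducible P)
    (hR : R.Monic) (hR' : Irreducible R) (h : P ≠ R) : IsCoprime P R :=
  (hP'.coprime_iff_not_dvd).2 fun hd =>
    h (eq_of_monic_of_associated hP hR (hP'.associated_of_dvd hR' hd))

variable (F) [Finite F]

theorem natDegree_X_pow_card_sub_X {d : ℕ} (hd : d ≠ 0) :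
    (X ^ (Nat.card F) ^ d - X : F[X]).natDegree = Nat.card F ^ d :=
  FiniteField.X_pow_card_pow_sub_X_natDegree_eq _ hd Finite.one_lt_card

/-- The distinct primes of degree `d` divide `X ^ (q ^ d) - X`. -/
theorem mul_card_primesDeg_le {d : ℕ} (hd : d ≠ 0) :
    d * (primesDeg F d).card ≤ Nat.card F ^ d := by
  have hdvd : ∏ P ∈ primesDeg F d, P ∣ (X ^ (Nat.card F) ^ d - X : F[X]) := by
    refine Finset.prod_dvd_of_coprime (fun P hP R hR hPR => ?_) fun P hP => ?_
    · obtain ⟨h1, h2, -⟩ := mem_primesDeg.1 hP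
      obtain ⟨h3, h4, -⟩ := mem_primesDeg.1 hR
      exact isCoprime_of_monic_irreducible h1 h2 h3 h4 hPR
    · obtain ⟨-, h2, h3⟩ := mem_primesDeg.1 hP
      exact h2.natDegree_dvd_iff_dvd_X_pow_card_pow_sub_X.1 (by rw [h3])
  have h := natDegree_le_of_dvd hdvd
    (FiniteField.X_pow_card_pow_sub_X_ne_zero _ hd Finite.one_lt_card)
  rw [natDegree_X_pow_card_sub_X F hd, natDegree_prod_of_monic _ _ fun P hP =>
    (mem_primesDeg.1 hP).1, Finset.sum_congr rfl fun P hP => (mem_primesDeg.1 hP).2.2,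
    Finset.sum_const, smul_eq_mul] at h
  linarith

/-- `X ^ (q ^ d) - X` is squarefree, and its prime factors have degrees dividing `d`. -/
theorem pow_card_le_sum_divisors {d : ℕ} (hd : d ≠ 0) :
    Nat.card F ^ d ≤ ∑ e ∈ d.divisors, e * (primesDeg F e).card := by
  classical
  set M : F[X] := X ^ (Nat.card F) ^ d - X with hM
  have hM0 : M ≠ 0 := FiniteField.X_pow_card_pow_sub_X_ne_zero _ hd Finite.one_lt_card
  have hMm : M.Monic := monic_X_pow_sub (by
    rw [degree_X]
    exact_mod_cast Nat.one_lt_pow hd Finite.one_lt_card)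
  have hsq : Squarefree M := by
    obtain ⟨p, hp⟩ := CharP.exists F
    refine (galois_poly_separable p _ (dvd_pow ?_ hd)).squarefree
    have := Fintype.ofFinite F
    rw [Nat.card_eq_fintype_card, ← CharP.cast_eq_zero_iff F p]
    exact Nat.cast_card_eq_zero F
  have hnd := (UniqueFactorizationMonoid.squarefree_iff_nodup_normalizedFactors hM0).1 hsq
  set m := UniqueFactorizationMonoid.normalizedFactors M with hm
  have hmem : ∀ P ∈ m, P.Monic ∧ Irreducible P ∧ P ∣ M := fun P hP =>
    ⟨(normalize_eq_self_iff_monic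
      (UniqueFactorizationMonoid.irreducible_of_normalized_factor P hP).ne_zero).1
      (UniqueFactorizationMonoid.normalize_normalized_factor P hP),
      UniqueFactorizationMonoid.irreducible_of_normalized_factor P hP,
      UniqueFactorizationMonoid.dvd_of_mem_normalizedFactors hP⟩
  have hprod : m.prod = M :=
    eq_of_monic_of_associated
      (by simpa using monic_multiset_prod_of_monic m id fun P hP => (hmem P hP).1) hMm
      (UniqueFactorizationMonoid.prod_normalizedFactors hM0)
  have hdeg : M.natDegree = ∑ P ∈ m.toFinset, P.natDegree := by
    conv_lhs => rw [← hprod]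
    rw [natDegree_multiset_prod_of_monic _ fun P hP => (hmem P hP).1, Finset.sum,
      Multiset.toFinset_val, hnd.dedup]
  rw [← natDegree_X_pow_card_sub_X F hd, ← hM, hdeg]
  have hsub : m.toFinset ⊆ d.divisors.biUnion (primesDeg F) := by
    intro P hP
    obtain ⟨h1, h2, h3⟩ := hmem P (Multiset.mem_toFinset.1 hP)
    rw [Finset.mem_biUnion]
    refine ⟨P.natDegree, ?_, mem_primesDeg.2 ⟨h1, h2, rfl⟩⟩
    rw [Nat.mem_divisors]
    exact ⟨h2.natDegree_dvd_iff_dvd_X_pow_card_pow_sub_X.2 h3, hd⟩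
  refine (Finset.sum_le_sum_of_subset hsub).trans ?_
  rw [Finset.sum_biUnion fun e _ e' _ hee => Finset.disjoint_left.2 fun P hP hP' =>
    hee ((mem_primesDeg.1 hP).2.2.symm.trans (mem_primesDeg.1 hP').2.2)]
  refine Finset.sum_le_sum fun e _ => ?_
  rw [Finset.sum_congr rfl fun P hP => (mem_primesDeg.1 hP).2.2, Finset.sum_const, smul_eq_mul,
    mul_comm]

end Primes

/-! ### Dyadic blocks of primes and Mertens' estimate -/

section Mertens

/-- `v = q ^ (-1/2)`, so that `v ^ deg f = |f| ^ (-1/2)` for monic `f`. -/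
def invSqrtCard (F : Type u) : ℝ := (√(Nat.card F : ℝ))⁻¹

theorem invSqrtCard_sq (F : Type u) : invSqrtCard F ^ 2 = (Nat.card F : ℝ)⁻¹ := by
  rw [invSqrtCard, inv_pow, Real.sq_sqrt (Nat.cast_nonneg _)]

theorem invSqrtCard_pow_two_mul (F : Type u) (d : ℕ) :
    invSqrtCard F ^ (2 * d) = ((Nat.card F : ℝ) ^ d)⁻¹ := by
  rw [pow_mul, invSqrtCard_sq, inv_pow]

variable (F : Type u) [Field F] [Finite F]

theorem two_le_card : (2 : ℝ) ≤ Nat.card F := by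
  exact_mod_cast (Finite.one_lt_card : 1 < Nat.card F)

theorem invSqrtCard_pos : 0 < invSqrtCard F := by
  have := two_le_card F
  unfold invSqrtCard; positivity

theorem invSqrtCard_sq_le : invSqrtCard F ^ 2 ≤ 1 / 2 := by
  rw [invSqrtCard_sq, one_div]
  exact inv_anti₀ (by norm_num) (two_le_card F)

theorem invSqrtCard_le : invSqrtCard F ≤ 3 / 4 := by
  have h := invSqrtCard_sq_le F
  nlinarith [invSqrtCard_pos F]

/-- The `i`-th dyadic block of primes: those of degree `2 ^ i ≤ d < 2 ^ (i + 1)`. -/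
def primeBlock (i : ℕ) : Finset F[X] :=
  open Classical in (Finset.Ico (2 ^ i) (2 ^ (i + 1))).biUnion (primesDeg F)

variable {F}

theorem mem_primeBlock {i : ℕ} {P : F[X]} : P ∈ primeBlock F i ↔
    P.Monic ∧ Irreducible P ∧ 2 ^ i ≤ P.natDegree ∧ P.natDegree < 2 ^ (i + 1) := by
  classical
  simp only [primeBlock, Finset.mem_biUnion, mem_primesDeg, Finset.mem_Ico]
  constructor
  · rintro ⟨d, hd, h1, h2, rfl⟩; exact ⟨h1, h2, hd⟩
  · rintro ⟨h1, h2, hd⟩; exact ⟨_, hd, h1, h2, rfl⟩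

theorem sum_primeBlock (i : ℕ) (g : ℕ → ℝ) : ∑ P ∈ primeBlock F i, g P.natDegree =
    ∑ d ∈ Finset.Ico (2 ^ i) (2 ^ (i + 1)), (primesDeg F d).card * g d := by
  classical
  rw [primeBlock, Finset.sum_biUnion fun e _ e' _ hee => Finset.disjoint_left.2 fun P hP hP' =>
    hee ((mem_primesDeg.1 hP).2.2.symm.trans (mem_primesDeg.1 hP').2.2)]
  refine Finset.sum_congr rfl fun d _ => ?_
  rw [Finset.sum_congr rfl fun P hP => by rw [(mem_primesDeg.1 hP).2.2], Finset.sum_const,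
    nsmul_eq_mul]

theorem sum_sum_primeBlock (J : ℕ) (g : ℕ → ℝ) :
    ∑ i ∈ Finset.range J, ∑ P ∈ primeBlock F i, g P.natDegree =
      ∑ d ∈ Finset.Ico 1 (2 ^ J), (primesDeg F d).card * g d := by
  induction J with
  | zero => simp
  | succ J ih =>
    rw [Finset.sum_range_succ, ih, sum_primeBlock, Finset.sum_Ico_consecutive _ Nat.one_le_two_pow
      (Nat.pow_le_pow_right (by norm_num) (by omega))]

variable (F)

/-- `∑ 1 / |P|` over the `i`-th block of primes. -/
def blockSum (i : ℕ) : ℝ := ∑ P ∈ primeBlock F i, invSqrtCard F ^ (2 * P.natDegree)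

/-- `∑ 1 / |P| ^ 2` over the `i`-th block of primes. -/
def blockSumSq (i : ℕ) : ℝ := ∑ P ∈ primeBlock F i, (invSqrtCard F ^ (2 * P.natDegree)) ^ 2

theorem card_primesDeg_mul_le {d : ℕ} (hd : d ≠ 0) :
    (primesDeg F d).card * invSqrtCard F ^ (2 * d) ≤ (d : ℝ)⁻¹ := by
  have h : ((d * (primesDeg F d).card : ℕ) : ℝ) ≤ ((Nat.card F ^ d : ℕ) : ℝ) :=
    Nat.cast_le.2 (mul_card_primesDeg_le F hd)
  push_cast at h
  have hq : (0 : ℝ) < (Nat.card F : ℝ) ^ d := pow_pos (by have := two_le_card F; linarith) _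
  have hd0 : (0 : ℝ) < d := by positivity
  rw [invSqrtCard_pow_two_mul, ← div_eq_mul_inv, div_le_iff₀ hq, inv_mul_eq_div, le_div_iff₀ hd0]
  linarith

/-- The lower bound in the prime number theorem: the proper divisors of `d` are at most `d / 2`, so
primes of those degrees account for at most `q ^ (d / 2 + 1)` in `pow_card_le_sum_divisors`. -/
theorem le_card_primesDeg_mul {d : ℕ} (hd : d ≠ 0) :
    (d : ℝ)⁻¹ - (1 / 2) ^ ((d - 1) / 2) ≤ (primesDeg F d).card * invSqrtCard F ^ (2 * d) := by
  have hq2 : 2 ≤ Nat.card F := Finite.one_lt_card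
  have h1 : ∑ e ∈ d.properDivisors, e * (primesDeg F e).card ≤ Nat.card F ^ (d / 2 + 1) := by
    refine (Finset.sum_le_sum fun e he => mul_card_primesDeg_le F ?_).trans
      (Nat.geomSum_lt hq2 fun e he => ?_).le
    · exact (Nat.pos_of_mem_properDivisors he).ne'
    · rw [Nat.lt_succ_iff, Nat.le_div_iff_mul_le (by norm_num)]
      obtain ⟨⟨c, hc⟩, hlt⟩ := Nat.mem_properDivisors.1 he
      have : 2 ≤ c := by
        by_contra hc2
        interval_cases c <;> omega
      nlinarith
  have h2 := pow_card_le_sum_divisors F hd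
  rw [← Nat.cons_self_properDivisors hd, Finset.sum_cons] at h2
  have h3 : ((Nat.card F ^ d : ℕ) : ℝ) ≤
      ((Nat.card F ^ (d / 2 + 1) + d * (primesDeg F d).card : ℕ) : ℝ) := by
    exact_mod_cast h2.trans (by omega)
  push_cast at h3
  have hqr := two_le_card F
  have hq : (0 : ℝ) < (Nat.card F : ℝ) ^ d := pow_pos (by linarith) _
  have hd0 : (0 : ℝ) < d := by positivity
  have hd1 : (1 : ℝ) ≤ d := by exact_mod_cast Nat.one_le_iff_ne_zero.2 hd
  have h4 : (Nat.card F : ℝ) ^ (d / 2 + 1) ≤ (1 / 2) ^ ((d - 1) / 2) * (Nat.card F : ℝ) ^ d := by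
    have hs : d = d / 2 + 1 + (d - 1) / 2 := by omega
    conv_rhs => rw [show (Nat.card F : ℝ) ^ d =
      (Nat.card F : ℝ) ^ (d / 2 + 1) * (Nat.card F : ℝ) ^ ((d - 1) / 2) by rw [← pow_add, ← hs]]
    rw [mul_left_comm, ← mul_pow]
    refine le_mul_of_one_le_right (by positivity) (one_le_pow₀ (by linarith))
  rw [invSqrtCard_pow_two_mul, ← div_eq_mul_inv, le_div_iff₀ hq, sub_mul, inv_mul_eq_div,
    sub_le_iff_le_add, div_le_iff₀ hd0]
  have h5 : 0 ≤ (1 / 2 : ℝ) ^ ((d - 1) / 2) * (Nat.card F : ℝ) ^ d := by positivity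
  nlinarith

theorem blockSum_eq (i : ℕ) : blockSum F i =
    ∑ d ∈ Finset.Ico (2 ^ i) (2 ^ (i + 1)), (primesDeg F d).card * invSqrtCard F ^ (2 * d) :=
  sum_primeBlock i fun d => invSqrtCard F ^ (2 * d)

theorem blockSum_le_one (i : ℕ) : blockSum F i ≤ 1 := by
  rw [blockSum_eq]
  calc _ ≤ ∑ d ∈ Finset.Ico (2 ^ i) (2 ^ (i + 1)), ((2 : ℝ) ^ i)⁻¹ := by
        refine Finset.sum_le_sum fun d hd => ?_
        have hd1 := (Finset.mem_Ico.1 hd).1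
        have : 0 < 2 ^ i := by positivity
        refine (card_primesDeg_mul_le F (by omega)).trans (inv_anti₀ (by positivity) ?_)
        exact_mod_cast hd1
    _ = 1 := by
        rw [Finset.sum_const, Nat.card_Ico, pow_succ, mul_two, Nat.add_sub_cancel, nsmul_eq_mul]
        push_cast
        exact mul_inv_cancel₀ (by positivity)

theorem sum_Ico_inv_eq_harmonic (n : ℕ) :
    ∑ d ∈ Finset.Ico 1 (n + 1), (d : ℝ)⁻¹ = harmonic n := by
  rw [harmonic, Finset.sum_Ico_eq_sum_range]
  push_cast
  exact Finset.sum_congr (by simp) fun i _ => by rw [add_comm]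

/-- The upper bound in Mertens' theorem: `∑ 1 / |P|` over the primes of degree less than `2 ^ J`. -/
theorem sum_blockSum_le (J : ℕ) :
    ∑ i ∈ Finset.range J, blockSum F i ≤ 1 + Real.log (2 ^ J) := by
  have h := sum_sum_primeBlock (F := F) J fun d => invSqrtCard F ^ (2 * d)
  unfold blockSum
  rw [h]
  obtain ⟨n, hn⟩ : ∃ n, 2 ^ J = n + 1 := ⟨2 ^ J - 1, by have := Nat.one_le_two_pow (n := J); omega⟩
  have hn' : (2 : ℝ) ^ J = n + 1 := by exact_mod_cast hn
  rw [hn, hn']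
  calc _ ≤ ∑ d ∈ Finset.Ico 1 (n + 1), (d : ℝ)⁻¹ := Finset.sum_le_sum fun d hd =>
        card_primesDeg_mul_le F (by have := (Finset.mem_Ico.1 hd).1; omega)
    _ = harmonic n := sum_Ico_inv_eq_harmonic n
    _ ≤ 1 + Real.log n := harmonic_le_one_add_log n
    _ ≤ _ := by
      rcases n.eq_zero_or_pos with rfl | h0
      · simp
      · gcongr
        linarith

theorem sum_half_pow_div_two_le (M : ℕ) :
    ∑ n ∈ Finset.range M, (1 / 2 : ℝ) ^ (n / 2) ≤ 4 := by
  have key : ∀ m : ℕ, ∑ n ∈ Finset.range (2 * m), (1 / 2 : ℝ) ^ (n / 2) =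
      4 - 4 * (1 / 2) ^ m := by
    intro m
    induction m with
    | zero => simp
    | succ m ih =>
      rw [show 2 * (m + 1) = 2 * m + 1 + 1 by ring, Finset.sum_range_succ, Finset.sum_range_succ,
        ih, show (2 * m + 1) / 2 = m by omega, show 2 * m / 2 = m by omega]
      ring
  calc _ ≤ ∑ n ∈ Finset.range (2 * M), (1 / 2 : ℝ) ^ (n / 2) :=
        Finset.sum_le_sum_of_subset_of_nonneg (Finset.range_mono (by omega))
          fun _ _ _ => by positivity
    _ ≤ 4 := by rw [key]; linarith [show (0 : ℝ) ≤ 4 * (1 / 2) ^ M by positivity]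

/-- The lower bound in Mertens' theorem. -/
theorem le_sum_blockSum (J : ℕ) :
    Real.log (2 ^ J) - 4 ≤ ∑ i ∈ Finset.range J, blockSum F i := by
  have h := sum_sum_primeBlock (F := F) J fun d => invSqrtCard F ^ (2 * d)
  unfold blockSum
  rw [h]
  obtain ⟨n, hn⟩ : ∃ n, 2 ^ J = n + 1 := ⟨2 ^ J - 1, by have := Nat.one_le_two_pow (n := J); omega⟩
  have hn' : (2 : ℝ) ^ J = (n + 1 : ℕ) := by exact_mod_cast hn
  rw [hn, hn']
  have h1 : ∑ d ∈ Finset.Ico 1 (n + 1), (1 / 2 : ℝ) ^ ((d - 1) / 2) ≤ 4 := by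
    rw [Finset.sum_Ico_eq_sum_range]
    simpa using sum_half_pow_div_two_le n
  calc _ ≤ (harmonic n : ℝ) - ∑ d ∈ Finset.Ico 1 (n + 1), (1 / 2 : ℝ) ^ ((d - 1) / 2) :=
        sub_le_sub (log_add_one_le_harmonic n) h1
    _ = ∑ d ∈ Finset.Ico 1 (n + 1), ((d : ℝ)⁻¹ - (1 / 2) ^ ((d - 1) / 2)) := by
        rw [Finset.sum_sub_distrib, sum_Ico_inv_eq_harmonic]
    _ ≤ _ := Finset.sum_le_sum fun d hd =>
        le_card_primesDeg_mul F (by have := (Finset.mem_Ico.1 hd).1; omega)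

theorem sum_blockSumSq_le (J : ℕ) : ∑ i ∈ Finset.range J, blockSumSq F i ≤ 1 := by
  have h := sum_sum_primeBlock (F := F) J fun d => (invSqrtCard F ^ (2 * d)) ^ 2
  unfold blockSumSq
  rw [h]
  calc _ ≤ ∑ d ∈ Finset.Ico 1 (2 ^ J), (1 / 2 : ℝ) ^ d := by
        refine Finset.sum_le_sum fun d hd => ?_
        have hd1 := (Finset.mem_Ico.1 hd).1
        have h1 := card_primesDeg_mul_le F (d := d) (by omega)
        have h2 : (d : ℝ)⁻¹ ≤ 1 := inv_le_one_of_one_le₀ (by exact_mod_cast hd1)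
        have h3 : invSqrtCard F ^ (2 * d) ≤ (1 / 2) ^ d := by
          rw [pow_mul]
          exact pow_le_pow_left₀ (sq_nonneg _) (invSqrtCard_sq_le F) d
        have h4 : 0 ≤ invSqrtCard F ^ (2 * d) := pow_nonneg (invSqrtCard_pos F).le _
        nlinarith
    _ = 1 - 2 * (1 / 2 : ℝ) ^ (2 ^ J) := by
        rw [geom_sum_Ico (by norm_num) Nat.one_le_two_pow]
        ring
    _ ≤ 1 := by linarith [show (0 : ℝ) ≤ 2 * (1 / 2) ^ (2 ^ J) by positivity]

end Mertens

/-! ### Characters modulo `Q` and the twisted first moment -/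

section Monics

variable (F : Type u) [Field F] [Finite F]

/-- The monic polynomials of degree `n`, as a finset. -/
def monics (n : ℕ) : Finset F[X] :=
  (Set.toFinite (Set.range fun f : MonicDeg F n => f.1)).toFinset

variable {F}

theorem mem_monics {n : ℕ} {f : F[X]} : f ∈ monics F n ↔ f.Monic ∧ f.natDegree = n := by
  simp [monics]

variable (F) in
theorem card_monics (n : ℕ) : (monics F n).card = Nat.card F ^ n := by
  rw [← card_monicDeg n]
  have e : MonicDeg F n ≃ monics F n := Equiv.subtypeEquivRight fun f => mem_monics.symm
  rw [Nat.card_congr e, Nat.card_eq_fintype_card, Fintype.card_coe]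

end Monics

section Characters

variable {F : Type u} [Field F] {Q : F[X]}

theorem isUnit_mk_of_natDegree_lt (hQ : Irreducible Q) {f : F[X]} (hf : f ≠ 0)
    (h : f.natDegree < Q.natDegree) : IsUnit (Ideal.Quotient.mk (Ideal.span {Q}) f) := by
  have hc : IsCoprime Q f := hQ.coprime_iff_not_dvd.2 fun hd =>
    absurd (natDegree_le_of_dvd hd hf) (by omega)
  obtain ⟨a, b, hab⟩ := hc
  refine IsUnit.of_mul_eq_one (Ideal.Quotient.mk _ b) ?_
  rw [← map_mul, ← map_one (Ideal.Quotient.mk (Ideal.span {Q})), Ideal.Quotient.eq,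
    Ideal.mem_span_singleton]
  exact ⟨-a, by linear_combination hab⟩

theorem mk_eq_mk_iff {f g : F[X]} : Ideal.Quotient.mk (Ideal.span {Q}) f =
    Ideal.Quotient.mk (Ideal.span {Q}) g ↔ Q ∣ f - g := by
  rw [Ideal.Quotient.eq, Ideal.mem_span_singleton]

theorem eq_of_mk_eq_mk {f g : F[X]} (hf : f.natDegree < Q.natDegree)
    (hg : g.natDegree < Q.natDegree) (h : Ideal.Quotient.mk (Ideal.span {Q}) f =
    Ideal.Quotient.mk (Ideal.span {Q}) g) : f = g := by
  rw [mk_eq_mk_iff] at h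
  by_contra hne
  have := natDegree_le_of_dvd h (sub_ne_zero.2 hne)
  have := natDegree_sub_le f g
  omega

theorem card_quotient [Finite F] (hQ : Q ≠ 0) :
    Nat.card (F[X] ⧸ Ideal.span {Q}) = Nat.card F ^ Q.natDegree := by
  have h : Function.Bijective
      (fun r : degreeLT F Q.natDegree => Ideal.Quotient.mk (Ideal.span {Q}) r.1) := by
    constructor
    · rintro ⟨r, hr⟩ ⟨s, hs⟩ hrs
      rw [Subtype.mk_eq_mk]
      rw [mem_degreeLT] at hr hs
      rw [mk_eq_mk_iff] at hrs
      by_contra hne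
      have h1 := degree_le_of_dvd hrs (sub_ne_zero.2 hne)
      have h2 := degree_sub_le r s
      rw [← degree_eq_natDegree hQ] at hr hs
      exact absurd (h1.trans h2) (not_le.2 (max_lt hr hs))
    · intro a
      obtain ⟨r, hr, rfl⟩ := exists_degree_lt hQ a
      exact ⟨⟨r, mem_degreeLT.2 (by rwa [← degree_eq_natDegree hQ])⟩, rfl⟩
  rw [← Nat.card_congr (Equiv.ofBijective _ h), Nat.card_congr (degreeLTEquiv F _).toEquiv,
    Nat.card_fun, Nat.card_fin]

/-- The number of units modulo `Q`, which is also the number of characters (`card_dirChar`). -/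
def numChars (Q : F[X]) : ℕ := Nat.card (F[X] ⧸ Ideal.span {Q})ˣ

theorem numChars_add_one [Finite F] (hQ : Irreducible Q) :
    numChars Q + 1 = Nat.card F ^ Q.natDegree := by
  have : (Ideal.span {Q}).IsMaximal := PrincipalIdealRing.isMaximal_of_irreducible hQ
  let _ := Ideal.Quotient.field (Ideal.span {Q})
  have := finite_quotient hQ.ne_zero
  rw [numChars, Nat.card_units, card_quotient hQ.ne_zero]
  exact Nat.sub_add_cancel (Nat.one_le_pow _ _ Nat.card_pos)

/-- Orthogonality of the characters modulo `Q`. -/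
theorem sum_val_mul_conj [Finite F] (hQ : Q ≠ 0) [Fintype (DirChar Q)] {f g : F[X]}
    (hf : IsUnit (Ideal.Quotient.mk (Ideal.span {Q}) f))
    (hg : IsUnit (Ideal.Quotient.mk (Ideal.span {Q}) g))
    [Decidable (Ideal.Quotient.mk (Ideal.span {Q}) f = Ideal.Quotient.mk (Ideal.span {Q}) g)] :
    ∑ χ : DirChar Q, χ.val f * (starRingEnd ℂ) (χ.val g) =
      if Ideal.Quotient.mk (Ideal.span {Q}) f = Ideal.Quotient.mk (Ideal.span {Q}) g
        then (numChars Q : ℂ) else 0 := by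
  have := finite_quotient hQ
  obtain ⟨x, hx⟩ := hf
  obtain ⟨y, hy⟩ := hg
  have hterm : ∀ χ : DirChar Q, χ.val f * (starRingEnd ℂ) (χ.val g) = χ ((x * y⁻¹ : _ˣ) : _) := by
    intro χ
    have h1 : (starRingEnd ℂ) (χ.val g) = χ ((y⁻¹ : _ˣ) : _) := by
      rw [starRingEnd_apply, DirChar.val, ← hy, MulChar.star_apply',
        MulChar.inv_apply, Ring.inverse_unit]
    rw [h1, DirChar.val, ← hx, Units.val_mul, map_mul]
  simp_rw [hterm]
  have hNZ : NeZero ((Monoid.exponent (F[X] ⧸ Ideal.span {Q})ˣ : ℕ) : ℂ) :=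
    ⟨by exact_mod_cast Monoid.exponent_ne_zero_of_finite⟩
  split_ifs with h
  · have hxy : x = y := Units.ext (by rw [hx, hy, h])
    rw [hxy, mul_inv_cancel]
    simp only [Units.val_one, map_one, Finset.sum_const, Finset.card_univ, nsmul_eq_mul, mul_one]
    rw [numChars, ← MulChar.card_eq_card_units_of_hasEnoughRootsOfUnity (F[X] ⧸ Ideal.span {Q}) ℂ,
      Nat.card_eq_fintype_card]
  · have hne : ((x * y⁻¹ : (F[X] ⧸ Ideal.span {Q})ˣ) : F[X] ⧸ Ideal.span {Q}) ≠ 1 := by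
      intro h1
      have : x = y := by
        rw [← mul_inv_eq_one]; exact Units.ext h1
      exact h (by rw [← hx, ← hy, this])
    obtain ⟨χ, hχ⟩ := MulChar.exists_apply_ne_one_of_hasEnoughRootsOfUnity _ ℂ hne
    refine eq_zero_of_mul_eq_self_left hχ ?_
    simp only [Finset.mul_sum, ← MulChar.mul_apply]
    exact Fintype.sum_bijective _ (Group.mulLeft_bijective χ) _ _ fun χ' => rfl

theorem val_mul (χ : DirChar Q) (f g : F[X]) : χ.val (f * g) = χ.val f * χ.val g := by
  simp only [DirChar.val, map_mul]

theorem val_mul_conj_self [Finite F] (hQ : Q ≠ 0) (χ : DirChar Q) {f : F[X]}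
    (hf : IsUnit (Ideal.Quotient.mk (Ideal.span {Q}) f)) :
    χ.val f * (starRingEnd ℂ) (χ.val f) = 1 := by
  have := finite_quotient hQ
  rw [starRingEnd_apply, DirChar.val, MulChar.star_apply', ← MulChar.mul_apply, mul_inv_cancel,
    MulChar.one_apply hf]

theorem val_principal {f : F[X]} (hf : IsUnit (Ideal.Quotient.mk (Ideal.span {Q}) f)) :
    DirChar.val (1 : DirChar Q) f = 1 := MulChar.one_apply hf

variable [Finite F]

theorem coeffL_eq_sum (χ : DirChar Q) (n : ℕ) : χ.coeffL n = ∑ h ∈ monics F n, χ.val h := by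
  have := Fintype.ofFinite (MonicDeg F n)
  rw [DirChar.coeffL, finsum_eq_sum_of_fintype]
  refine Finset.sum_bij (fun f _ => f.1) (fun f _ => mem_monics.2 f.2)
    (fun f _ g _ h => Subtype.ext h) (fun f hf => ⟨⟨f, mem_monics.1 hf⟩, Finset.mem_univ _, rfl⟩)
    fun f _ => rfl

/-- The polynomial of degree `< deg Q` in `v = q ^ (-1/2)` which represents `L(1/2, χ)` for
non-principal `χ`. It is finite for the principal character too, where `DirChar.L` diverges. -/
def DirChar.lPoly (χ : DirChar Q) : ℂ :=
  ∑ n ∈ Finset.range Q.natDegree, ∑ h ∈ monics F n, (invSqrtCard F : ℂ) ^ n * χ.val h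

theorem L_half_eq_lPoly (hQ : Q ≠ 0) {χ : DirChar Q} (hχ : χ ≠ 1) : χ.L (1 / 2) = χ.lPoly := by
  have hv : (Nat.card F : ℂ) ^ (-(1 / 2 : ℂ)) = invSqrtCard F := by
    rw [Complex.cpow_neg, invSqrtCard, Complex.ofReal_inv, Real.sqrt_eq_rpow,
      Complex.ofReal_cpow (Nat.cast_nonneg _)]
    norm_num
  rw [L_eq_sum hQ hχ, DirChar.lPoly, hv]
  refine Finset.sum_congr rfl fun n _ => ?_
  rw [coeffL_eq_sum, ← Finset.mul_sum, mul_comm]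

theorem card_pow_eq {F : Type u} (n : ℕ) :
    ((Nat.card F ^ n : ℕ) : ℝ) = (invSqrtCard F)⁻¹ ^ (2 * n) := by
  rw [inv_pow, invSqrtCard_pow_two_mul, inv_inv, Nat.cast_pow]

theorem numChars_eq (hQ : Irreducible Q) :
    (numChars Q : ℝ) = (invSqrtCard F)⁻¹ ^ (2 * Q.natDegree) - 1 := by
  rw [← card_pow_eq, ← numChars_add_one hQ]
  push_cast
  ring

variable [Fintype (DirChar Q)]

theorem sum_lPoly_mul (hQ : Irreducible Q) {f g : F[X]}
    (hf : IsUnit (Ideal.Quotient.mk (Ideal.span {Q}) f))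
    (hg : IsUnit (Ideal.Quotient.mk (Ideal.span {Q}) g))
    [DecidablePred fun h : F[X] => Ideal.Quotient.mk (Ideal.span {Q}) (h * f) =
      Ideal.Quotient.mk (Ideal.span {Q}) g] :
    ∑ χ : DirChar Q, χ.lPoly * (χ.val f * (starRingEnd ℂ) (χ.val g)) =
      numChars Q * ∑ n ∈ Finset.range Q.natDegree, ∑ h ∈ monics F n,
        if Ideal.Quotient.mk (Ideal.span {Q}) (h * f) = Ideal.Quotient.mk (Ideal.span {Q}) g
        then (invSqrtCard F : ℂ) ^ n else 0 := by
  simp_rw [DirChar.lPoly, Finset.sum_mul]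
  rw [Finset.sum_comm, Finset.mul_sum]
  refine Finset.sum_congr rfl fun n hn => ?_
  rw [Finset.sum_comm, Finset.mul_sum]
  refine Finset.sum_congr rfl fun h hh => ?_
  have hu : IsUnit (Ideal.Quotient.mk (Ideal.span {Q}) (h * f)) := by
    obtain ⟨h1, h2⟩ := mem_monics.1 hh
    rw [map_mul]
    exact (isUnit_mk_of_natDegree_lt hQ h1.ne_zero (h2 ▸ Finset.mem_range.1 hn)).mul hf
  have := sum_val_mul_conj hQ.ne_zero hu hg
  simp_rw [mul_assoc, ← Finset.mul_sum]
  simp_rw [val_mul, mul_assoc] at this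
  rw [this]
  split_ifs <;> ring

open Classical in
/-- The twisted first moment. Besides `h = g / f`, the congruence `h f ≡ g` has at most one
solution `h` of degree less than `deg Q`, and that one has degree at least `deg Q - deg f`. -/
theorem norm_sum_lPoly_sub_le (hQ : Irreducible Q) {f g : F[X]} (hf : f.Monic) (hg : g.Monic)
    (hfQ : f.natDegree < Q.natDegree) (hgQ : g.natDegree < Q.natDegree) :
    ‖∑ χ : DirChar Q, χ.lPoly * (χ.val f * (starRingEnd ℂ) (χ.val g)) -
      numChars Q * (if f ∣ g then (invSqrtCard F : ℂ) ^ (g.natDegree - f.natDegree) else 0)‖ ≤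
      numChars Q * invSqrtCard F ^ (Q.natDegree - f.natDegree) := by
  have hfu := isUnit_mk_of_natDegree_lt hQ hf.ne_zero hfQ
  have hgu := isUnit_mk_of_natDegree_lt hQ hg.ne_zero hgQ
  have hv := invSqrtCard_pos F
  rw [sum_lPoly_mul hQ hfu hgu, ← mul_sub, norm_mul, Complex.norm_natCast]
  refine mul_le_mul_of_nonneg_left ?_ (Nat.cast_nonneg _)
  have huniq : ∀ h h' : F[X], h.natDegree < Q.natDegree → h'.natDegree < Q.natDegree →
      Ideal.Quotient.mk (Ideal.span {Q}) (h * f) = Ideal.Quotient.mk (Ideal.span {Q}) g →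
      Ideal.Quotient.mk (Ideal.span {Q}) (h' * f) = Ideal.Quotient.mk (Ideal.span {Q}) g →
      h = h' := by
    intro h h' hd hd' e e'
    refine eq_of_mk_eq_mk hd hd' (hfu.mul_left_injective ?_)
    simp only [← map_mul]
    rw [e, e']
  by_cases hex : ∃ n ∈ Finset.range Q.natDegree, ∃ h ∈ monics F n,
      Ideal.Quotient.mk (Ideal.span {Q}) (h * f) = Ideal.Quotient.mk (Ideal.span {Q}) g
  · obtain ⟨n, hn, h, hh, he⟩ := hex
    obtain ⟨hm, hdeg⟩ := mem_monics.1 hh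
    have hnQ := Finset.mem_range.1 hn
    have hsum : ∑ n ∈ Finset.range Q.natDegree, ∑ h ∈ monics F n,
        (if Ideal.Quotient.mk (Ideal.span {Q}) (h * f) = Ideal.Quotient.mk (Ideal.span {Q}) g
        then (invSqrtCard F : ℂ) ^ n else 0) = (invSqrtCard F : ℂ) ^ n := by
      rw [Finset.sum_eq_single_of_mem n hn, Finset.sum_eq_single_of_mem h hh, if_pos he]
      · intro h' hh' hne
        obtain ⟨hm', hdeg'⟩ := mem_monics.1 hh'
        exact if_neg fun he' => hne (huniq _ _ (by omega) (by omega) he' he)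
      · intro n' hn' hne
        refine Finset.sum_eq_zero fun h' hh' => if_neg fun he' => hne ?_
        obtain ⟨hm', hdeg'⟩ := mem_monics.1 hh'
        have := Finset.mem_range.1 hn'
        rw [← hdeg', ← hdeg, huniq h' h (by omega) (by omega) he' he]
    rw [hsum]
    have hdm : (h * f).natDegree = n + f.natDegree := by rw [hm.natDegree_mul hf, hdeg]
    by_cases hlt : n + f.natDegree < Q.natDegree
    · have hgf : h * f = g := eq_of_mk_eq_mk (by omega) hgQ he
      rw [if_pos ⟨h, by rw [← hgf, mul_comm]⟩, ← hgf, hdm, Nat.add_sub_cancel, sub_self, norm_zero]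
      positivity
    · rw [if_neg, sub_zero, norm_pow, Complex.norm_real, Real.norm_of_nonneg hv.le]
      · exact pow_le_pow_of_le_one hv.le ((invSqrtCard_le F).trans (by norm_num)) (by omega)
      · rintro ⟨c, hc⟩
        have hcm : c.Monic := hf.of_mul_monic_left (hc ▸ hg)
        have hcd : g.natDegree = f.natDegree + c.natDegree := by rw [hc, hf.natDegree_mul hcm]
        have := huniq h c (by omega) (by omega) he (by rw [hc, mul_comm])
        rw [← this] at hcd
        omega
  · push Not at hex
    rw [Finset.sum_eq_zero fun n hn => Finset.sum_eq_zero fun h hh => if_neg (hex n hn h hh),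
      if_neg, sub_zero, norm_zero]
    · positivity
    · rintro ⟨c, hc⟩
      have hcm : c.Monic := hf.of_mul_monic_left (hc ▸ hg)
      have hcd : g.natDegree = f.natDegree + c.natDegree := by rw [hc, hf.natDegree_mul hcm]
      exact hex c.natDegree (Finset.mem_range.2 (by omega)) c (mem_monics.2 ⟨hcm, rfl⟩)
        (by rw [hc, mul_comm])

end Characters

/-! ### Counting solutions of `h f ≡ h' g` modulo `Q` -/

section SecondMoment

variable {F : Type u} [Field F]

/-- For coprime `f`, `g` the polynomials `u f - w g` with `deg u < n` and `deg w < m` exhaust all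
degrees below `n + deg f`, as soon as `n ≥ deg g` and `m ≥ deg f`. -/
theorem exists_mul_sub_mul_eq {f g : F[X]} (hf : f.Monic) (hg : g.Monic) (hfg : IsCoprime f g)
    {n m : ℕ} (hn : g.natDegree ≤ n) (hm : f.natDegree ≤ m) {r : F[X]}
    (hr : r.degree < (n + f.natDegree : ℕ)) :
    ∃ u w : F[X], u.degree < n ∧ w.degree < m ∧ u * f - w * g = r := by
  obtain ⟨s, t, hst⟩ := hfg
  set w := (-(r * t)) %ₘ f with hw
  set c := (-(r * t)) /ₘ f with hc
  have hdm : w + f * c = -(r * t) := modByMonic_add_div _ f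
  have hwd : w.degree < f.degree := degree_modByMonic_lt _ hf
  have hfd : f.degree = (f.natDegree : WithBot ℕ) := degree_eq_natDegree hf.ne_zero
  have hgd : g.degree = (g.natDegree : WithBot ℕ) := degree_eq_natDegree hg.ne_zero
  have heq : (r * s - c * g) * f - w * g = r := by
    linear_combination r * hst - g * hdm
  refine ⟨r * s - c * g, w, ?_, ?_, heq⟩
  · have h1 : (w * g).degree < (n + f.natDegree : ℕ) := by
      rcases eq_or_ne w 0 with h0 | h0
      · rw [h0, zero_mul, degree_zero]; exact WithBot.bot_lt_coe _
      · rw [degree_mul, degree_eq_natDegree h0, hgd, ← Nat.cast_add]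
        rw [degree_eq_natDegree h0, hfd] at hwd
        have : w.natDegree < f.natDegree := by exact_mod_cast hwd
        exact_mod_cast (by omega : w.natDegree + g.natDegree < n + f.natDegree)
    have h2 : ((r * s - c * g) * f).degree < (n + f.natDegree : ℕ) := by
      rw [show (r * s - c * g) * f = r + w * g by linear_combination heq]
      exact (degree_add_le _ _).trans_lt (max_lt hr h1)
    rcases eq_or_ne (r * s - c * g) 0 with h0 | h0
    · rw [h0, degree_zero]; exact WithBot.bot_lt_coe _
    · rw [degree_mul, degree_eq_natDegree h0, hfd, ← Nat.cast_add] at h2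
      rw [degree_eq_natDegree h0]
      have : (r * s - c * g).natDegree + f.natDegree < n + f.natDegree := by exact_mod_cast h2
      exact_mod_cast (by omega : (r * s - c * g).natDegree < n)
  · rw [hfd] at hwd
    exact hwd.trans_le (by exact_mod_cast hm)

variable [Finite F] {Q : F[X]}

open Classical in
/-- The number of pairs `(h, h')` of monic polynomials of degrees `n` and `m` with
`h f ≡ h' g` modulo `Q`. -/
def solCount (Q f g : F[X]) (n m : ℕ) : ℕ :=
  ((monics F n ×ˢ monics F m).filter fun p => Ideal.Quotient.mk (Ideal.span {Q}) (p.1 * f) =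
    Ideal.Quotient.mk (Ideal.span {Q}) (p.2 * g)).card

theorem add_mem_monics {n : ℕ} {h u : F[X]} (hh : h ∈ monics F n) (hu : u.degree < n) :
    h + u ∈ monics F n := by
  obtain ⟨h1, rfl⟩ := mem_monics.1 hh
  rw [← degree_eq_natDegree h1.ne_zero] at hu
  exact mem_monics.2 ⟨h1.add_of_left hu, natDegree_add_eq_left_of_degree_lt hu⟩

/-- When every class modulo `Q` is represented by some `u f - w g`, the condition
`h f ≡ h' g` is equidistributed. -/
theorem solCount_mul_eq (hQ : Q ≠ 0) {f g : F[X]} {n m : ℕ}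
    (hrep : ∀ r : F[X], r.degree < Q.degree →
      ∃ u w : F[X], u.degree < n ∧ w.degree < m ∧ u * f - w * g = r) :
    solCount Q f g n m * Nat.card F ^ Q.natDegree = Nat.card F ^ (n + m) := by
  classical
  have := finite_quotient hQ
  have := Fintype.ofFinite (F[X] ⧸ Ideal.span {Q})
  let Ψ : F[X] × F[X] → F[X] ⧸ Ideal.span {Q} := fun p =>
    Ideal.Quotient.mk (Ideal.span {Q}) (p.1 * f - p.2 * g)
  let S := monics F n ×ˢ monics F m
  have hle : ∀ c d, (S.filter fun p => Ψ p = c).card ≤ (S.filter fun p => Ψ p = d).card := by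
    intro c d
    obtain ⟨r, hr, hrd⟩ := exists_degree_lt hQ (d - c)
    obtain ⟨u, w, hu, hw, huw⟩ := hrep r hr
    refine Finset.card_le_card_of_injOn (fun p => (p.1 + u, p.2 + w)) ?_ ?_
    · rintro ⟨h, h'⟩ hp
      simp only [S, Finset.coe_filter, Finset.mem_product, Set.mem_ofPred_eq] at hp ⊢
      obtain ⟨⟨h1, h2⟩, h3⟩ := hp
      refine ⟨⟨add_mem_monics h1 hu, add_mem_monics h2 hw⟩, ?_⟩
      simp only [Ψ] at h3 ⊢
      rw [show (h + u) * f - (h' + w) * g = (h * f - h' * g) + (u * f - w * g) by ring, map_add, h3,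
        huw, hrd]
      ring
    · rintro ⟨h, h'⟩ - ⟨k, k'⟩ - heq
      simpa using heq
  have hcard : S.card = Nat.card F ^ (n + m) := by
    rw [Finset.card_product, card_monics, card_monics, pow_add]
  have h0 : solCount Q f g n m = (S.filter fun p => Ψ p = 0).card := by
    rw [solCount]
    congr 1
    refine Finset.filter_congr fun p _ => ?_
    simp only [Ψ]
    rw [map_sub, sub_eq_zero]
  rw [← hcard, Finset.card_eq_sum_card_fiberwise (f := Ψ) (t := Finset.univ)
    (fun _ _ => Finset.mem_coe.2 (Finset.mem_univ _)),
    Finset.sum_congr rfl fun c _ => le_antisymm (hle c 0) (hle 0 c), Finset.sum_const, h0,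
    Finset.card_univ, ← Nat.card_eq_fintype_card, card_quotient hQ, smul_eq_mul, mul_comm]

/-- Since `g` is invertible modulo `Q`, the component `h` of a solution determines `h'`. -/
theorem solCount_le_left (hQ : Irreducible Q) {f g : F[X]} (hg : g.Monic)
    (hgQ : g.natDegree < Q.natDegree) {n m : ℕ} (hm : m < Q.natDegree) :
    solCount Q f g n m ≤ Nat.card F ^ n := by
  classical
  rw [← card_monics, solCount]
  refine Finset.card_le_card_of_injOn Prod.fst ?_ ?_
  · intro p hp
    simp only [Finset.coe_filter, Finset.mem_product, Set.mem_ofPred_eq] at hp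
    exact hp.1.1
  · rintro ⟨h, h'⟩ hp ⟨k, k'⟩ hp' (rfl : h = k)
    simp only [Finset.coe_filter, Finset.mem_product, Set.mem_ofPred_eq] at hp hp'
    have hgu := isUnit_mk_of_natDegree_lt hQ hg.ne_zero hgQ
    have e : h' = k' := by
      refine eq_of_mk_eq_mk (by rw [(mem_monics.1 hp.1.2).2]; exact hm)
        (by rw [(mem_monics.1 hp'.1.2).2]; exact hm) (hgu.mul_left_injective ?_)
      simp only [← map_mul]
      rw [← hp.2, ← hp'.2]
    rw [e]

theorem solCount_comm (f g : F[X]) (n m : ℕ) : solCount Q f g n m = solCount Q g f m n := by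
  classical
  unfold solCount
  refine Finset.card_bij (fun p _ => p.swap) ?_ ?_ ?_
  · rintro ⟨h, h'⟩ hp
    simp only [Finset.mem_filter, Finset.mem_product, Prod.swap] at hp ⊢
    exact ⟨⟨hp.1.2, hp.1.1⟩, hp.2.symm⟩
  · rintro p - p' - h; exact Prod.swap_injective h
  · rintro ⟨h, h'⟩ hp
    simp only [Finset.mem_filter, Finset.mem_product] at hp
    refine ⟨(h', h), ?_, rfl⟩
    simp only [Finset.mem_filter, Finset.mem_product]
    exact ⟨⟨hp.1.2, hp.1.1⟩, hp.2.symm⟩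

/-- In small degrees the congruence is an equality, with solutions `(g c, f c)`. -/
theorem solCount_of_lt {f g : F[X]} (hf : f.Monic) (hg : g.Monic) (hfg : IsCoprime f g)
    {n m : ℕ} (hn : n + f.natDegree < Q.natDegree) (hm : m + g.natDegree < Q.natDegree) :
    solCount Q f g n m = if n + f.natDegree = m + g.natDegree ∧ g.natDegree ≤ n
      then Nat.card F ^ (n - g.natDegree) else 0 := by
  classical
  have key : ∀ h ∈ monics F n, ∀ h' ∈ monics F m, Ideal.Quotient.mk (Ideal.span {Q}) (h * f) =
      Ideal.Quotient.mk (Ideal.span {Q}) (h' * g) → h * f = h' * g := by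
    intro h hh h' hh' he
    obtain ⟨h1, h2⟩ := mem_monics.1 hh
    obtain ⟨h3, h4⟩ := mem_monics.1 hh'
    exact eq_of_mk_eq_mk (by rw [h1.natDegree_mul hf, h2]; exact hn)
      (by rw [h3.natDegree_mul hg, h4]; exact hm) he
  split_ifs with hc
  · rw [← card_monics, solCount]
    symm
    refine Finset.card_bij (fun c _ => (g * c, f * c)) ?_ ?_ ?_
    · intro c hcm
      obtain ⟨h1, h2⟩ := mem_monics.1 hcm
      simp only [Finset.mem_filter, Finset.mem_product]
      refine ⟨⟨mem_monics.2 ⟨hg.mul h1, ?_⟩, mem_monics.2 ⟨hf.mul h1, ?_⟩⟩, by ring_nf⟩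
      · rw [hg.natDegree_mul h1]; omega
      · rw [hf.natDegree_mul h1]; omega
    · intro c _ c' _ h
      exact mul_left_cancel₀ hg.ne_zero (Prod.ext_iff.1 h).1
    · rintro ⟨h, h'⟩ hp
      simp only [Finset.mem_filter, Finset.mem_product] at hp
      have he := key h hp.1.1 h' hp.1.2 hp.2
      obtain ⟨h1, h2⟩ := mem_monics.1 hp.1.1
      have hd : g ∣ h := hfg.symm.dvd_of_dvd_mul_right ⟨h', by rw [he, mul_comm]⟩
      obtain ⟨c, rfl⟩ := hd
      have hcm : c.Monic := hg.of_mul_monic_left h1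
      rw [hg.natDegree_mul hcm] at h2
      refine ⟨c, mem_monics.2 ⟨hcm, by omega⟩, Prod.ext rfl ?_⟩
      refine mul_left_cancel₀ hg.ne_zero ?_
      change g * (f * c) = g * h'
      linear_combination he
  · rw [solCount, Finset.card_eq_zero, Finset.filter_eq_empty_iff]
    rintro ⟨h, h'⟩ hp he
    rw [Finset.mem_product] at hp
    have he := key h hp.1 h' hp.2 he
    obtain ⟨h1, h2⟩ := mem_monics.1 hp.1
    obtain ⟨h3, h4⟩ := mem_monics.1 hp.2
    refine hc ⟨?_, ?_⟩
    · rw [← h2, ← h4, ← h1.natDegree_mul hf, ← h3.natDegree_mul hg, he]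
    · have hd : g ∣ h := hfg.symm.dvd_of_dvd_mul_right ⟨h', by rw [he, mul_comm]⟩
      rw [← h2]
      exact natDegree_le_of_dvd hd h1.ne_zero

/-- Away from small degrees, the number of solutions deviates little from its mean. -/
theorem abs_solCount_sub_le (hQ : Irreducible Q) {f g : F[X]} (hf : f.Monic) (hg : g.Monic)
    (hfg : IsCoprime f g) (hN : f.natDegree + g.natDegree < Q.natDegree) {n m : ℕ}
    (hn : n < Q.natDegree) (hm : m < Q.natDegree)
    (hnm : ¬ (n + f.natDegree < Q.natDegree ∧ m + g.natDegree < Q.natDegree)) :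
    |invSqrtCard F ^ (n + m) * (numChars Q * solCount Q f g n m - (Nat.card F ^ (n + m) : ℕ))| ≤
      (invSqrtCard F)⁻¹ ^ (Q.natDegree + 2 * (f.natDegree + g.natDegree)) := by
  set v := invSqrtCard F with hv
  have hv0 : 0 < v := invSqrtCard_pos F
  have hv1 : 1 ≤ v⁻¹ := (one_le_inv₀ hv0).2 ((invSqrtCard_le F).trans (by norm_num))
  have hvv : v * v⁻¹ = 1 := mul_inv_cancel₀ hv0.ne'
  set N := Q.natDegree with hNdef
  set a := f.natDegree
  set b := g.natDegree
  -- if `b ≤ n` and `a ≤ m` the count equals its mean; otherwise it and its mean are both small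
  by_cases hI : b ≤ n ∧ a ≤ m
  · have hcount : solCount Q f g n m * Nat.card F ^ N = Nat.card F ^ (n + m) := by
      refine solCount_mul_eq hQ.ne_zero fun r hr => ?_
      rw [degree_eq_natDegree hQ.ne_zero] at hr
      by_cases h1 : n + a < N
      · have h2 : N ≤ m + b := by
          by_contra h2; exact hnm ⟨h1, by omega⟩
        obtain ⟨u, w, hu, hw, huw⟩ := exists_mul_sub_mul_eq hg hf hfg.symm hI.2 hI.1
          (r := -r) (by rw [degree_neg]; exact hr.trans_le (by exact_mod_cast h2))
        exact ⟨w, u, hw, hu, by linear_combination -huw⟩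
      · exact exists_mul_sub_mul_eq hf hg hfg hI.1 hI.2
          (hr.trans_le (by exact_mod_cast (by omega : N ≤ n + a)))
    have hc : (solCount Q f g n m : ℝ) * v⁻¹ ^ (2 * N) = v⁻¹ ^ (2 * (n + m)) := by
      rw [← card_pow_eq, ← card_pow_eq, ← hcount]; push_cast; ring
    rw [numChars_eq hQ, card_pow_eq, ← hc]
    have e : v ^ (n + m) * ((v⁻¹ ^ (2 * N) - 1) * (solCount Q f g n m : ℝ) -
        (solCount Q f g n m : ℝ) * v⁻¹ ^ (2 * N)) = -(v ^ (n + m) * solCount Q f g n m) := by ring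
    rw [e, abs_neg, abs_of_nonneg (by positivity)]
    have hle : (solCount Q f g n m : ℝ) ≤ v⁻¹ ^ (n + m) := by
      have h1 : v⁻¹ ^ (2 * (n + m)) ≤ v⁻¹ ^ (n + m) * v⁻¹ ^ (2 * N) := by
        rw [← pow_add]
        exact pow_le_pow_right₀ hv1 (by omega)
      rw [← hc] at h1
      exact le_of_mul_le_mul_right h1 (by positivity)
    calc v ^ (n + m) * (solCount Q f g n m : ℝ) ≤ v ^ (n + m) * v⁻¹ ^ (n + m) := by gcongr
      _ = 1 := by rw [← mul_pow, hvv, one_pow]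
      _ ≤ _ := one_le_pow₀ hv1
  · have hsmall : ∃ s t, s + t = n + m ∧ s ≤ a + b ∧ t < N ∧ N ≤ t + a + b ∧
        (solCount Q f g n m : ℝ) ≤ v⁻¹ ^ (2 * s) := by
      by_cases hb : b ≤ n
      · refine ⟨m, n, by omega, by omega, hn, by omega, ?_⟩
        rw [← card_pow_eq, solCount_comm]
        exact_mod_cast solCount_le_left hQ hf (by omega) hn
      · refine ⟨n, m, by omega, by omega, hm, by omega, ?_⟩
        rw [← card_pow_eq]
        exact_mod_cast solCount_le_left hQ hg (by omega) hm
    obtain ⟨s, t, hst, hs, ht, htN, hle⟩ := hsmall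
    rw [card_pow_eq, ← hst, numChars_eq hQ]
    set R := (solCount Q f g n m : ℝ)
    have hR : 0 ≤ R := Nat.cast_nonneg _
    have hNpos : 1 ≤ v⁻¹ ^ (2 * N) := one_le_pow₀ hv1
    have b1 : v ^ (s + t) * ((v⁻¹ ^ (2 * N) - 1) * R) ≤ v⁻¹ ^ (N + 2 * (a + b)) := by
      calc _ ≤ v ^ (s + t) * (v⁻¹ ^ (2 * N) * v⁻¹ ^ (2 * s)) := by gcongr; linarith
        _ ≤ v ^ (s + t) * v⁻¹ ^ (s + t + (N + 2 * (a + b))) := by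
          gcongr
          rw [← pow_add]
          exact pow_le_pow_right₀ hv1 (by omega)
        _ = _ := by rw [pow_add v⁻¹ (s + t), ← mul_assoc, ← mul_pow, hvv, one_pow, one_mul]
    have b2 : v ^ (s + t) * v⁻¹ ^ (2 * (s + t)) ≤ v⁻¹ ^ (N + 2 * (a + b)) := by
      rw [two_mul (s + t), pow_add v⁻¹, ← mul_assoc, ← mul_pow, hvv, one_pow, one_mul]
      exact pow_le_pow_right₀ hv1 (by omega)
    have b3 : 0 ≤ v ^ (s + t) * ((v⁻¹ ^ (2 * N) - 1) * R) := by
      have : 0 ≤ v⁻¹ ^ (2 * N) - 1 := by linarith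
      positivity
    have b4 : 0 ≤ v ^ (s + t) * v⁻¹ ^ (2 * (s + t)) := by positivity
    rw [mul_sub, abs_le]
    constructor <;> linarith

end SecondMoment

/-! ### The second moment of `L(1/2, χ)` twisted by a short monomial -/

section SecondMoment

variable {F : Type u} [Field F] [Finite F] {Q : F[X]}

/-- The constant `1 / (q ^ (1/2) - 1) ^ 2` in the lower order term of the second moment. -/
def secondMomentConst (F : Type u) : ℝ := (((invSqrtCard F)⁻¹ - 1)⁻¹) ^ 2

variable (F) in
theorem secondMomentConst_le : secondMomentConst F ≤ 9 := by
  have h1 : (4 / 3 : ℝ) ≤ (invSqrtCard F)⁻¹ := by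
    rw [le_inv_comm₀ (by norm_num) (invSqrtCard_pos F)]
    exact (invSqrtCard_le F).trans (by norm_num)
  have h2 : ((invSqrtCard F)⁻¹ - 1)⁻¹ ≤ 3 := by
    rw [inv_le_comm₀ (by linarith) (by norm_num)]
    linarith
  have h3 : 0 ≤ ((invSqrtCard F)⁻¹ - 1)⁻¹ := inv_nonneg.2 (by linarith)
  unfold secondMomentConst
  nlinarith

/-- The counts of `solCount`, centred at their means and summed with the weights of the second
moment. The pairs of small degrees contribute the solutions of `h f = h' g`, which exist for
`deg Q - deg f - deg g` values of `n`, minus a geometric sum of means, which is the term with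
`secondMomentConst`. -/
theorem abs_sum_solCount_sub_le (hQ : Irreducible Q) {f g : F[X]} (hf : f.Monic) (hg : g.Monic)
    (hfg : IsCoprime f g) (hN : f.natDegree + g.natDegree < Q.natDegree) :
    |∑ n ∈ Finset.range Q.natDegree, ∑ m ∈ Finset.range Q.natDegree,
        invSqrtCard F ^ (n + m) * (numChars Q * solCount Q f g n m - (Nat.card F ^ (n + m) : ℕ)) -
      (numChars Q * ((Q.natDegree : ℝ) - (f.natDegree + g.natDegree)) -
        secondMomentConst F * (invSqrtCard F)⁻¹ ^ (2 * Q.natDegree)) *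
          invSqrtCard F ^ (f.natDegree + g.natDegree)| ≤
      ((Q.natDegree : ℝ) ^ 2 + 18) *
        (invSqrtCard F)⁻¹ ^ (Q.natDegree + 2 * (f.natDegree + g.natDegree)) := by
  classical
  have herr := fun n m => abs_solCount_sub_le hQ hf hg hfg hN (n := n) (m := m)
  have hmain := fun n m => solCount_of_lt (Q := Q) hf hg hfg (n := n) (m := m)
  have hcardpow := fun n => card_pow_eq (F := F) n
  have hκ := secondMomentConst_le F
  have hκ0 : 0 ≤ secondMomentConst F := sq_nonneg _
  unfold secondMomentConst at hκ hκ0 ⊢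
  set v := invSqrtCard F with hv
  have hv0 : 0 < v := invSqrtCard_pos F
  have hv1 : 1 < v⁻¹ := (one_lt_inv₀ hv0).2 ((invSqrtCard_le F).trans_lt (by norm_num))
  have hvv : v * v⁻¹ = 1 := mul_inv_cancel₀ hv0.ne'
  set N := Q.natDegree with hNdef
  set a := f.natDegree
  set b := g.natDegree
  set Φ : ℝ := (numChars Q : ℝ)
  set t : ℕ → ℕ → ℝ := fun n m =>
    v ^ (n + m) * (Φ * solCount Q f g n m - (Nat.card F ^ (n + m) : ℕ)) with ht
  set w := v⁻¹ with hw
  set B := w ^ (N + 2 * (a + b))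
  have hsplit : ∑ n ∈ Finset.range N, ∑ m ∈ Finset.range N, t n m =
      ∑ n ∈ Finset.range (N - a), ∑ m ∈ Finset.range (N - b), t n m +
      ∑ p ∈ (Finset.range N ×ˢ Finset.range N).filter
        (fun p => ¬ (p.1 + a < N ∧ p.2 + b < N)), t p.1 p.2 := by
    rw [← Finset.sum_product', ← Finset.sum_product',
      ← Finset.sum_filter_add_sum_filter_not _ (fun p : ℕ × ℕ => p.1 + a < N ∧ p.2 + b < N)]
    congr 1
    refine Finset.sum_congr (Finset.ext fun p => ?_) fun _ _ => rfl
    simp only [Finset.mem_filter, Finset.mem_product, Finset.mem_range]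
    omega
  have hrest : |∑ p ∈ (Finset.range N ×ˢ Finset.range N).filter
      (fun p => ¬ (p.1 + a < N ∧ p.2 + b < N)), t p.1 p.2| ≤ (N : ℝ) ^ 2 * B := by
    refine (Finset.abs_sum_le_sum_abs _ _).trans ?_
    refine (Finset.sum_le_card_nsmul _ _ B fun p hp => ?_).trans ?_
    · simp only [Finset.mem_filter, Finset.mem_product, Finset.mem_range] at hp
      exact herr p.1 p.2 hp.1.1 hp.1.2 hp.2
    · rw [nsmul_eq_mul]
      have h1 : ((Finset.range N ×ˢ Finset.range N).filter
          (fun p => ¬ (p.1 + a < N ∧ p.2 + b < N))).card ≤ N ^ 2 := by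
        refine (Finset.card_filter_le _ _).trans ?_
        rw [Finset.card_product, Finset.card_range, sq]
      have h2 : 0 ≤ B := by positivity
      gcongr
      exact_mod_cast h1
  have hbox : ∑ n ∈ Finset.range (N - a), ∑ m ∈ Finset.range (N - b), t n m =
      Φ * ((N : ℝ) - (a + b)) * v ^ (a + b) -
        (∑ n ∈ Finset.range (N - a), w ^ n) * ∑ m ∈ Finset.range (N - b), w ^ m := by
    have e1 : ∀ n ∈ Finset.range (N - a), ∀ m ∈ Finset.range (N - b), t n m =
        Φ * (if m = n + a - b then (if b ≤ n then v ^ (a + b) else 0) else 0) - w ^ n * w ^ m := by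
      intro n hn m hm
      rw [Finset.mem_range] at hn hm
      have hsq : v ^ (n + m) * w ^ (2 * (n + m)) = w ^ n * w ^ m := by
        rw [two_mul, pow_add w, ← mul_assoc, ← mul_pow, hvv, one_pow, one_mul, pow_add]
      simp only [ht]
      rw [hmain n m (by omega) (by omega), hcardpow, mul_sub, hsq]
      congr 1
      by_cases hb : b ≤ n
      · by_cases hm' : m = n + a - b
        · rw [if_pos ⟨by omega, hb⟩, if_pos hm', if_pos hb, hcardpow]
          have hs : n + m = a + b + 2 * (n - b) := by omega
          rw [hs, pow_add]
          have : v ^ (2 * (n - b)) * w ^ (2 * (n - b)) = 1 := by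
            rw [← mul_pow, hvv, one_pow]
          linear_combination Φ * v ^ (a + b) * this
        · rw [if_neg (by omega), if_neg hm']; simp
      · rw [if_neg (by omega), if_neg hb]; simp
    rw [Finset.sum_congr rfl fun n hn => Finset.sum_congr rfl fun m hm => e1 n hn m hm]
    simp only [Finset.sum_sub_distrib, ← Finset.mul_sum, ← Finset.sum_mul]
    congr 1
    rw [mul_assoc]
    congr 1
    have e2 : ∀ n ∈ Finset.range (N - a), ∑ m ∈ Finset.range (N - b),
        (if m = n + a - b then (if b ≤ n then v ^ (a + b) else 0) else 0) =
        if b ≤ n then v ^ (a + b) else 0 := by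
      intro n hn
      rw [Finset.mem_range] at hn
      rw [Finset.sum_ite_eq']
      by_cases hb : b ≤ n
      · rw [if_pos (Finset.mem_range.2 (by omega))]
      · rw [if_neg hb, ite_self]
    rw [Finset.sum_congr rfl e2, ← Finset.sum_filter, Finset.sum_const, nsmul_eq_mul]
    congr 1
    have e3 : (Finset.range (N - a)).filter (fun n => b ≤ n) = Finset.Ico b (N - a) := by
      ext n; simp only [Finset.mem_filter, Finset.mem_range, Finset.mem_Ico]; tauto
    rw [e3, Nat.card_Ico, Nat.cast_sub (by omega), Nat.cast_sub (by omega)]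
    ring
  have hgeom : (∑ n ∈ Finset.range (N - a), w ^ n) * ∑ m ∈ Finset.range (N - b), w ^ m =
      ((w - 1)⁻¹) ^ 2 * ((w ^ (N - a) - 1) * (w ^ (N - b) - 1)) := by
    rw [geom_sum_eq hv1.ne', geom_sum_eq hv1.ne']
    field_simp
  have hprod : w ^ (N - a) * w ^ (N - b) = w ^ (2 * N) * v ^ (a + b) := by
    have : w ^ (2 * N) = w ^ (N - a) * w ^ (N - b) * w ^ (a + b) := by
      rw [← pow_add, ← pow_add]; congr 1; omega
    rw [this, mul_assoc, ← mul_pow, mul_comm w v, hvv, one_pow, mul_one]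
  rw [hsplit, hbox, hgeom]
  set R := ∑ p ∈ (Finset.range N ×ˢ Finset.range N).filter
      (fun p => ¬ (p.1 + a < N ∧ p.2 + b < N)), t p.1 p.2
  set κ := ((w - 1)⁻¹) ^ 2
  have e4 : Φ * ((N : ℝ) - (a + b)) * v ^ (a + b) -
      κ * ((w ^ (N - a) - 1) * (w ^ (N - b) - 1)) + R -
      (Φ * ((N : ℝ) - (a + b)) - κ * w ^ (2 * N)) * v ^ (a + b) =
      R + κ * (w ^ (N - a) + w ^ (N - b) - 1) := by
    linear_combination -κ * hprod
  rw [e4]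
  have h1 : w ^ (N - a) ≤ B := pow_le_pow_right₀ hv1.le (by omega)
  have h2 : w ^ (N - b) ≤ B := pow_le_pow_right₀ hv1.le (by omega)
  have h3 : 1 ≤ w ^ (N - a) := one_le_pow₀ hv1.le
  have h4 : 1 ≤ w ^ (N - b) := one_le_pow₀ hv1.le
  have h5 : |κ * (w ^ (N - a) + w ^ (N - b) - 1)| ≤ 18 * B := by
    rw [abs_of_nonneg (mul_nonneg hκ0 (by linarith))]
    nlinarith
  calc _ ≤ |R| + |κ * (w ^ (N - a) + w ^ (N - b) - 1)| := abs_add_le _ _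
    _ ≤ (N : ℝ) ^ 2 * B + 18 * B := add_le_add hrest h5
    _ = _ := by ring

theorem lPoly_principal (hQ : Irreducible Q) :
    DirChar.lPoly (1 : DirChar Q) =
      ((∑ n ∈ Finset.range Q.natDegree, invSqrtCard F ^ n * (Nat.card F ^ n : ℕ) : ℝ) : ℂ) := by
  rw [DirChar.lPoly]
  push_cast
  refine Finset.sum_congr rfl fun n hn => ?_
  rw [Finset.sum_congr rfl fun h hh => by
    rw [val_principal (isUnit_mk_of_natDegree_lt hQ (mem_monics.1 hh).1.ne_zero
      ((mem_monics.1 hh).2 ▸ Finset.mem_range.1 hn))], Finset.sum_const, card_monics,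
    nsmul_eq_mul]
  push_cast
  ring

variable [Fintype (DirChar Q)]

open Classical in
/-- Orthogonality turns the twisted second moment over all characters into a weighted count of
solutions. The principal character accounts for the means subtracted in `abs_solCount_sub_le`. -/
theorem sum_lPoly_conj_mul (hQ : Irreducible Q) {f g : F[X]}
    (hf : IsUnit (Ideal.Quotient.mk (Ideal.span {Q}) f))
    (hg : IsUnit (Ideal.Quotient.mk (Ideal.span {Q}) g)) :
    ∑ χ : DirChar Q, χ.lPoly * (starRingEnd ℂ) χ.lPoly * (χ.val f * (starRingEnd ℂ) (χ.val g)) =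
      ((numChars Q * ∑ n ∈ Finset.range Q.natDegree, ∑ m ∈ Finset.range Q.natDegree,
        invSqrtCard F ^ (n + m) * solCount Q f g n m : ℝ) : ℂ) := by
  have hterm : ∀ χ : DirChar Q, χ.lPoly * (starRingEnd ℂ) χ.lPoly *
      (χ.val f * (starRingEnd ℂ) (χ.val g)) =
      ∑ n ∈ Finset.range Q.natDegree, ∑ m ∈ Finset.range Q.natDegree,
        ∑ p ∈ monics F n ×ˢ monics F m, (invSqrtCard F : ℂ) ^ (n + m) *
          (χ.val (p.1 * f) * (starRingEnd ℂ) (χ.val (p.2 * g))) := by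
    intro χ
    rw [DirChar.lPoly, map_sum, Finset.sum_mul_sum, Finset.sum_mul]
    refine Finset.sum_congr rfl fun n _ => ?_
    rw [Finset.sum_mul]
    refine Finset.sum_congr rfl fun m _ => ?_
    rw [map_sum, Finset.sum_mul_sum, ← Finset.sum_product', Finset.sum_mul]
    refine Finset.sum_congr rfl fun p _ => ?_
    rw [val_mul, val_mul, map_mul, map_mul, map_pow, Complex.conj_ofReal, pow_add]
    ring
  simp_rw [hterm]
  rw [Finset.sum_comm]
  push_cast
  rw [Finset.mul_sum]
  refine Finset.sum_congr rfl fun n hn => ?_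
  rw [Finset.sum_comm, Finset.mul_sum]
  refine Finset.sum_congr rfl fun m hm => ?_
  rw [Finset.sum_comm, solCount, Finset.card_filter]
  push_cast
  rw [Finset.mul_sum, Finset.mul_sum]
  refine Finset.sum_congr rfl fun p hp => ?_
  rw [Finset.mem_product] at hp
  have hu : ∀ {n : ℕ} {h f : F[X]}, h ∈ monics F n → n ∈ Finset.range Q.natDegree →
      IsUnit (Ideal.Quotient.mk (Ideal.span {Q}) f) →
      IsUnit (Ideal.Quotient.mk (Ideal.span {Q}) (h * f)) := by
    intro n h f hh hn hf
    obtain ⟨h1, h2⟩ := mem_monics.1 hh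
    rw [map_mul]
    exact (isUnit_mk_of_natDegree_lt hQ h1.ne_zero (h2 ▸ Finset.mem_range.1 hn)).mul hf
  rw [← Finset.mul_sum, sum_val_mul_conj hQ.ne_zero (hu hp.1 hn hf) (hu hp.2 hm hg)]
  split_ifs <;> ring

open Classical in
/-- The twisted second moment over the non-principal characters. -/
theorem norm_sum_lPoly_conj_sub_le (hQ : Irreducible Q) {f g : F[X]} (hf : f.Monic) (hg : g.Monic)
    (hfg : IsCoprime f g) (hN : f.natDegree + g.natDegree < Q.natDegree) :
    ‖∑ χ ∈ Finset.univ.erase (1 : DirChar Q),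
        χ.lPoly * (starRingEnd ℂ) χ.lPoly * (χ.val f * (starRingEnd ℂ) (χ.val g)) -
      (((numChars Q * ((Q.natDegree : ℝ) - (f.natDegree + g.natDegree)) -
        secondMomentConst F * (invSqrtCard F)⁻¹ ^ (2 * Q.natDegree)) *
          invSqrtCard F ^ (f.natDegree + g.natDegree) : ℝ) : ℂ)‖ ≤
      ((Q.natDegree : ℝ) ^ 2 + 18) *
        (invSqrtCard F)⁻¹ ^ (Q.natDegree + 2 * (f.natDegree + g.natDegree)) := by
  have hfu := isUnit_mk_of_natDegree_lt hQ hf.ne_zero (by omega)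
  have hgu := isUnit_mk_of_natDegree_lt hQ hg.ne_zero (by omega)
  refine le_trans (le_of_eq ?_) (abs_sum_solCount_sub_le hQ hf hg hfg hN)
  rw [← Real.norm_eq_abs, ← Complex.norm_real]
  congr 1
  have h := Finset.sum_erase_add Finset.univ (fun χ : DirChar Q =>
    χ.lPoly * (starRingEnd ℂ) χ.lPoly * (χ.val f * (starRingEnd ℂ) (χ.val g)))
    (Finset.mem_univ (1 : DirChar Q))
  rw [← eq_sub_iff_add_eq, sum_lPoly_conj_mul hQ hfu hgu, val_principal hfu, val_principal hgu,
    lPoly_principal hQ, Complex.conj_ofReal, map_one, mul_one, mul_one, ← Complex.ofReal_mul,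
    ← Complex.ofReal_sub] at h
  rw [h, ← Complex.ofReal_sub]
  congr 2
  rw [Finset.sum_mul_sum, Finset.mul_sum, ← Finset.sum_sub_distrib]
  refine Finset.sum_congr rfl fun n _ => ?_
  rw [Finset.mul_sum, ← Finset.sum_sub_distrib]
  refine Finset.sum_congr rfl fun m _ => ?_
  push_cast
  ring

end SecondMoment

/-! ### Monomials in a family of primes, and independence of disjoint blocks -/

section Monomials

variable {F : Type u} [Field F]

/-- A family of pairwise distinct primes of `F[T]`. -/
structure IsPrimeFamily {σ : Type*} (p : σ → F[X]) : Prop where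
  monic : ∀ s, (p s).Monic
  irreducible : ∀ s, Irreducible (p s)
  injective : Function.Injective p

theorem IsPrimeFamily.isCoprime {σ : Type*} {p : σ → F[X]} (hp : IsPrimeFamily p)
    {s t : σ} (h : s ≠ t) : IsCoprime (p s) (p t) :=
  isCoprime_of_monic_irreducible (hp.monic s) (hp.irreducible s) (hp.monic t) (hp.irreducible t)
    fun h' => h (hp.injective h')

variable {σ : Type*} [Fintype σ] {p : σ → F[X]}

/-- The monic polynomial `∏ p_s ^ e_s`. -/
def monomialOf (p : σ → F[X]) (e : σ → ℕ) : F[X] := ∏ s, p s ^ e s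

theorem IsPrimeFamily.monic_monomialOf (hp : IsPrimeFamily p) (e : σ → ℕ) :
    (monomialOf p e).Monic :=
  monic_prod_of_monic _ _ fun s _ => (hp.monic s).pow _

theorem IsPrimeFamily.natDegree_monomialOf (hp : IsPrimeFamily p) (e : σ → ℕ) :
    (monomialOf p e).natDegree = ∑ s, e s * (p s).natDegree := by
  rw [monomialOf, natDegree_prod_of_monic _ _ fun s _ => (hp.monic s).pow _]
  exact Finset.sum_congr rfl fun s _ => (hp.monic s).natDegree_pow _

theorem IsPrimeFamily.monomialOf_dvd_iff (hp : IsPrimeFamily p) {e e' : σ → ℕ} :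
    monomialOf p e ∣ monomialOf p e' ↔ ∀ s, e s ≤ e' s := by
  classical
  refine ⟨fun h s => ?_, fun h => Finset.prod_dvd_prod_of_dvd _ _ fun s _ => pow_dvd_pow _ (h s)⟩
  have h1 : p s ^ e s ∣ p s ^ e' s * ∏ t ∈ Finset.univ.erase s, p t ^ e' t := by
    rw [Finset.mul_prod_erase _ (fun t => p t ^ e' t) (Finset.mem_univ s)]
    exact (Finset.dvd_prod_of_mem (fun t => p t ^ e t) (Finset.mem_univ s)).trans h
  have h2 : IsCoprime (p s ^ e s) (∏ t ∈ Finset.univ.erase s, p t ^ e' t) :=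
    IsCoprime.prod_right fun t ht => (hp.isCoprime (Finset.ne_of_mem_erase ht).symm).pow
  exact (pow_dvd_pow_iff (hp.irreducible s).ne_zero (hp.irreducible s).not_isUnit).1
    (h2.dvd_of_dvd_mul_right h1)

theorem IsPrimeFamily.monomialOf_injective (hp : IsPrimeFamily p) :
    Function.Injective (monomialOf p) := fun _ _ h => funext fun s =>
  le_antisymm (hp.monomialOf_dvd_iff.1 (h ▸ dvd_rfl) s) (hp.monomialOf_dvd_iff.1 (h ▸ dvd_rfl) s)

theorem monomialOf_eq_mul (p : σ → F[X]) (e e' : σ → ℕ) : monomialOf p e =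
    monomialOf p (fun s => min (e s) (e' s)) * monomialOf p (fun s => e s - e' s) := by
  rw [monomialOf, monomialOf, monomialOf, ← Finset.prod_mul_distrib]
  refine Finset.prod_congr rfl fun s _ => ?_
  rw [← pow_add]
  congr 1
  omega

theorem IsPrimeFamily.isCoprime_monomialOf_sub (hp : IsPrimeFamily p) (e e' : σ → ℕ) :
    IsCoprime (monomialOf p fun s => e s - e' s) (monomialOf p fun s => e' s - e s) := by
  refine IsCoprime.prod_left fun s _ => IsCoprime.prod_right fun t _ => ?_
  beta_reduce
  rcases eq_or_ne s t with rfl | h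
  · rcases le_total (e s) (e' s) with h | h
    · rw [Nat.sub_eq_zero_of_le h, pow_zero]; exact isCoprime_one_left
    · rw [Nat.sub_eq_zero_of_le h, pow_zero]; exact isCoprime_one_right
  · exact (hp.isCoprime h).pow

theorem val_monomialOf {Q : F[X]} (χ : DirChar Q) (p : σ → F[X]) (e : σ → ℕ) :
    χ.val (monomialOf p e) = ∏ s, χ.val (p s) ^ e s := by
  simp only [DirChar.val, monomialOf, map_prod, map_pow]

end Monomials

section Expansion

variable {σ : Type*} [Fintype σ]

open Classical in
/-- The exponent vectors of total degree at most `ℓ`. -/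
def expSet (σ : Type*) [Fintype σ] (ℓ : ℕ) : Finset (σ → ℕ) :=
  (Fintype.piFinset fun _ => Finset.range (ℓ + 1)).filter fun e => ∑ s, e s ≤ ℓ

theorem mem_expSet {ℓ : ℕ} {e : σ → ℕ} : e ∈ expSet σ ℓ ↔ ∑ s, e s ≤ ℓ := by
  classical
  simp only [expSet, Finset.mem_filter, Fintype.mem_piFinset, Finset.mem_range,
    and_iff_right_iff_imp]
  intro h s
  have := Finset.single_le_sum (f := e) (fun _ _ => Nat.zero_le _) (Finset.mem_univ s)
  omega

/-- The multinomial expansion of a polynomial in `∑ y_s`. -/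
theorem sum_mul_sum_pow {A : Type*} [CommSemiring A] (β : ℕ → A) (y : σ → A) (ℓ : ℕ) :
    ∑ r ∈ Finset.range (ℓ + 1), β r * (∑ s, y s) ^ r =
      ∑ e ∈ expSet σ ℓ, β (∑ s, e s) * (Nat.multinomial Finset.univ e * ∏ s, y s ^ e s) := by
  classical
  rw [← Finset.sum_fiberwise_of_maps_to (t := Finset.range (ℓ + 1)) (g := fun e : σ → ℕ => ∑ s, e s)
    fun e he => Finset.mem_range.2 (Nat.lt_succ_of_le (mem_expSet.1 he))]
  refine Finset.sum_congr rfl fun r hr => ?_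
  rw [Finset.sum_pow_eq_sum_piAntidiag, Finset.mul_sum]
  refine Finset.sum_congr (Finset.ext fun e => ?_) fun e he => ?_
  · rw [Finset.mem_filter, mem_expSet, Finset.mem_piAntidiag]
    have := Finset.mem_range.1 hr
    constructor
    · rintro ⟨h, -⟩; exact ⟨(show ∑ s, e s = r from h).trans_le (by omega), h⟩
    · rintro ⟨-, h⟩; exact ⟨h, fun _ _ => Finset.mem_univ _⟩
  · rw [(Finset.mem_filter.1 he).2]

theorem multinomial_div_factorial (e : σ → ℕ) :
    (Nat.multinomial Finset.univ e : ℝ) / (∑ s, e s).factorial = ∏ s, ((e s).factorial : ℝ)⁻¹ := by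
  have h : (∏ s, ((e s).factorial : ℝ)) * Nat.multinomial Finset.univ e = (∑ s, e s).factorial := by
    exact_mod_cast Nat.multinomial_spec Finset.univ e
  have h0 : (∏ s, ((e s).factorial : ℝ)) ≠ 0 := Finset.prod_ne_zero_iff.2 fun s _ => by positivity
  rw [← h, Finset.prod_inv_distrib]
  have h1 : (Nat.multinomial Finset.univ e : ℝ) ≠ 0 := by
    intro h2
    rw [h2, mul_zero] at h
    exact absurd h.symm (by positivity)
  field_simp

theorem multinomial_le_factorial (e : σ → ℕ) :
    Nat.multinomial Finset.univ e ≤ (∑ s, e s).factorial :=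
  Nat.div_le_self _ _

end Expansion

section Independence

variable {F : Type u} [Field F] {Q : F[X]}

/-- Parseval's identity for Dirichlet polynomials of degree less than `deg Q`. -/
theorem sum_norm_sq_eq [Finite F] [Fintype (DirChar Q)] (hQ : Irreducible Q) {τ : Type*}
    (T : Finset τ) (a : τ → ℝ) (f : τ → F[X])
    (hinj : Set.InjOn f T) (hm : ∀ j ∈ T, (f j).Monic)
    (hd : ∀ j ∈ T, (f j).natDegree < Q.natDegree) :
    ∑ χ : DirChar Q, ‖∑ j ∈ T, (a j : ℂ) * χ.val (f j)‖ ^ 2 = numChars Q * ∑ j ∈ T, a j ^ 2 := by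
  classical
  have hu := fun j hj => isUnit_mk_of_natDegree_lt hQ (hm j hj).ne_zero (hd j hj)
  have : ((∑ χ : DirChar Q, ‖∑ j ∈ T, (a j : ℂ) * χ.val (f j)‖ ^ 2 : ℝ) : ℂ) =
      ((numChars Q * ∑ j ∈ T, a j ^ 2 : ℝ) : ℂ) := by
    push_cast
    simp_rw [← Complex.mul_conj', map_sum, Finset.sum_mul_sum]
    rw [Finset.sum_comm, Finset.mul_sum]
    refine Finset.sum_congr rfl fun j hj => ?_
    rw [Finset.sum_comm, Finset.sum_eq_single_of_mem j hj]
    · simp_rw [map_mul, Complex.conj_ofReal, mul_mul_mul_comm (a j : ℂ) _ (a j : ℂ) _,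
        ← Finset.mul_sum]
      rw [sum_val_mul_conj hQ.ne_zero (hu j hj) (hu j hj), if_pos rfl]
      ring
    · intro i hi hij
      simp_rw [map_mul, Complex.conj_ofReal, mul_mul_mul_comm (a j : ℂ) _ (a i : ℂ) _,
        ← Finset.mul_sum]
      rw [sum_val_mul_conj hQ.ne_zero (hu j hj) (hu i hi), if_neg, mul_zero]
      exact fun h => hij (hinj hi hj (eq_of_mk_eq_mk (hd j hj) (hd i hi) h).symm)
  exact_mod_cast this

/-- `P(χ) = ∑ χ(p_s) / |p_s| ^ (1/2)`. -/
def primeSum {σ : Type*} [Fintype σ] (p : σ → F[X]) (χ : DirChar Q) : ℂ :=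
  ∑ s, (invSqrtCard F : ℂ) ^ (p s).natDegree * χ.val (p s)

theorem sum_mul_primeSum_pow {σ : Type*} [Fintype σ] (p : σ → F[X]) (β : ℕ → ℝ) (ℓ : ℕ)
    (χ : DirChar Q) :
    ∑ r ∈ Finset.range (ℓ + 1), (β r : ℂ) * primeSum p χ ^ r =
      ∑ e ∈ expSet σ ℓ, ((β (∑ s, e s) * (Nat.multinomial Finset.univ e *
        ∏ s, (invSqrtCard F ^ (p s).natDegree) ^ e s) : ℝ) : ℂ) * χ.val (monomialOf p e) := by
  rw [primeSum, sum_mul_sum_pow]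
  refine Finset.sum_congr rfl fun e _ => ?_
  rw [val_monomialOf]
  push_cast
  simp_rw [mul_pow, Finset.prod_mul_distrib]
  ring

theorem sigma_uncurry_injective {ι : Type*} {σ : ι → Type*} :
    Function.Injective fun (e : (i : ι) → σ i → ℕ) (s : Σ i, σ i) => e s.1 s.2 :=
  fun _ _ h => funext fun i => funext fun s => congrFun h ⟨i, s⟩

variable {ι : Type*} [Fintype ι] {σ : ι → Type*} [∀ i, Fintype (σ i)] {p : (i : ι) → σ i → F[X]}

theorem prod_val_monomialOf (p : (i : ι) → σ i → F[X]) (e : (i : ι) → σ i → ℕ) (χ : DirChar Q) :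
    ∏ i, χ.val (monomialOf (p i) (e i)) =
      χ.val (monomialOf (fun s : Σ i, σ i => p s.1 s.2) fun s => e s.1 s.2) := by
  simp_rw [val_monomialOf]
  rw [Fintype.prod_sigma]

theorem natDegree_monomialOf_sigma_le (hp : IsPrimeFamily fun s : Σ i, σ i => p s.1 s.2)
    {D : ι → ℕ} (hD : ∀ i s, (p i s).natDegree ≤ D i) {R : ι → ℕ} {e : (i : ι) → σ i → ℕ}
    (he : ∀ i, e i ∈ expSet (σ i) (R i)) :
    (monomialOf (fun s : Σ i, σ i => p s.1 s.2) fun s => e s.1 s.2).natDegree ≤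
      ∑ i, R i * D i := by
  rw [hp.natDegree_monomialOf, Fintype.sum_sigma]
  refine Finset.sum_le_sum fun i _ => ?_
  calc ∑ s, e i s * (p i s).natDegree ≤ ∑ s, e i s * D i := by gcongr with s; exact hD i s
    _ = (∑ s, e i s) * D i := by rw [Finset.sum_mul]
    _ ≤ _ := Nat.mul_le_mul_right _ (mem_expSet.1 (he i))

variable [Finite F] [Fintype (DirChar Q)]

/-- Polynomials in the sums over disjoint blocks of primes behave as if independent, and their
mean squares are dominated by those of complex Gaussians of the same variance. -/
theorem sum_prod_norm_sq_le (hQ : Irreducible Q)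
    (hp : IsPrimeFamily fun s : Σ i, σ i => p s.1 s.2)
    {D : ι → ℕ} (hD : ∀ i s, (p i s).natDegree ≤ D i) {R : ι → ℕ}
    (hR : ∑ i, R i * D i < Q.natDegree) (β : ι → ℕ → ℝ) :
    ∑ χ : DirChar Q, ∏ i, ‖∑ r ∈ Finset.range (R i + 1), (β i r : ℂ) * primeSum (p i) χ ^ r‖ ^ 2 ≤
      numChars Q * ∏ i, ∑ r ∈ Finset.range (R i + 1), β i r ^ 2 * (r.factorial *
        (∑ s, invSqrtCard F ^ (2 * (p i s).natDegree)) ^ r) := by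
  classical
  set c : (i : ι) → (σ i → ℕ) → ℝ := fun i e => β i (∑ s, e s) *
    (Nat.multinomial Finset.univ e * ∏ s, (invSqrtCard F ^ (p i s).natDegree) ^ e s) with hc
  have h1 : ∀ χ : DirChar Q,
      ∏ i, ‖∑ r ∈ Finset.range (R i + 1), (β i r : ℂ) * primeSum (p i) χ ^ r‖ ^ 2 =
      ‖∑ e ∈ Fintype.piFinset fun i => expSet (σ i) (R i), ((∏ i, c i (e i) : ℝ) : ℂ) *
        χ.val (monomialOf (fun s : Σ i, σ i => p s.1 s.2) fun s => e s.1 s.2)‖ ^ 2 := by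
    intro χ
    rw [Finset.prod_pow, ← norm_prod]
    simp_rw [sum_mul_primeSum_pow]
    rw [Finset.prod_univ_sum]
    congr 2
    refine Finset.sum_congr rfl fun e _ => ?_
    rw [Finset.prod_mul_distrib, prod_val_monomialOf, Complex.ofReal_prod]
  simp_rw [h1]
  rw [sum_norm_sq_eq hQ]
  · refine mul_le_mul_of_nonneg_left ?_ (Nat.cast_nonneg _)
    simp_rw [← Finset.prod_pow]
    rw [← Finset.prod_univ_sum (fun i => expSet (σ i) (R i)) fun i e => c i e ^ 2]
    refine Finset.prod_le_prod (fun i _ => Finset.sum_nonneg fun _ _ => sq_nonneg _) fun i _ => ?_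
    have h2 := sum_mul_sum_pow (fun r => β i r ^ 2 * (r.factorial : ℝ))
      (fun s => invSqrtCard F ^ (2 * (p i s).natDegree)) (R i)
    simp_rw [mul_assoc] at h2
    rw [h2]
    refine Finset.sum_le_sum fun e _ => ?_
    have h3 : (Nat.multinomial Finset.univ e : ℝ) ≤ (∑ s, e s).factorial := by
      exact_mod_cast multinomial_le_factorial e
    have h4 : ∏ s, (invSqrtCard F ^ (2 * (p i s).natDegree)) ^ e s =
        (∏ s, (invSqrtCard F ^ (p i s).natDegree) ^ e s) ^ 2 := by
      rw [← Finset.prod_pow]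
      exact Finset.prod_congr rfl fun s _ => by ring
    rw [h4, hc]
    simp only
    have h5 : (0 : ℝ) ≤ Nat.multinomial Finset.univ e := Nat.cast_nonneg _
    rw [mul_pow, mul_pow, sq (Nat.multinomial Finset.univ e : ℝ), mul_assoc]
    gcongr
  · intro e _ e' _ h
    exact sigma_uncurry_injective (hp.monomialOf_injective h)
  · intro e _
    exact hp.monic_monomialOf _
  · intro e he
    exact (natDegree_monomialOf_sigma_le hp hD fun i => Fintype.mem_piFinset.1 he i).trans_lt hR

/-- The bound of `sum_prod_norm_sq_le` for products of sums of two squares, by expanding them. -/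
theorem sum_prod_add_norm_sq_le (hQ : Irreducible Q)
    (hp : IsPrimeFamily fun s : Σ i, σ i => p s.1 s.2)
    {D : ι → ℕ} (hD : ∀ i s, (p i s).natDegree ≤ D i) {R : ι → ℕ}
    (hR : ∑ i, R i * D i < Q.natDegree) (β γ : ι → ℕ → ℝ) {A : ι → ℝ} (hA : ∀ i, 0 ≤ A i) :
    ∑ χ : DirChar Q, ∏ i,
        (A i * ‖∑ r ∈ Finset.range (R i + 1), (β i r : ℂ) * primeSum (p i) χ ^ r‖ ^ 2 +
          ‖∑ r ∈ Finset.range (R i + 1), (γ i r : ℂ) * primeSum (p i) χ ^ r‖ ^ 2) ≤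
      numChars Q * ∏ i,
        (A i * ∑ r ∈ Finset.range (R i + 1), β i r ^ 2 * (r.factorial *
            (∑ s, invSqrtCard F ^ (2 * (p i s).natDegree)) ^ r) +
          ∑ r ∈ Finset.range (R i + 1), γ i r ^ 2 * (r.factorial *
            (∑ s, invSqrtCard F ^ (2 * (p i s).natDegree)) ^ r)) := by
  classical
  simp_rw [Finset.prod_add]
  rw [Finset.sum_comm, Finset.mul_sum]
  refine Finset.sum_le_sum fun t _ => ?_
  have h := sum_prod_norm_sq_le hQ hp hD hR fun i => if i ∈ t then β i else γ i
  have hsplit : ∀ f g : ι → ℝ, (∏ i ∈ t, A i * f i) * ∏ i ∈ Finset.univ \ t, g i =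
      (∏ i ∈ t, A i) * ∏ i, if i ∈ t then f i else g i := by
    intro f g
    rw [Finset.prod_mul_distrib, mul_assoc]
    congr 1
    rw [← Finset.prod_mul_prod_compl t fun i => if i ∈ t then f i else g i,
      Finset.compl_eq_univ_sdiff]
    congr 1
    · exact Finset.prod_congr rfl fun i hi => (if_pos hi).symm
    · exact Finset.prod_congr rfl fun i hi => (if_neg (Finset.mem_sdiff.1 hi).2).symm
  simp_rw [hsplit]
  rw [← Finset.mul_sum, mul_left_comm]
  refine mul_le_mul_of_nonneg_left ?_ (Finset.prod_nonneg fun i _ => hA i)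
  refine le_trans (le_of_eq ?_) (h.trans (le_of_eq ?_))
  · refine Finset.sum_congr rfl fun χ _ => Finset.prod_congr rfl fun i _ => ?_
    by_cases hi : i ∈ t <;> simp only [hi, if_true, if_false]
  · congr 1
    refine Finset.prod_congr rfl fun i _ => ?_
    by_cases hi : i ∈ t <;> simp only [hi, if_true, if_false]

end Independence

/-! ### Truncated Euler products -/

section TruncatedProducts

variable {σ : Type*} [Fintype σ]

/-- The terms of `∏ s, ∑ t, w s t` in absolute value, weighted by the exponential of
their total size. -/
theorem sum_prod_abs_mul_exp_le [DecidableEq σ] {τ : Type*} [DecidableEq τ] {T : Finset τ}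
    {t₀ : τ} (ht₀ : t₀ ∈ T) {size : τ → ℕ} (hsize : size t₀ = 0) {w : σ → τ → ℝ}
    (hw : ∀ s, w s t₀ = 1) {x : σ → ℝ} {K : ℝ}
    (hK : ∀ s, ∑ t ∈ T.erase t₀, |w s t| * Real.exp (size t) ≤ K * x s) :
    ∑ t ∈ Fintype.piFinset fun _ : σ => T, (∏ s, |w s (t s)|) * Real.exp (∑ s, (size (t s) : ℝ)) ≤
      Real.exp (K * ∑ s, x s) := by
  simp_rw [Real.exp_sum, ← Finset.prod_mul_distrib]
  rw [← Finset.prod_univ_sum (fun _ => T) fun s t => |w s t| * Real.exp (size t), Finset.mul_sum,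
    Real.exp_sum]
  refine Finset.prod_le_prod (fun s _ => Finset.sum_nonneg fun _ _ => by positivity) fun s _ => ?_
  rw [← Finset.add_sum_erase T _ ht₀, hw, hsize]
  have := Real.add_one_le_exp (K * x s)
  have := hK s
  simp only [abs_one, Nat.cast_zero, Real.exp_zero, mul_one]
  linarith

/-- Rankin's trick: a truncation of `∏ s, ∑ t, w s t` that only drops terms of total size more
than `ℓ` is exponentially close to the full product. -/
theorem abs_sum_prod_sub_prod_sum_le [DecidableEq σ] {τ : Type*} [DecidableEq τ] {T : Finset τ}
    {t₀ : τ} (ht₀ : t₀ ∈ T) {size : τ → ℕ} (hsize : size t₀ = 0) {w : σ → τ → ℝ}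
    (hw : ∀ s, w s t₀ = 1) {x : σ → ℝ} {K : ℝ}
    (hK : ∀ s, ∑ t ∈ T.erase t₀, |w s t| * Real.exp (size t) ≤ K * x s)
    {E : Finset (σ → τ)} (hE : E ⊆ Fintype.piFinset fun _ => T) {ℓ : ℕ}
    (hℓ : ∀ t ∈ Fintype.piFinset fun _ : σ => T, ∑ s, size (t s) ≤ ℓ → t ∈ E) :
    |∑ t ∈ E, ∏ s, w s (t s) - ∏ s, ∑ t ∈ T, w s t| ≤
      Real.exp (-ℓ) * Real.exp (K * ∑ s, x s) := by
  rw [Finset.prod_univ_sum, ← Finset.sum_sdiff hE, ← sub_sub, sub_right_comm, sub_self, zero_sub,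
    abs_neg]
  refine (Finset.abs_sum_le_sum_abs _ _).trans ?_
  refine le_trans ?_ (mul_le_mul_of_nonneg_left (sum_prod_abs_mul_exp_le ht₀ hsize hw hK)
    (Real.exp_pos _).le)
  rw [Finset.mul_sum]
  refine (Finset.sum_le_sum fun t ht => ?_).trans
    (Finset.sum_le_sum_of_subset_of_nonneg Finset.sdiff_subset fun t _ _ => by positivity)
  rw [Finset.mem_sdiff] at ht
  have hlt : ℓ < ∑ s, size (t s) := not_le.1 fun h => ht.2 (hℓ t ht.1 h)
  have hlt' : (ℓ : ℝ) ≤ ∑ s, (size (t s) : ℝ) := by exact_mod_cast hlt.le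
  rw [Finset.abs_prod, mul_left_comm, ← Real.exp_add]
  exact le_mul_of_one_le_right (by positivity) (Real.one_le_exp (by linarith))

theorem sum_pow_div_factorial_le_exp {y : ℝ} (hy : 0 ≤ y) (n : ℕ) :
    ∑ r ∈ Finset.range n, y ^ r / r.factorial ≤ Real.exp y := Real.sum_le_exp_of_nonneg hy n

/-- Truncations of the exponential series are non-negative on `[-1, ∞)`. -/
theorem sum_pow_div_factorial_nonneg {y : ℝ} (hy : -1 ≤ y) (n : ℕ) :
    0 ≤ ∑ r ∈ Finset.range n, y ^ r / r.factorial := by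
  rcases le_or_gt 0 y with h | h
  · exact Finset.sum_nonneg fun r _ => by positivity
  · have even : ∀ m : ℕ, 0 ≤ ∑ r ∈ Finset.range (2 * m), y ^ r / r.factorial := by
      intro m
      induction m with
      | zero => simp
      | succ m ih =>
        rw [show 2 * (m + 1) = 2 * m + 1 + 1 by ring, Finset.sum_range_succ, Finset.sum_range_succ,
          add_assoc]
        refine add_nonneg ih ?_
        have e : y ^ (2 * m) / ((2 * m).factorial : ℝ) +
            y ^ (2 * m + 1) / ((2 * m + 1).factorial : ℝ) =
            (y ^ m) ^ 2 / ((2 * m).factorial : ℝ) * (1 + y / (2 * m + 1)) := by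
          have hy2 : y ^ (2 * m) = (y ^ m) ^ 2 := by rw [← pow_mul, mul_comm]
          rw [Nat.factorial_succ, pow_succ, hy2]
          push_cast
          have : ((2 * m).factorial : ℝ) ≠ 0 := by positivity
          have : (2 * (m : ℝ) + 1) ≠ 0 := by positivity
          field_simp
        rw [e]
        have h1 : (1 : ℝ) ≤ 2 * m + 1 := by linarith [(Nat.cast_nonneg m : (0 : ℝ) ≤ m)]
        have h2 : -1 ≤ y / (2 * m + 1) := by
          rw [le_div_iff₀ (by linarith)]; linarith
        have : 0 ≤ 1 + y / (2 * m + 1) := by linarith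
        positivity
    rcases n.even_or_odd' with ⟨m, rfl | rfl⟩
    · exact even m
    · rw [Finset.sum_range_succ]
      refine add_nonneg (even m) ?_
      rw [pow_mul]
      positivity

/-- The weight of `P ^ a` in the diagonal of the twisted first moment, with `x = 1 / |P|`. -/
def firstWeight (k x : ℝ) (a : ℕ) : ℝ :=
  k ^ a / a.factorial * (∑ j ∈ Finset.range (a + 1), (k - 1) ^ j / j.factorial) * x ^ a

theorem firstWeight_nonneg {k x : ℝ} (hk : 0 ≤ k) (hx : 0 ≤ x) (a : ℕ) :
    0 ≤ firstWeight k x a := by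
  have := sum_pow_div_factorial_nonneg (y := k - 1) (by linarith) (a + 1)
  unfold firstWeight
  positivity

theorem sum_firstWeight_mul_exp_le {k x : ℝ} (hk : 0 ≤ k) (hx : 0 ≤ x) (hx1 : x ≤ 1) (ℓ : ℕ) :
    ∑ a ∈ (Finset.range (ℓ + 1)).erase 0, |firstWeight k x a| * Real.exp (a : ℕ) ≤
      Real.exp (k + 1 + k * Real.exp 1) * x := by
  calc _ ≤ ∑ a ∈ (Finset.range (ℓ + 1)).erase 0,
        Real.exp (k + 1) * ((k * Real.exp 1) ^ a / a.factorial) * x := by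
        refine Finset.sum_le_sum fun a ha => ?_
        have ha1 : a ≠ 0 := Finset.ne_of_mem_erase ha
        rw [abs_of_nonneg (firstWeight_nonneg hk hx a)]
        have h1 : ∑ j ∈ Finset.range (a + 1), (k - 1) ^ j / j.factorial ≤ Real.exp (k + 1) := by
          refine le_trans (Finset.sum_le_sum fun j _ => ?_)
            (sum_pow_div_factorial_le_exp (by linarith : 0 ≤ k + 1) (a + 1))
          gcongr ?_ / _
          refine (le_abs_self _).trans ?_
          rw [abs_pow]
          gcongr
          rw [abs_le]; constructor <;> linarith
        have h2 : x ^ a ≤ x := pow_le_of_le_one hx hx1 ha1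
        have h3 : Real.exp (a : ℕ) = Real.exp 1 ^ a := by rw [← Real.exp_nat_mul, mul_one]
        have h0 := sum_pow_div_factorial_nonneg (y := k - 1) (by linarith) (a + 1)
        unfold firstWeight
        calc _ ≤ k ^ a / a.factorial * Real.exp (k + 1) * x * Real.exp (a : ℕ) := by gcongr
          _ = _ := by rw [h3, mul_pow]; ring
    _ ≤ ∑ a ∈ Finset.range (ℓ + 1), Real.exp (k + 1) * ((k * Real.exp 1) ^ a / a.factorial) * x :=
        Finset.sum_le_sum_of_subset_of_nonneg (Finset.erase_subset _ _)
          fun _ _ _ => by positivity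
    _ = Real.exp (k + 1) *
        (∑ a ∈ Finset.range (ℓ + 1), (k * Real.exp 1) ^ a / a.factorial) * x := by
        rw [Finset.mul_sum, Finset.sum_mul]
    _ ≤ Real.exp (k + 1) * Real.exp (k * Real.exp 1) * x := by
        gcongr
        exact sum_pow_div_factorial_le_exp (by positivity) _
    _ = _ := by rw [← Real.exp_add]

theorem exp_sub_sq_le {y : ℝ} (hy : 0 ≤ y) : Real.exp (y - y ^ 2) ≤ 1 + y := by
  rw [← Real.le_log_iff_exp_le (by linarith)]
  refine le_trans ?_ (Real.one_sub_inv_le_log_of_pos (by linarith))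
  rw [show 1 - (1 + y)⁻¹ = y / (1 + y) by field_simp; ring, le_div_iff₀ (by linarith)]
  nlinarith [pow_nonneg hy 3]

theorem exp_neg_two_mul_le {y : ℝ} (hy : 0 ≤ y) (hy1 : y ≤ 1 / 2) :
    Real.exp (-(2 * y)) ≤ 1 - y := by
  rw [Real.exp_neg, inv_le_comm₀ (Real.exp_pos _) (by linarith)]
  refine le_trans ?_ (Real.add_one_le_exp _)
  rw [inv_le_iff_one_le_mul₀ (by linarith)]
  nlinarith

/-- The contribution of a block of primes to the diagonal of the first moment. -/
theorem le_sum_prod_firstWeight {k : ℝ} (hk : 0 ≤ k) {x : σ → ℝ} (hx : ∀ s, 0 ≤ x s)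
    (hx1 : ∀ s, x s ≤ 1) (hV : ∑ s, x s ≤ 1) {ℓ : ℕ} (hℓ1 : 1 ≤ ℓ)
    (hℓ : Real.exp (Real.exp (k + 1 + k * Real.exp 1)) * Real.exp (-ℓ) ≤ 1 / 2) :
    Real.exp (k ^ 2 * ∑ s, x s - k ^ 4 * ∑ s, x s ^ 2 -
      2 * Real.exp (Real.exp (k + 1 + k * Real.exp 1)) * Real.exp (-ℓ)) ≤
      ∑ e ∈ expSet σ ℓ, ∏ s, firstWeight k (x s) (e s) := by
  classical
  set K := Real.exp (k + 1 + k * Real.exp 1)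
  set η := Real.exp K * Real.exp (-ℓ) with hη
  have hη0 : 0 ≤ η := by positivity
  have htr := abs_sum_prod_sub_prod_sum_le (σ := σ) (T := Finset.range (ℓ + 1)) (t₀ := 0)
    (by simp) (size := id) rfl (w := fun s a => firstWeight k (x s) a)
    (fun s => by simp [firstWeight]) (x := x) (K := K)
    (fun s => sum_firstWeight_mul_exp_le hk (hx s) (hx1 s) ℓ) (E := expSet σ ℓ)
    (Finset.filter_subset _ _) (ℓ := ℓ) (fun t _ h => mem_expSet.2 h)
  set Z := ∏ s, ∑ a ∈ Finset.range (ℓ + 1), firstWeight k (x s) a with hZ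
  -- all weights are non-negative, so the terms `a = 0` and `a = 1` give a lower bound
  have hfac : ∀ s, 1 + k ^ 2 * x s ≤ ∑ a ∈ Finset.range (ℓ + 1), firstWeight k (x s) a := by
    intro s
    have h1 : ∑ a ∈ Finset.range 2, firstWeight k (x s) a = 1 + k ^ 2 * x s := by
      have e0 : firstWeight k (x s) 0 = 1 := by simp [firstWeight]
      have e1 : firstWeight k (x s) 1 = k ^ 2 * x s := by
        simp [firstWeight, Finset.sum_range_succ, sq]
      rw [Finset.sum_range_succ, Finset.sum_range_one, e0, e1]
    rw [← h1]
    exact Finset.sum_le_sum_of_subset_of_nonneg (Finset.range_mono (by omega))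
      fun _ _ _ => firstWeight_nonneg hk (hx s) _
  have hZ1 : 1 ≤ Z := by
    rw [hZ, ← Finset.prod_const_one (s := (Finset.univ : Finset σ))]
    refine Finset.prod_le_prod (fun _ _ => zero_le_one) fun s _ => le_trans ?_ (hfac s)
    have := hx s
    nlinarith [mul_nonneg (sq_nonneg k) this]
  have hZ2 : Real.exp (k ^ 2 * ∑ s, x s - k ^ 4 * ∑ s, x s ^ 2) ≤ Z := by
    rw [Finset.mul_sum, Finset.mul_sum, ← Finset.sum_sub_distrib, Real.exp_sum]
    refine Finset.prod_le_prod (fun _ _ => (Real.exp_pos _).le) fun s _ => le_trans ?_ (hfac s)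
    have := exp_sub_sq_le (mul_nonneg (sq_nonneg k) (hx s))
    rwa [mul_pow, ← pow_mul] at this
  have herr : Real.exp (-ℓ) * Real.exp (K * ∑ s, x s) ≤ η := by
    rw [hη, mul_comm]
    gcongr
    exact mul_le_of_le_one_right (Real.exp_pos _).le hV
  have h1 := (abs_le.1 htr).1
  have hη2 := exp_neg_two_mul_le hη0 hℓ
  rw [show k ^ 2 * ∑ s, x s - k ^ 4 * ∑ s, x s ^ 2 - 2 * Real.exp K * Real.exp (-ℓ) =
    k ^ 2 * ∑ s, x s - k ^ 4 * ∑ s, x s ^ 2 + -(2 * η) by rw [hη]; ring, Real.exp_add]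
  calc _ ≤ Z * (1 - η) := by gcongr
    _ ≤ Z - η := by nlinarith
    _ ≤ _ := by linarith

/-- The weight of the pair `(P ^ a, P ^ b)` in the diagonal of the twisted second moment, with
`x = 1 / |P|`. -/
def pairWeight (α x : ℝ) (a b : ℕ) : ℝ :=
  α ^ a / a.factorial * (α ^ b / b.factorial) * x ^ max a b

theorem abs_pairWeight_le {α x : ℝ} (hα : |α| ≤ 1) (hx : 0 ≤ x) (a b : ℕ) :
    |pairWeight α x a b| ≤ (1 / a.factorial) * (1 / b.factorial) * x ^ max a b := by
  rw [pairWeight, abs_mul, abs_mul, abs_div, abs_div, abs_pow, abs_pow, Nat.abs_cast, Nat.abs_cast,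
    abs_of_nonneg (pow_nonneg hx _)]
  gcongr
  · exact pow_le_one₀ (abs_nonneg _) hα
  · exact pow_le_one₀ (abs_nonneg _) hα

theorem sum_pairWeight_mul_exp_le {α x : ℝ} (hα : |α| ≤ 1) (hx : 0 ≤ x) (hx1 : x ≤ 1) (ℓ : ℕ) :
    ∑ t ∈ (Finset.range (ℓ + 1) ×ˢ Finset.range (ℓ + 1)).erase (0, 0),
      |pairWeight α x t.1 t.2| * Real.exp ((t.1 + t.2 : ℕ) : ℝ) ≤
      Real.exp (2 * Real.exp 1) * x := by
  calc _ ≤ ∑ t ∈ (Finset.range (ℓ + 1) ×ˢ Finset.range (ℓ + 1)).erase (0, 0),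
        (Real.exp 1 ^ t.1 / t.1.factorial) * (Real.exp 1 ^ t.2 / t.2.factorial) * x := by
        refine Finset.sum_le_sum fun t ht => ?_
        have hne : max t.1 t.2 ≠ 0 := fun h => Finset.ne_of_mem_erase ht
          (Prod.ext (by simp; omega) (by simp; omega))
        have h2 : x ^ max t.1 t.2 ≤ x := pow_le_of_le_one hx hx1 hne
        have h3 : Real.exp ((t.1 + t.2 : ℕ) : ℝ) = Real.exp 1 ^ t.1 * Real.exp 1 ^ t.2 := by
          rw [← pow_add, ← Real.exp_nat_mul, mul_one]
        calc _ ≤ (1 / t.1.factorial) * (1 / t.2.factorial) * x *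
              Real.exp ((t.1 + t.2 : ℕ) : ℝ) := by
              gcongr
              exact (abs_pairWeight_le hα hx _ _).trans (by gcongr)
          _ = _ := by rw [h3]; ring
    _ ≤ ∑ t ∈ Finset.range (ℓ + 1) ×ˢ Finset.range (ℓ + 1),
        (Real.exp 1 ^ t.1 / t.1.factorial) * (Real.exp 1 ^ t.2 / t.2.factorial) * x :=
        Finset.sum_le_sum_of_subset_of_nonneg (Finset.erase_subset _ _)
          fun _ _ _ => by positivity
    _ = (∑ a ∈ Finset.range (ℓ + 1), Real.exp 1 ^ a / a.factorial) *
        (∑ a ∈ Finset.range (ℓ + 1), Real.exp 1 ^ a / a.factorial) * x := by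
        rw [Finset.sum_mul_sum, Finset.sum_product, Finset.sum_mul]
        exact Finset.sum_congr rfl fun _ _ => by rw [Finset.sum_mul]
    _ ≤ Real.exp (Real.exp 1) * Real.exp (Real.exp 1) * x := by
        have := sum_pow_div_factorial_le_exp (Real.exp_pos 1).le (ℓ + 1)
        have h0 : 0 ≤ ∑ a ∈ Finset.range (ℓ + 1), Real.exp 1 ^ a / (a.factorial : ℝ) :=
          Finset.sum_nonneg fun _ _ => by positivity
        gcongr
    _ = _ := by rw [← Real.exp_add, two_mul]

/-- The terms with `a, b ≤ 1` add up to `1 + 2 (k - 1) x + (k - 1) ^ 2 x = 1 + (k ^ 2 - 1) x`. -/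
theorem abs_sum_pairWeight_le {k x : ℝ} (hk : 0 ≤ k) (hk1 : k ≤ 1) (hx : 0 ≤ x) (hx1 : x ≤ 1)
    {ℓ : ℕ} (hℓ : 1 ≤ ℓ) :
    |∑ t ∈ Finset.range (ℓ + 1) ×ˢ Finset.range (ℓ + 1), pairWeight (k - 1) x t.1 t.2| ≤
      Real.exp ((k ^ 2 - 1) * x + 9 * x ^ 2) := by
  have hα : |k - 1| ≤ 1 := by rw [abs_le]; constructor <;> linarith
  have hsub : Finset.range 2 ×ˢ Finset.range 2 ⊆ Finset.range (ℓ + 1) ×ˢ Finset.range (ℓ + 1) :=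
    Finset.product_subset_product (Finset.range_mono (by omega)) (Finset.range_mono (by omega))
  have h4 : ∑ t ∈ Finset.range 2 ×ˢ Finset.range 2, pairWeight (k - 1) x t.1 t.2 =
      1 + (k ^ 2 - 1) * x := by
    rw [Finset.sum_product]
    simp [Finset.sum_range_succ, pairWeight]
    ring
  rw [← Finset.sum_sdiff hsub, h4]
  have hrest : |∑ t ∈ (Finset.range (ℓ + 1) ×ˢ Finset.range (ℓ + 1)) \
      (Finset.range 2 ×ˢ Finset.range 2), pairWeight (k - 1) x t.1 t.2| ≤ 9 * x ^ 2 := by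
    calc _ ≤ ∑ t ∈ (Finset.range (ℓ + 1) ×ˢ Finset.range (ℓ + 1)) \
        (Finset.range 2 ×ˢ Finset.range 2), (1 / t.1.factorial) * (1 / t.2.factorial) * x ^ 2 := by
          refine (Finset.abs_sum_le_sum_abs _ _).trans (Finset.sum_le_sum fun t ht => ?_)
          refine (abs_pairWeight_le hα hx _ _).trans ?_
          have h2 : 2 ≤ max t.1 t.2 := by
            simp only [Finset.mem_sdiff, Finset.mem_product, Finset.mem_range] at ht
            omega
          have : x ^ max t.1 t.2 ≤ x ^ 2 := pow_le_pow_of_le_one hx hx1 h2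
          gcongr
      _ ≤ ∑ t ∈ Finset.range (ℓ + 1) ×ˢ Finset.range (ℓ + 1),
          ((1 : ℝ) ^ t.1 / t.1.factorial) * ((1 : ℝ) ^ t.2 / t.2.factorial) * x ^ 2 := by
          simp only [one_pow]
          exact Finset.sum_le_sum_of_subset_of_nonneg Finset.sdiff_subset fun _ _ _ => by positivity
      _ = (∑ a ∈ Finset.range (ℓ + 1), (1 : ℝ) ^ a / a.factorial) *
          (∑ a ∈ Finset.range (ℓ + 1), (1 : ℝ) ^ a / a.factorial) * x ^ 2 := by
          rw [Finset.sum_mul_sum, Finset.sum_product, Finset.sum_mul]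
          exact Finset.sum_congr rfl fun _ _ => by rw [Finset.sum_mul]
      _ ≤ 3 * 3 * x ^ 2 := by
          have h1 := sum_pow_div_factorial_le_exp zero_le_one (ℓ + 1)
          have h3 : ∑ a ∈ Finset.range (ℓ + 1), (1 : ℝ) ^ a / a.factorial ≤ 3 := by
            linarith [Real.exp_one_lt_d9]
          have h0 : 0 ≤ ∑ a ∈ Finset.range (ℓ + 1), (1 : ℝ) ^ a / (a.factorial : ℝ) :=
            Finset.sum_nonneg fun _ _ => by positivity
          gcongr
      _ = _ := by ring
  have h0 : 0 ≤ 1 + (k ^ 2 - 1) * x := by nlinarith [mul_nonneg (sq_nonneg k) hx]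
  have := Real.add_one_le_exp ((k ^ 2 - 1) * x + 9 * x ^ 2)
  calc _ ≤ 9 * x ^ 2 + (1 + (k ^ 2 - 1) * x) :=
        (abs_add_le _ _).trans (by rw [abs_of_nonneg h0]; linarith)
    _ ≤ _ := by linarith

theorem sum_expSet_sum_expSet {ℓ : ℕ} (g : (σ → ℕ × ℕ) → ℝ) [DecidableEq σ] :
    ∑ e ∈ expSet σ ℓ, ∑ e' ∈ expSet σ ℓ, g (fun s => (e s, e' s)) =
      ∑ t ∈ (Fintype.piFinset fun _ : σ => Finset.range (ℓ + 1) ×ˢ Finset.range (ℓ + 1)).filter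
        (fun t => ∑ s, (t s).1 ≤ ℓ ∧ ∑ s, (t s).2 ≤ ℓ), g t := by
  refine (Finset.sum_product' _ _ fun e e' : σ → ℕ => g fun s => (e s, e' s)).symm.trans ?_
  refine Finset.sum_bij' (fun p _ s => (p.1 s, p.2 s))
    (fun t _ => (fun s => (t s).1, fun s => (t s).2)) ?_ ?_ ?_ ?_ ?_
  · rintro ⟨e, e'⟩ h
    rw [Finset.mem_product] at h
    have h1 := mem_expSet.1 h.1
    have h2 := mem_expSet.1 h.2
    simp only [Finset.mem_filter, Fintype.mem_piFinset, Finset.mem_product, Finset.mem_range]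
    refine ⟨fun s => ⟨?_, ?_⟩, h1, h2⟩
    · exact Nat.lt_succ_of_le
        ((Finset.single_le_sum (f := e) (fun _ _ => Nat.zero_le _) (Finset.mem_univ s)).trans h1)
    · exact Nat.lt_succ_of_le
        ((Finset.single_le_sum (f := e') (fun _ _ => Nat.zero_le _) (Finset.mem_univ s)).trans h2)
  · intro t ht
    rw [Finset.mem_filter] at ht
    exact Finset.mem_product.2 ⟨mem_expSet.2 ht.2.1, mem_expSet.2 ht.2.2⟩
  · intros; rfl
  · intros; rfl
  · intros; rfl

/-- The contribution of a block of primes to the diagonal of the second moment. -/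
theorem abs_sum_prod_pairWeight_le {k : ℝ} (hk : 0 ≤ k) (hk1 : k ≤ 1) {x : σ → ℝ}
    (hx : ∀ s, 0 ≤ x s) (hx1 : ∀ s, x s ≤ 1) (hV : ∑ s, x s ≤ 1) {ℓ : ℕ} (hℓ : 1 ≤ ℓ) :
    |∑ e ∈ expSet σ ℓ, ∑ e' ∈ expSet σ ℓ, ∏ s, pairWeight (k - 1) (x s) (e s) (e' s)| ≤
      Real.exp ((k ^ 2 - 1) * ∑ s, x s + 9 * ∑ s, x s ^ 2 +
        Real.exp (Real.exp (2 * Real.exp 1) + 1) * Real.exp (-ℓ)) := by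
  classical
  have hα : |k - 1| ≤ 1 := by rw [abs_le]; constructor <;> linarith
  rw [sum_expSet_sum_expSet fun t => ∏ s, pairWeight (k - 1) (x s) (t s).1 (t s).2]
  set K := Real.exp (2 * Real.exp 1)
  have htr := abs_sum_prod_sub_prod_sum_le (σ := σ)
    (T := Finset.range (ℓ + 1) ×ˢ Finset.range (ℓ + 1)) (t₀ := (0, 0))
    (by simp) (size := fun t => t.1 + t.2) rfl
    (w := fun s t => pairWeight (k - 1) (x s) t.1 t.2)
    (fun s => by simp [pairWeight]) (x := x) (K := K)
    (fun s => sum_pairWeight_mul_exp_le hα (hx s) (hx1 s) ℓ)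
    (Finset.filter_subset (fun t => ∑ s, (t s).1 ≤ ℓ ∧ ∑ s, (t s).2 ≤ ℓ) _) (ℓ := ℓ)
    (fun t ht h => by
      rw [Finset.sum_add_distrib] at h
      exact Finset.mem_filter.2 ⟨ht, by omega, by omega⟩)
  set A := (k ^ 2 - 1) * ∑ s, x s + 9 * ∑ s, x s ^ 2 with hA
  set Z := ∏ s, ∑ t ∈ Finset.range (ℓ + 1) ×ˢ Finset.range (ℓ + 1),
    pairWeight (k - 1) (x s) t.1 t.2
  have hZ : |Z| ≤ Real.exp A := by
    rw [Finset.abs_prod, hA, Finset.mul_sum, Finset.mul_sum, ← Finset.sum_add_distrib,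
      Real.exp_sum]
    exact Finset.prod_le_prod (fun _ _ => abs_nonneg _)
      fun s _ => abs_sum_pairWeight_le hk hk1 (hx s) (hx1 s) hℓ
  have hA1 : -1 ≤ A := by
    have h1 : 0 ≤ ∑ s, x s := Finset.sum_nonneg fun s _ => hx s
    have h2 : 0 ≤ ∑ s, x s ^ 2 := Finset.sum_nonneg fun s _ => sq_nonneg _
    rw [hA]
    nlinarith [mul_nonneg (sq_nonneg k) h1]
  have herr : Real.exp (-ℓ) * Real.exp (K * ∑ s, x s) ≤
      Real.exp A * (Real.exp (K + 1) * Real.exp (-ℓ)) := by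
    have h1 : Real.exp (K * ∑ s, x s) ≤ Real.exp A * Real.exp (K + 1) := by
      rw [← Real.exp_add]
      refine Real.exp_le_exp.2 ?_
      have : K * ∑ s, x s ≤ K := mul_le_of_le_one_right (Real.exp_pos _).le hV
      linarith
    calc _ ≤ Real.exp (-ℓ) * (Real.exp A * Real.exp (K + 1)) := by gcongr
      _ = _ := by ring
  have h1 := abs_sub_abs_le_abs_sub (∑ t ∈ (Fintype.piFinset fun _ : σ =>
    Finset.range (ℓ + 1) ×ˢ Finset.range (ℓ + 1)).filter
        (fun t => ∑ s, (t s).1 ≤ ℓ ∧ ∑ s, (t s).2 ≤ ℓ),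
      ∏ s, pairWeight (k - 1) (x s) (t s).1 (t s).2) Z
  have h2 := Real.add_one_le_exp (Real.exp (K + 1) * Real.exp (-ℓ))
  rw [Real.exp_add]
  nlinarith [Real.exp_pos A]

/-- The diagonal of the second moment weighted by the number of prime factors of a block. Bounding
this number by its exponential costs only a constant. -/
theorem sum_prod_abs_pairWeight_mul_le {α : ℝ} (hα : |α| ≤ 1) {x : σ → ℝ}
    (hx : ∀ s, 0 ≤ x s) (hx1 : ∀ s, x s ≤ 1) (hV : ∑ s, x s ≤ 1) (ℓ : ℕ) :
    ∑ e ∈ expSet σ ℓ, ∑ e' ∈ expSet σ ℓ, |∏ s, pairWeight α (x s) (e s) (e' s)| *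
      ∑ s, ((e s : ℝ) + e' s) ≤ Real.exp (Real.exp (2 * Real.exp 1)) := by
  classical
  rw [sum_expSet_sum_expSet fun t => |∏ s, pairWeight α (x s) (t s).1 (t s).2| *
    ∑ s, (((t s).1 : ℝ) + (t s).2)]
  have h := sum_prod_abs_mul_exp_le (σ := σ)
    (T := Finset.range (ℓ + 1) ×ˢ Finset.range (ℓ + 1)) (t₀ := (0, 0))
    (by simp) (size := fun t => t.1 + t.2) rfl
    (w := fun s t => pairWeight α (x s) t.1 t.2)
    (fun s => by simp [pairWeight]) (x := x) (K := Real.exp (2 * Real.exp 1))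
    (fun s => sum_pairWeight_mul_exp_le hα (hx s) (hx1 s) ℓ)
  calc _ ≤ ∑ t ∈ Fintype.piFinset fun _ : σ => Finset.range (ℓ + 1) ×ˢ Finset.range (ℓ + 1),
        (∏ s, |pairWeight α (x s) (t s).1 (t s).2|) *
          Real.exp (∑ s, (((t s).1 + (t s).2 : ℕ) : ℝ)) := by
        refine (Finset.sum_le_sum_of_subset_of_nonneg (Finset.filter_subset _ _)
          fun _ _ _ => by positivity).trans (Finset.sum_le_sum fun t _ => ?_)
        rw [Finset.abs_prod]
        push_cast
        gcongr
        linarith [Real.add_one_le_exp (∑ s, (((t s).1 : ℝ) + (t s).2))]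
    _ ≤ _ := h.trans (Real.exp_le_exp.2 (mul_le_of_le_one_right (Real.exp_pos _).le hV))

end TruncatedProducts

/-! ### Resonators and the twisted first moment -/

section Resonator

variable {F : Type u} [Field F] {Q : F[X]}

/-- The coefficient of `χ (∏ p_s ^ e_s)` in the exponential of `α ∑ χ(p_s) / |p_s| ^ (1/2)`. -/
def blockCoeff {σ : Type*} [Fintype σ] (p : σ → F[X]) (α : ℝ) (e : σ → ℕ) : ℝ :=
  ∏ s, α ^ e s / (e s).factorial * (invSqrtCard F ^ (p s).natDegree) ^ e s

theorem pow_div_factorial_mul_multinomial {σ : Type*} [Fintype σ] (p : σ → F[X]) (α : ℝ)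
    (e : σ → ℕ) : α ^ (∑ s, e s) / (∑ s, e s).factorial * (Nat.multinomial Finset.univ e *
      ∏ s, (invSqrtCard F ^ (p s).natDegree) ^ e s) = blockCoeff p α e := by
  simp_rw [blockCoeff, div_eq_mul_inv, Finset.prod_mul_distrib]
  rw [← multinomial_div_factorial, Finset.prod_pow_eq_pow_sum]
  ring

theorem expTrunc_mul_primeSum {σ : Type*} [Fintype σ] (p : σ → F[X]) (ℓ : ℕ) (α : ℝ)
    (χ : DirChar Q) : expTrunc ℓ (α * primeSum p χ) =
      ∑ e ∈ expSet σ ℓ, (blockCoeff p α e : ℂ) * χ.val (monomialOf p e) := by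
  have h := sum_mul_primeSum_pow p (fun r => α ^ r / r.factorial) ℓ χ
  simp_rw [pow_div_factorial_mul_multinomial] at h
  rw [← h, expTrunc]
  refine Finset.sum_congr rfl fun r _ => ?_
  push_cast
  rw [mul_pow]
  ring

theorem sum_abs_blockCoeff_le {σ : Type*} [Fintype σ] (p : σ → F[X]) (ℓ : ℕ) (α : ℝ) {Y : ℝ}
    (hY : 1 ≤ Y) (hS : ∑ s, invSqrtCard F ^ (p s).natDegree ≤ Y)
    (h0 : 0 ≤ ∑ s, invSqrtCard F ^ (p s).natDegree) :
    ∑ e ∈ expSet σ ℓ, |blockCoeff p α e| ≤ Real.exp |α| * Y ^ ℓ := by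
  have hv : 0 ≤ invSqrtCard F := inv_nonneg.2 (Real.sqrt_nonneg _)
  have habs : ∀ e, |blockCoeff p α e| = blockCoeff p |α| e := by
    intro e
    rw [blockCoeff, Finset.abs_prod]
    refine Finset.prod_congr rfl fun s _ => ?_
    rw [abs_mul, abs_div, abs_pow, Nat.abs_cast, abs_of_nonneg (pow_nonneg (pow_nonneg hv _) _)]
  have h := sum_mul_sum_pow (fun r => |α| ^ r / (r.factorial : ℝ))
    (fun s => invSqrtCard F ^ (p s).natDegree) ℓ
  simp_rw [pow_div_factorial_mul_multinomial] at h
  simp_rw [habs]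
  rw [← h]
  calc _ ≤ ∑ r ∈ Finset.range (ℓ + 1), |α| ^ r / r.factorial * Y ^ ℓ := by
        refine Finset.sum_le_sum fun r hr => ?_
        have h1 : (∑ s, invSqrtCard F ^ (p s).natDegree) ^ r ≤ Y ^ ℓ :=
          (pow_le_pow_left₀ h0 hS r).trans
            (pow_le_pow_right₀ hY (Nat.lt_succ_iff.1 (Finset.mem_range.1 hr)))
        gcongr
    _ ≤ _ := by
        rw [← Finset.sum_mul]
        gcongr
        exact sum_pow_div_factorial_le_exp (abs_nonneg _) _

variable {ι : Type*} [Fintype ι] {σ : ι → Type*} [∀ i, Fintype (σ i)]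

/-- Disjoint blocks of primes, the `i`-th with degrees at most `D i` and `∑ 1 / |P| ≤ 1`. -/
structure IsBlockSystem (p : (i : ι) → σ i → F[X]) (D : ι → ℕ) : Prop where
  isPrimeFamily : IsPrimeFamily fun s : Σ i, σ i => p s.1 s.2
  natDegree_le : ∀ i s, (p i s).natDegree ≤ D i
  sum_le : ∀ i, ∑ s, invSqrtCard F ^ (2 * (p i s).natDegree) ≤ 1

/-- The product over all blocks of the truncated exponentials of `α ∑ χ(P) / |P| ^ (1/2)`, a short
Dirichlet polynomial which imitates `L(1/2, χ) ^ α`. -/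
def resonator (p : (i : ι) → σ i → F[X]) (ℓ : ι → ℕ) (α : ℝ) (χ : DirChar Q) : ℂ :=
  ∏ i, expTrunc (ℓ i) (α * primeSum (p i) χ)

/-- The coefficients of `resonator`. -/
def resonatorCoeff (p : (i : ι) → σ i → F[X]) (α : ℝ) (e : (i : ι) → σ i → ℕ) : ℝ :=
  ∏ i, blockCoeff (p i) α (e i)

/-- The monic polynomial `∏ p_{i,s} ^ e_{i,s}`. -/
def blockMonomial (p : (i : ι) → σ i → F[X]) (e : (i : ι) → σ i → ℕ) : F[X] :=
  monomialOf (fun s : Σ i, σ i => p s.1 s.2) fun s => e s.1 s.2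

theorem monic_blockMonomial {p : (i : ι) → σ i → F[X]} {D : ι → ℕ} (hp : IsBlockSystem p D)
    (e : (i : ι) → σ i → ℕ) : (blockMonomial p e).Monic :=
  hp.isPrimeFamily.monic_monomialOf _

theorem natDegree_blockMonomial {p : (i : ι) → σ i → F[X]} {D : ι → ℕ}
    (hp : IsBlockSystem p D) (e : (i : ι) → σ i → ℕ) :
    (blockMonomial p e).natDegree = ∑ i, ∑ s, e i s * (p i s).natDegree := by
  rw [blockMonomial, hp.isPrimeFamily.natDegree_monomialOf, Fintype.sum_sigma]

theorem isCoprime_blockMonomial_sub {p : (i : ι) → σ i → F[X]} {D : ι → ℕ}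
    (hp : IsBlockSystem p D) (e e' : (i : ι) → σ i → ℕ) :
    IsCoprime (blockMonomial p fun i s => e i s - e' i s)
      (blockMonomial p fun i s => e' i s - e i s) :=
  hp.isPrimeFamily.isCoprime_monomialOf_sub (fun s : Σ i, σ i => e s.1 s.2) fun s => e' s.1 s.2

variable [DecidableEq ι]

theorem natDegree_blockMonomial_le {p : (i : ι) → σ i → F[X]} {D : ι → ℕ}
    (hp : IsBlockSystem p D) {ℓ : ι → ℕ} {e : (i : ι) → σ i → ℕ}
    (he : e ∈ Fintype.piFinset fun i => expSet (σ i) (ℓ i)) :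
    (blockMonomial p e).natDegree ≤ ∑ i, ℓ i * D i :=
  natDegree_monomialOf_sigma_le hp.isPrimeFamily hp.natDegree_le (Fintype.mem_piFinset.1 he)

theorem resonator_eq_sum (p : (i : ι) → σ i → F[X]) (ℓ : ι → ℕ) (α : ℝ) (χ : DirChar Q) :
    resonator p ℓ α χ = ∑ e ∈ Fintype.piFinset fun i => expSet (σ i) (ℓ i),
      (resonatorCoeff p α e : ℂ) * χ.val (blockMonomial p e) := by
  simp_rw [resonator, expTrunc_mul_primeSum]
  rw [Finset.prod_univ_sum]
  refine Finset.sum_congr rfl fun e _ => ?_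
  rw [Finset.prod_mul_distrib, prod_val_monomialOf, resonatorCoeff, Complex.ofReal_prod,
    blockMonomial]

theorem sum_sum_prod_piFinset {A : ι → Type*} (E : (i : ι) → Finset (A i))
    (g : (i : ι) → A i → A i → ℝ) :
    ∑ e ∈ Fintype.piFinset E, ∑ e' ∈ Fintype.piFinset E, ∏ i, g i (e i) (e' i) =
      ∏ i, ∑ a ∈ E i, ∑ b ∈ E i, g i a b := by
  rw [Finset.prod_univ_sum]
  refine Finset.sum_congr rfl fun e _ => ?_
  rw [Finset.prod_univ_sum]

/-- The diagonal of the twisted first moment is a product over the blocks. -/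
theorem sum_sum_coeff_dvd_eq {p : (i : ι) → σ i → F[X]} {D : ι → ℕ} (hp : IsBlockSystem p D)
    (ℓ : ι → ℕ) (k : ℝ) [DecidableRel fun f g : F[X] => f ∣ g] :
    ∑ e ∈ Fintype.piFinset fun i => expSet (σ i) (ℓ i),
      ∑ e' ∈ Fintype.piFinset fun i => expSet (σ i) (ℓ i),
        resonatorCoeff p (k - 1) e * resonatorCoeff p k e' *
          (if blockMonomial p e ∣ blockMonomial p e' then invSqrtCard F ^
            ((blockMonomial p e').natDegree - (blockMonomial p e).natDegree) else 0) =
      ∏ i, ∑ e ∈ expSet (σ i) (ℓ i),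
        ∏ s, firstWeight k (invSqrtCard F ^ (2 * (p i s).natDegree)) (e s) := by
  classical
  set v := invSqrtCard F
  let g : (i : ι) → (σ i → ℕ) → (σ i → ℕ) → ℝ := fun i e e' =>
    ∏ s, if e s ≤ e' s then (k - 1) ^ e s / (e s).factorial * (k ^ e' s / (e' s).factorial) *
      (v ^ (2 * (p i s).natDegree)) ^ e' s else 0
  have hterm : ∀ e e' : (i : ι) → σ i → ℕ, resonatorCoeff p (k - 1) e * resonatorCoeff p k e' *
      (if blockMonomial p e ∣ blockMonomial p e' then v ^
        ((blockMonomial p e').natDegree - (blockMonomial p e).natDegree) else 0) =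
      ∏ i, g i (e i) (e' i) := by
    intro e e'
    simp only [g, Finset.prod_ite_zero, Finset.mem_univ, true_implies, blockMonomial,
      hp.isPrimeFamily.monomialOf_dvd_iff, Sigma.forall]
    split_ifs with h
    · rw [hp.isPrimeFamily.natDegree_monomialOf, hp.isPrimeFamily.natDegree_monomialOf,
        Fintype.sum_sigma, Fintype.sum_sigma, ← Finset.sum_tsub_distrib _ fun i _ =>
          Finset.sum_le_sum fun s _ => Nat.mul_le_mul_right _ (h i s),
        ← Finset.prod_pow_eq_pow_sum, resonatorCoeff, resonatorCoeff, ← Finset.prod_mul_distrib,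
        ← Finset.prod_mul_distrib]
      refine Finset.prod_congr rfl fun i _ => ?_
      rw [← Finset.sum_tsub_distrib _ fun s _ => Nat.mul_le_mul_right _ (h i s),
        ← Finset.prod_pow_eq_pow_sum, blockCoeff, blockCoeff, ← Finset.prod_mul_distrib,
        ← Finset.prod_mul_distrib]
      refine Finset.prod_congr rfl fun s _ => ?_
      dsimp only
      obtain ⟨c, hc⟩ := Nat.exists_eq_add_of_le (h i s)
      rw [hc, ← Nat.sub_mul, Nat.add_sub_cancel_left]
      ring
    · rw [mul_zero]
  simp_rw [hterm]
  rw [sum_sum_prod_piFinset]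
  refine Finset.prod_congr rfl fun i _ => ?_
  rw [Finset.sum_comm]
  refine Finset.sum_congr rfl fun e' he' => ?_
  have hsub : (Fintype.piFinset fun s => Finset.range (e' s + 1)) ⊆ expSet (σ i) (ℓ i) := by
    intro e he
    rw [mem_expSet] at he' ⊢
    refine (Finset.sum_le_sum fun s _ => ?_).trans he'
    have := Fintype.mem_piFinset.1 he s
    rw [Finset.mem_range] at this
    omega
  rw [← Finset.sum_subset hsub]
  · have e1 : ∀ e ∈ Fintype.piFinset fun s => Finset.range (e' s + 1), g i e e' =
        ∏ s, (k - 1) ^ e s / (e s).factorial * (k ^ e' s / (e' s).factorial) *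
          (v ^ (2 * (p i s).natDegree)) ^ e' s := by
      intro e he
      refine Finset.prod_congr rfl fun s _ => if_pos ?_
      have := Fintype.mem_piFinset.1 he s
      rw [Finset.mem_range] at this
      omega
    rw [Finset.sum_congr rfl e1, ← Finset.prod_univ_sum (fun s => Finset.range (e' s + 1))
      fun s a => (k - 1) ^ a / (a.factorial : ℝ) * (k ^ e' s / (e' s).factorial) *
          (v ^ (2 * (p i s).natDegree)) ^ e' s]
    refine Finset.prod_congr rfl fun s _ => ?_
    rw [firstWeight, ← Finset.sum_mul, ← Finset.sum_mul]
    ring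
  · intro e _ he
    rw [Fintype.mem_piFinset] at he
    push Not at he
    obtain ⟨s, hs⟩ := he
    rw [Finset.mem_range] at hs
    exact Finset.prod_eq_zero (Finset.mem_univ s) (if_neg (by omega))

variable [Finite F]

/-- The resonator is short: its coefficients add up to a small power of `|Q|` if `∑ ℓ_i D_i` is
small compared with `deg Q`. -/
theorem sum_abs_resonatorCoeff_le {p : (i : ι) → σ i → F[X]} {D : ι → ℕ} (hp : IsBlockSystem p D)
    (ℓ : ι → ℕ) (α : ℝ) :
    ∑ e ∈ Fintype.piFinset fun i => expSet (σ i) (ℓ i), |resonatorCoeff p α e| ≤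
      Real.exp (|α| * Fintype.card ι) * (invSqrtCard F)⁻¹ ^ (∑ i, ℓ i * D i) := by
  have hv0 := invSqrtCard_pos F
  have hv1 : 1 ≤ (invSqrtCard F)⁻¹ :=
    (one_le_inv₀ hv0).2 ((invSqrtCard_le F).trans (by norm_num))
  simp_rw [resonatorCoeff, Finset.abs_prod]
  rw [← Finset.prod_univ_sum (fun i => expSet (σ i) (ℓ i)) fun i e => |blockCoeff (p i) α e|]
  have hS : ∀ i, ∑ s, invSqrtCard F ^ (p i s).natDegree ≤ (invSqrtCard F)⁻¹ ^ D i := by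
    intro i
    calc _ ≤ ∑ s, invSqrtCard F ^ (2 * (p i s).natDegree) * (invSqrtCard F)⁻¹ ^ D i := by
          refine Finset.sum_le_sum fun s _ => ?_
          have h1 : (invSqrtCard F)⁻¹ ^ (p i s).natDegree ≤ (invSqrtCard F)⁻¹ ^ D i :=
            pow_le_pow_right₀ hv1 (hp.natDegree_le i s)
          calc _ = invSqrtCard F ^ (2 * (p i s).natDegree) *
                (invSqrtCard F)⁻¹ ^ (p i s).natDegree := by
                rw [two_mul, pow_add, mul_assoc, ← mul_pow, mul_inv_cancel₀ hv0.ne', one_pow,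
                  mul_one]
            _ ≤ _ := by gcongr
      _ ≤ _ := by
          rw [← Finset.sum_mul]
          exact mul_le_of_le_one_left (by positivity) (hp.sum_le i)
  calc _ ≤ ∏ i, Real.exp |α| * ((invSqrtCard F)⁻¹ ^ D i) ^ ℓ i := by
        refine Finset.prod_le_prod (fun i _ => Finset.sum_nonneg fun _ _ => abs_nonneg _)
          fun i _ => ?_
        exact sum_abs_blockCoeff_le _ _ _ (one_le_pow₀ hv1) (hS i) (by positivity)
    _ = _ := by
        rw [Finset.prod_mul_distrib, Finset.prod_const, Finset.card_univ, ← Real.exp_nat_mul,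
          mul_comm |α|]
        congr 1
        rw [← Finset.prod_pow_eq_pow_sum]
        exact Finset.prod_congr rfl fun i _ => by rw [← pow_mul, mul_comm]

theorem norm_resonator_le {p : (i : ι) → σ i → F[X]} {D : ι → ℕ} (hp : IsBlockSystem p D)
    (hQ : Q ≠ 0) (ℓ : ι → ℕ) (α : ℝ) (χ : DirChar Q) : ‖resonator p ℓ α χ‖ ≤
      Real.exp (|α| * Fintype.card ι) * (invSqrtCard F)⁻¹ ^ (∑ i, ℓ i * D i) := by
  rw [resonator_eq_sum]
  refine (norm_sum_le _ _).trans (le_trans (Finset.sum_le_sum fun e _ => ?_)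
    (sum_abs_resonatorCoeff_le hp ℓ α))
  rw [norm_mul, Complex.norm_real, Real.norm_eq_abs]
  exact mul_le_of_le_one_right (abs_nonneg _) (norm_val_le_one hQ χ _)

variable (Q) in
theorem norm_lPoly_principal_le (hQ : Irreducible Q) :
    ‖DirChar.lPoly (1 : DirChar Q)‖ ≤ 3 * (invSqrtCard F)⁻¹ ^ Q.natDegree := by
  have hv0 := invSqrtCard_pos F
  set w := (invSqrtCard F)⁻¹ with hw
  have hw1 : 4 / 3 ≤ w := by
    rw [hw, le_inv_comm₀ (by norm_num) hv0]
    exact (invSqrtCard_le F).trans (by norm_num)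
  have h1 : ∀ n, invSqrtCard F ^ n * (Nat.card F ^ n : ℕ) = w ^ n := fun n => by
    rw [card_pow_eq, two_mul, pow_add, ← mul_assoc, ← mul_pow, mul_inv_cancel₀ hv0.ne', one_pow,
      one_mul]
  rw [lPoly_principal hQ, Complex.norm_real, Finset.sum_congr rfl fun n _ => h1 n,
    Real.norm_of_nonneg (by positivity), geom_sum_eq (by linarith), div_le_iff₀ (by linarith)]
  have : 0 < w ^ Q.natDegree := by positivity
  nlinarith

variable [Fintype (DirChar Q)]

open Classical in
/-- The first moment of `L(1/2, χ)` twisted by `resonator`. -/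
theorem norm_sum_lPoly_resonator_sub_le (hQ : Irreducible Q) {p : (i : ι) → σ i → F[X]}
    {D : ι → ℕ} (hp : IsBlockSystem p D) {ℓ : ι → ℕ} (hℓ : ∑ i, ℓ i * D i < Q.natDegree)
    {k : ℝ} (hk : 0 ≤ k) :
    ‖∑ χ ∈ Finset.univ.erase (1 : DirChar Q),
        χ.lPoly * (resonator p ℓ (k - 1) χ * (starRingEnd ℂ) (resonator p ℓ k χ)) -
      ((numChars Q * ∏ i, ∑ e ∈ expSet (σ i) (ℓ i),
        ∏ s, firstWeight k (invSqrtCard F ^ (2 * (p i s).natDegree)) (e s) : ℝ) : ℂ)‖ ≤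
      4 * Real.exp ((2 * k + 1) * Fintype.card ι) *
        (invSqrtCard F)⁻¹ ^ (Q.natDegree + 3 * ∑ i, ℓ i * D i) := by
  set E := Fintype.piFinset fun i => expSet (σ i) (ℓ i)
  set Δ := ∑ i, ℓ i * D i with hΔ
  set N := Q.natDegree
  set Φ : ℝ := (numChars Q : ℝ) with hΦ
  have hv0 := invSqrtCard_pos F
  set v := invSqrtCard F with hv
  set w := v⁻¹ with hw
  have hw1 : 1 ≤ w := (one_le_inv₀ hv0).2 ((invSqrtCard_le F).trans (by norm_num))
  have hvw : v * w = 1 := mul_inv_cancel₀ hv0.ne'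
  set C := Real.exp ((2 * k + 1) * Fintype.card ι) with hC
  have hΦ0 : 0 ≤ Φ := Nat.cast_nonneg _
  have hΦ1 : Φ ≤ w ^ (2 * N) := by rw [hΦ, numChars_eq hQ]; linarith
  have hl1 := sum_abs_resonatorCoeff_le hp ℓ (k - 1)
  have hl2 := sum_abs_resonatorCoeff_le hp ℓ k
  have hCC : Real.exp (|k - 1| * Fintype.card ι) * Real.exp (|k| * Fintype.card ι) ≤ C := by
    rw [← Real.exp_add, ← add_mul, hC, abs_of_nonneg hk]
    have : |k - 1| ≤ k + 1 := by rw [abs_le]; constructor <;> linarith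
    exact Real.exp_le_exp.2 (mul_le_mul_of_nonneg_right (by linarith) (Nat.cast_nonneg _))
  have hsum : ∑ χ : DirChar Q,
      χ.lPoly * (resonator p ℓ (k - 1) χ * (starRingEnd ℂ) (resonator p ℓ k χ)) =
      ∑ e ∈ E, ∑ e' ∈ E, ((resonatorCoeff p (k - 1) e * resonatorCoeff p k e' : ℝ) : ℂ) *
        ∑ χ : DirChar Q, χ.lPoly * (χ.val (blockMonomial p e) *
          (starRingEnd ℂ) (χ.val (blockMonomial p e'))) := by
    simp_rw [resonator_eq_sum, map_sum, Finset.sum_mul_sum, Finset.mul_sum]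
    rw [Finset.sum_comm]
    refine Finset.sum_congr rfl fun e _ => ?_
    rw [Finset.sum_comm]
    refine Finset.sum_congr rfl fun e' _ => Finset.sum_congr rfl fun χ _ => ?_
    rw [map_mul, Complex.conj_ofReal]
    push_cast
    ring
  have hmain : ‖∑ χ : DirChar Q,
      χ.lPoly * (resonator p ℓ (k - 1) χ * (starRingEnd ℂ) (resonator p ℓ k χ)) -
      ((Φ * ∏ i, ∑ e ∈ expSet (σ i) (ℓ i),
        ∏ s, firstWeight k (v ^ (2 * (p i s).natDegree)) (e s) : ℝ) : ℂ)‖ ≤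
      C * w ^ (N + 3 * Δ) := by
    rw [hsum, ← sum_sum_coeff_dvd_eq hp ℓ k]
    have hdist : ∀ f : ((i : ι) → σ i → ℕ) → ((i : ι) → σ i → ℕ) → ℝ,
        ((Φ * ∑ e ∈ E, ∑ e' ∈ E, f e e' : ℝ) : ℂ) = ∑ e ∈ E, ∑ e' ∈ E, ((Φ * f e e' : ℝ) : ℂ) := by
      intro f
      push_cast
      simp_rw [Finset.mul_sum]
    rw [hdist, ← Finset.sum_sub_distrib]
    simp_rw [← Finset.sum_sub_distrib]
    calc _ ≤ ∑ e ∈ E, ∑ e' ∈ E, |resonatorCoeff p (k - 1) e| * |resonatorCoeff p k e'| *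
          (w ^ (2 * N) * v ^ (N - Δ)) := by
          refine (norm_sum_le _ _).trans (Finset.sum_le_sum fun e he =>
            (norm_sum_le _ _).trans (Finset.sum_le_sum fun e' he' => ?_))
          have hd := natDegree_blockMonomial_le hp he
          have hd' := natDegree_blockMonomial_le hp he'
          have h1 := norm_sum_lPoly_sub_le hQ (monic_blockMonomial hp e)
            (monic_blockMonomial hp e') (by omega) (by omega)
          have h2 : (Φ : ℂ) = (numChars Q : ℂ) := by rw [hΦ, Complex.ofReal_natCast]
          have h3 : (((Φ * (resonatorCoeff p (k - 1) e * resonatorCoeff p k e' *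
              (if blockMonomial p e ∣ blockMonomial p e' then v ^
              ((blockMonomial p e').natDegree - (blockMonomial p e).natDegree) else 0)) : ℝ)) : ℂ) =
              ((resonatorCoeff p (k - 1) e * resonatorCoeff p k e' : ℝ) : ℂ) *
              (numChars Q * (if blockMonomial p e ∣ blockMonomial p e' then (v : ℂ) ^
              ((blockMonomial p e').natDegree - (blockMonomial p e).natDegree) else 0)) := by
            split_ifs
            · push_cast; rw [h2]; ring
            · simp
          rw [h3, ← mul_sub, norm_mul, Complex.norm_real, Real.norm_eq_abs, abs_mul]
          refine mul_le_mul_of_nonneg_left (h1.trans ?_) (by positivity)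
          have h4 : v ^ (N - (blockMonomial p e).natDegree) ≤ v ^ (N - Δ) :=
            pow_le_pow_of_le_one hv0.le ((invSqrtCard_le F).trans (by norm_num)) (by omega)
          gcongr
      _ = (∑ e ∈ E, |resonatorCoeff p (k - 1) e|) * (∑ e ∈ E, |resonatorCoeff p k e|) *
          (w ^ (2 * N) * v ^ (N - Δ)) := by
          rw [Finset.sum_mul_sum, Finset.sum_mul]
          exact Finset.sum_congr rfl fun e _ => by rw [Finset.sum_mul]
      _ ≤ (Real.exp (|k - 1| * Fintype.card ι) * w ^ Δ) *
          (Real.exp (|k| * Fintype.card ι) * w ^ Δ) * (w ^ (2 * N) * v ^ (N - Δ)) := by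
          gcongr
      _ = (Real.exp (|k - 1| * Fintype.card ι) * Real.exp (|k| * Fintype.card ι)) *
          (w ^ (2 * Δ + 2 * N) * v ^ (N - Δ)) := by ring
      _ ≤ C * w ^ (N + 3 * Δ) := by
          have h5 : w ^ (2 * Δ + 2 * N) * v ^ (N - Δ) = w ^ (N + 3 * Δ) := by
            rw [show 2 * Δ + 2 * N = N + 3 * Δ + (N - Δ) by omega, pow_add _ (N + 3 * Δ),
              mul_assoc, ← mul_pow, mul_comm w, hvw, one_pow, mul_one]
          rw [h5]
          gcongr
  have hprin : ‖DirChar.lPoly (1 : DirChar Q) * (resonator p ℓ (k - 1) (1 : DirChar Q) *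
      (starRingEnd ℂ) (resonator p ℓ k (1 : DirChar Q)))‖ ≤ 3 * C * w ^ (N + 3 * Δ) := by
    rw [norm_mul, norm_mul, RCLike.norm_conj]
    calc _ ≤ 3 * w ^ N * ((Real.exp (|k - 1| * Fintype.card ι) * w ^ Δ) *
          (Real.exp (|k| * Fintype.card ι) * w ^ Δ)) := by
          gcongr
          · exact norm_lPoly_principal_le Q hQ
          · exact norm_resonator_le hp hQ.ne_zero ℓ _ _
          · exact norm_resonator_le hp hQ.ne_zero ℓ _ _
      _ = 3 * (Real.exp (|k - 1| * Fintype.card ι) * Real.exp (|k| * Fintype.card ι)) *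
          w ^ (N + 2 * Δ) := by ring
      _ ≤ _ := by
          gcongr
          norm_num
  rw [← Finset.sum_erase_add Finset.univ _ (Finset.mem_univ (1 : DirChar Q))] at hmain
  set A := ∑ χ ∈ Finset.univ.erase (1 : DirChar Q),
        χ.lPoly * (resonator p ℓ (k - 1) χ * (starRingEnd ℂ) (resonator p ℓ k χ))
  set B := DirChar.lPoly (1 : DirChar Q) * (resonator p ℓ (k - 1) (1 : DirChar Q) *
      (starRingEnd ℂ) (resonator p ℓ k (1 : DirChar Q)))
  set Z := ((Φ * ∏ i, ∑ e ∈ expSet (σ i) (ℓ i),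
        ∏ s, firstWeight k (v ^ (2 * (p i s).natDegree)) (e s) : ℝ) : ℂ)
  calc ‖A - Z‖ = ‖(A + B - Z) - B‖ := by congr 1; ring
    _ ≤ ‖A + B - Z‖ + ‖B‖ := norm_sub_le _ _
    _ ≤ C * w ^ (N + 3 * Δ) + 3 * C * w ^ (N + 3 * Δ) := add_le_add hmain hprin
    _ = _ := by ring

end Resonator

/-! ### Moments of resonators -/

section ResonatorMoments

variable {ι : Type*} [Fintype ι]

/-- A product over `ι` weighted by a sum over `ι` of functions of one variable: the weight spoils
one factor at a time. -/
theorem abs_sum_sum_prod_mul_sum_le [DecidableEq ι] {A : ι → Type*} (E : (i : ι) → Finset (A i))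
    (g lam : (i : ι) → A i → A i → ℝ) (hlam : ∀ i a b, 0 ≤ lam i a b) {h τ : ι → ℝ}
    (hh : ∀ i, |∑ a ∈ E i, ∑ b ∈ E i, g i a b| ≤ h i)
    (hτ : ∀ i, ∑ a ∈ E i, ∑ b ∈ E i, |g i a b| * lam i a b ≤ τ i) :
    |∑ e ∈ Fintype.piFinset E, ∑ e' ∈ Fintype.piFinset E,
        (∏ i, g i (e i) (e' i)) * ∑ j, lam j (e j) (e' j)| ≤
      ∑ j, τ j * ∏ i ∈ Finset.univ.erase j, h i := by
  have hswap : ∑ e ∈ Fintype.piFinset E, ∑ e' ∈ Fintype.piFinset E,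
        (∏ i, g i (e i) (e' i)) * ∑ j, lam j (e j) (e' j) =
      ∑ j, ∏ i, ∑ a ∈ E i, ∑ b ∈ E i, g i a b * (if i = j then lam i a b else 1) := by
    have h1 : ∀ j, ∏ i, ∑ a ∈ E i, ∑ b ∈ E i, g i a b * (if i = j then lam i a b else 1) =
        ∑ e ∈ Fintype.piFinset E, ∑ e' ∈ Fintype.piFinset E,
          (∏ i, g i (e i) (e' i)) * lam j (e j) (e' j) := by
      intro j
      rw [← sum_sum_prod_piFinset E fun i a b => g i a b * (if i = j then lam i a b else 1)]
      refine Finset.sum_congr rfl fun e _ => Finset.sum_congr rfl fun e' _ => ?_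
      rw [Finset.prod_mul_distrib, Finset.prod_ite_eq' Finset.univ j, if_pos (Finset.mem_univ j)]
    simp_rw [h1, Finset.mul_sum]
    rw [Finset.sum_comm (s := Finset.univ) (t := Fintype.piFinset E)]
    refine Finset.sum_congr rfl fun e _ => ?_
    rw [Finset.sum_comm]
  rw [hswap]
  refine (Finset.abs_sum_le_sum_abs _ _).trans (Finset.sum_le_sum fun j _ => ?_)
  rw [Finset.abs_prod, ← Finset.mul_prod_erase _ _ (Finset.mem_univ j)]
  simp only [if_true]
  have h0 : 0 ≤ τ j := (Finset.sum_nonneg fun a _ => Finset.sum_nonneg fun b _ =>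
    mul_nonneg (abs_nonneg _) (hlam j a b)).trans (hτ j)
  refine mul_le_mul ?_ (Finset.prod_le_prod (fun i _ => abs_nonneg _) fun i hi => ?_)
    (Finset.prod_nonneg fun i _ => abs_nonneg _) h0
  · refine le_trans ?_ (hτ j)
    refine (Finset.abs_sum_le_sum_abs _ _).trans (Finset.sum_le_sum fun a _ => ?_)
    refine (Finset.abs_sum_le_sum_abs _ _).trans (Finset.sum_le_sum fun b _ => ?_)
    rw [abs_mul, abs_of_nonneg (hlam j a b)]
  · simp only [if_neg (Finset.ne_of_mem_erase hi), mul_one]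
    exact hh i

variable {F : Type u} [Field F] {Q : F[X]}
variable {σ : ι → Type*} [∀ i, Fintype (σ i)] {p : (i : ι) → σ i → F[X]} {D : ι → ℕ}

/-- The diagonal terms of the second moment factor over the primes. -/
theorem resonatorCoeff_mul_mul_pow (hp : IsBlockSystem p D) (α : ℝ) (e e' : (i : ι) → σ i → ℕ) :
    resonatorCoeff p α e * resonatorCoeff p α e' * invSqrtCard F ^
      ((blockMonomial p fun i s => e i s - e' i s).natDegree +
        (blockMonomial p fun i s => e' i s - e i s).natDegree) =
      ∏ i, ∏ s, pairWeight α (invSqrtCard F ^ (2 * (p i s).natDegree)) (e i s) (e' i s) := by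
  rw [natDegree_blockMonomial hp, natDegree_blockMonomial hp, ← Finset.sum_add_distrib,
    ← Finset.prod_pow_eq_pow_sum, resonatorCoeff, resonatorCoeff, ← Finset.prod_mul_distrib,
    ← Finset.prod_mul_distrib]
  refine Finset.prod_congr rfl fun i _ => ?_
  rw [← Finset.sum_add_distrib, ← Finset.prod_pow_eq_pow_sum, blockCoeff, blockCoeff,
    ← Finset.prod_mul_distrib, ← Finset.prod_mul_distrib]
  refine Finset.prod_congr rfl fun s _ => ?_
  rw [pairWeight]
  have h1 : 2 * (p i s).natDegree * max (e i s) (e' i s) = (p i s).natDegree * e i s +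
      (p i s).natDegree * e' i s + ((e i s - e' i s) * (p i s).natDegree +
        (e' i s - e i s) * (p i s).natDegree) := by
    have : 2 * max (e i s) (e' i s) = e i s + e' i s + ((e i s - e' i s) + (e' i s - e i s)) := by
      omega
    calc _ = (p i s).natDegree * (2 * max (e i s) (e' i s)) := by ring
      _ = _ := by rw [this]; ring
  rw [← pow_mul _ (2 * (p i s).natDegree), h1, pow_add _ (_ + _), pow_add _ (_ * _), pow_mul,
    pow_mul]
  ring

variable [Finite F]

/-- The common divisor of the two monomials cancels. -/
theorem val_mul_conj_blockMonomial (hQ : Irreducible Q) (hp : IsBlockSystem p D)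
    {e e' : (i : ι) → σ i → ℕ} (he : (blockMonomial p e).natDegree < Q.natDegree)
    (χ : DirChar Q) :
    χ.val (blockMonomial p e) * (starRingEnd ℂ) (χ.val (blockMonomial p e')) =
      χ.val (blockMonomial p fun i s => e i s - e' i s) *
        (starRingEnd ℂ) (χ.val (blockMonomial p fun i s => e' i s - e i s)) := by
  set d := blockMonomial p fun i s => min (e i s) (e' i s) with hd
  have h1 : blockMonomial p e = d * blockMonomial p fun i s => e i s - e' i s :=
    monomialOf_eq_mul _ (fun s : Σ i, σ i => e s.1 s.2) fun s => e' s.1 s.2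
  have h2 : blockMonomial p e' = d * blockMonomial p fun i s => e' i s - e i s := by
    rw [hd]
    simp_rw [min_comm (e _ _)]
    exact monomialOf_eq_mul _ (fun s : Σ i, σ i => e' s.1 s.2) fun s => e s.1 s.2
  have hdm : d.Monic := monic_blockMonomial hp _
  have hdd : d.natDegree < Q.natDegree := by
    rw [h1, hdm.natDegree_mul (monic_blockMonomial hp _)] at he
    omega
  have h3 := val_mul_conj_self hQ.ne_zero χ (isUnit_mk_of_natDegree_lt hQ hdm.ne_zero hdd)
  rw [h1, h2, val_mul, val_mul, map_mul, mul_mul_mul_comm, h3, one_mul]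

variable [Fintype (DirChar Q)]

/-- The bound for the contribution of one block of primes to the twisted second moment. -/
def blockBound (k : ℝ) (ℓ : ℕ) {σ : Type*} [Fintype σ] (p : σ → F[X]) : ℝ :=
  Real.exp ((k ^ 2 - 1) * ∑ s, invSqrtCard F ^ (2 * (p s).natDegree) +
    9 * ∑ s, (invSqrtCard F ^ (2 * (p s).natDegree)) ^ 2 +
    Real.exp (Real.exp (2 * Real.exp 1) + 1) * Real.exp (-ℓ))

open Classical in
/-- The second moment of `L(1/2, χ)` twisted by `resonator`. By `norm_sum_lPoly_conj_sub_le` the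
coprime parts `f`, `g` of two monomials contribute `deg Q - deg f - deg g`. Without the last two
degrees this gives a product over the blocks; `deg f` and `deg g` are sums over the blocks, so that
they spoil one factor at a time and cost no more than `∑ D_i`. -/
theorem sum_lPoly_sq_resonator_sq_le [DecidableEq ι] (hQ : Irreducible Q)
    (hp : IsBlockSystem p D) {ℓ : ι → ℕ}
    (hℓ1 : ∀ i, 1 ≤ ℓ i) (hℓ : 2 * ∑ i, ℓ i * D i < Q.natDegree) {k : ℝ} (hk : 0 ≤ k)
    (hk1 : k ≤ 1) :
    ∑ χ ∈ Finset.univ.erase (1 : DirChar Q), ‖χ.lPoly‖ ^ 2 * ‖resonator p ℓ (k - 1) χ‖ ^ 2 ≤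
      (numChars Q * (Q.natDegree + Real.exp (Real.exp (2 * Real.exp 1) + 1) * ∑ i, (D i : ℝ)) +
        9 * (invSqrtCard F)⁻¹ ^ (2 * Q.natDegree)) * ∏ i, blockBound k (ℓ i) (p i) +
      Real.exp (2 * Fintype.card ι) * ((Q.natDegree : ℝ) ^ 2 + 18) *
        (invSqrtCard F)⁻¹ ^ (Q.natDegree + 6 * ∑ i, ℓ i * D i) := by
  set E := Fintype.piFinset fun i => expSet (σ i) (ℓ i) with hE
  set Δ := ∑ i, ℓ i * D i with hΔ
  set N := Q.natDegree with hN
  set Φ : ℝ := (numChars Q : ℝ) with hΦ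
  have hΦ0 : 0 ≤ Φ := Nat.cast_nonneg _
  have hα : |k - 1| ≤ 1 := by rw [abs_le]; constructor <;> linarith
  have hκ := secondMomentConst_le F
  have hκ0 : 0 ≤ secondMomentConst F := sq_nonneg _
  set κ := secondMomentConst F
  have hv0 := invSqrtCard_pos F
  set v := invSqrtCard F with hv
  set w := v⁻¹ with hw
  have hw1 : 1 ≤ w := (one_le_inv₀ hv0).2 ((invSqrtCard_le F).trans (by norm_num))
  have hv1 : v ≤ 1 := (invSqrtCard_le F).trans (by norm_num)
  set B : ℝ := ((N : ℝ) ^ 2 + 18) * w ^ (N + 4 * Δ) with hB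
  let c := resonatorCoeff p (k - 1)
  let fs : ((i : ι) → σ i → ℕ) → ((i : ι) → σ i → ℕ) → F[X] := fun e e' =>
    blockMonomial p fun i s => e i s - e' i s
  let deg : ((i : ι) → σ i → ℕ) → ((i : ι) → σ i → ℕ) → ℕ := fun e e' =>
    (fs e e').natDegree + (fs e' e).natDegree
  have hterm : ∀ χ : DirChar Q,
      ((‖χ.lPoly‖ ^ 2 * ‖resonator p ℓ (k - 1) χ‖ ^ 2 : ℝ) : ℂ) =
      ∑ e ∈ E, ∑ e' ∈ E, ((c e * c e' : ℝ) : ℂ) * (χ.lPoly * (starRingEnd ℂ) χ.lPoly *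
        (χ.val (fs e e') * (starRingEnd ℂ) (χ.val (fs e' e)))) := by
    intro χ
    push_cast
    rw [← Complex.mul_conj', ← Complex.mul_conj', resonator_eq_sum, map_sum, Finset.sum_mul_sum,
      Finset.mul_sum]
    refine Finset.sum_congr rfl fun e he => ?_
    rw [Finset.mul_sum]
    refine Finset.sum_congr rfl fun e' he' => ?_
    have hd := natDegree_blockMonomial_le hp he
    rw [← val_mul_conj_blockMonomial hQ hp (by omega), map_mul, Complex.conj_ofReal]
    ring
  have hdeg : ∀ e ∈ E, ∀ e', (fs e e').natDegree ≤ Δ := by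
    intro e he e'
    refine le_trans ?_ (natDegree_blockMonomial_le hp he)
    rw [natDegree_blockMonomial hp, natDegree_blockMonomial hp]
    gcongr
    omega
  have hsum : ((∑ χ ∈ Finset.univ.erase (1 : DirChar Q),
      ‖χ.lPoly‖ ^ 2 * ‖resonator p ℓ (k - 1) χ‖ ^ 2 : ℝ) : ℂ) =
      ∑ e ∈ E, ∑ e' ∈ E, ((c e * c e' : ℝ) : ℂ) * ∑ χ ∈ Finset.univ.erase (1 : DirChar Q),
        χ.lPoly * (starRingEnd ℂ) χ.lPoly *
          (χ.val (fs e e') * (starRingEnd ℂ) (χ.val (fs e' e))) := by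
    rw [Complex.ofReal_sum]
    simp_rw [hterm]
    rw [Finset.sum_comm]
    refine Finset.sum_congr rfl fun e _ => ?_
    rw [Finset.sum_comm]
    refine Finset.sum_congr rfl fun e' _ => ?_
    rw [Finset.mul_sum]
  set M : ℝ := ∑ e ∈ E, ∑ e' ∈ E, c e * c e' *
    (Φ * ((N : ℝ) - deg e e') - κ * w ^ (2 * N)) * v ^ deg e e' with hM
  have herr : |∑ χ ∈ Finset.univ.erase (1 : DirChar Q),
      ‖χ.lPoly‖ ^ 2 * ‖resonator p ℓ (k - 1) χ‖ ^ 2 - M| ≤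
      Real.exp (2 * Fintype.card ι) * ((N : ℝ) ^ 2 + 18) * w ^ (N + 6 * Δ) := by
    rw [← Real.norm_eq_abs, ← Complex.norm_real, Complex.ofReal_sub, hsum, hM, Complex.ofReal_sum,
      ← Finset.sum_sub_distrib]
    calc _ ≤ ∑ e ∈ E, ∑ e' ∈ E, |c e| * |c e'| * B := by
          refine (norm_sum_le _ _).trans (Finset.sum_le_sum fun e he => ?_)
          rw [Complex.ofReal_sum, ← Finset.sum_sub_distrib]
          refine (norm_sum_le _ _).trans (Finset.sum_le_sum fun e' he' => ?_)
          have hd := hdeg e he e'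
          have hd' := hdeg e' he' e
          have h1 := norm_sum_lPoly_conj_sub_le hQ (monic_blockMonomial hp _)
            (monic_blockMonomial hp _)
            (isCoprime_blockMonomial_sub hp e e')
            (show (fs e e').natDegree + (fs e' e).natDegree < Q.natDegree by omega)
          rw [mul_assoc (c e * c e'), Complex.ofReal_mul (c e * c e') (_ * v ^ _), ← mul_sub,
            norm_mul, Complex.norm_real, Real.norm_eq_abs, abs_mul]
          refine mul_le_mul_of_nonneg_left ?_ (by positivity)
          have h2 : w ^ (N + 2 * ((fs e e').natDegree + (fs e' e).natDegree)) ≤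
              w ^ (N + 4 * Δ) := pow_le_pow_right₀ hw1 (by omega)
          refine le_trans (le_of_eq ?_) (h1.trans (mul_le_mul_of_nonneg_left h2 (by positivity)))
          congr 3
          simp only [deg]
          push_cast
          rfl
      _ = (∑ e ∈ E, |c e|) * (∑ e ∈ E, |c e|) * B := by
          rw [Finset.sum_mul_sum, Finset.sum_mul]
          exact Finset.sum_congr rfl fun e _ => by rw [Finset.sum_mul]
      _ ≤ (Real.exp (Fintype.card ι) * w ^ Δ) * (Real.exp (Fintype.card ι) * w ^ Δ) * B := by
          have h3 : ∑ e ∈ E, |c e| ≤ Real.exp (Fintype.card ι) * w ^ Δ := by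
            refine (sum_abs_resonatorCoeff_le hp ℓ (k - 1)).trans ?_
            refine mul_le_mul_of_nonneg_right (Real.exp_le_exp.2 ?_) (by positivity)
            exact mul_le_of_le_one_left (Nat.cast_nonneg _) hα
          have h4 : 0 ≤ ∑ e ∈ E, |c e| := Finset.sum_nonneg fun _ _ => abs_nonneg _
          gcongr
      _ = _ := by
          rw [two_mul, Real.exp_add, hB, show N + 6 * Δ = N + 4 * Δ + Δ + Δ by ring, pow_add,
            pow_add]
          ring
  let g : (i : ι) → (σ i → ℕ) → (σ i → ℕ) → ℝ := fun i e e' =>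
    ∏ s, pairWeight (k - 1) (v ^ (2 * (p i s).natDegree)) (e s) (e' s)
  let lam : (i : ι) → (σ i → ℕ) → (σ i → ℕ) → ℝ := fun i e e' =>
    ∑ s, (((e s - e' s : ℕ) : ℝ) + ((e' s - e s : ℕ) : ℝ)) * (p i s).natDegree
  have hx0 : ∀ i s, 0 ≤ v ^ (2 * (p i s).natDegree) := fun i s => pow_nonneg hv0.le _
  have hx1 : ∀ i s, v ^ (2 * (p i s).natDegree) ≤ 1 := fun i s => pow_le_one₀ hv0.le hv1
  have hh : ∀ i, |∑ a ∈ expSet (σ i) (ℓ i), ∑ b ∈ expSet (σ i) (ℓ i), g i a b| ≤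
      blockBound k (ℓ i) (p i) := fun i =>
    abs_sum_prod_pairWeight_le hk hk1 (hx0 i) (hx1 i) (hp.sum_le i) (hℓ1 i)
  have hτ : ∀ i, ∑ a ∈ expSet (σ i) (ℓ i), ∑ b ∈ expSet (σ i) (ℓ i), |g i a b| * lam i a b ≤
      D i * Real.exp (Real.exp (2 * Real.exp 1)) := by
    intro i
    refine le_trans ?_ (mul_le_mul_of_nonneg_left
      (sum_prod_abs_pairWeight_mul_le hα (hx0 i) (hx1 i) (hp.sum_le i) (ℓ i))
      (Nat.cast_nonneg (D i)))
    rw [Finset.mul_sum]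
    refine Finset.sum_le_sum fun a _ => ?_
    rw [Finset.mul_sum]
    refine Finset.sum_le_sum fun b _ => ?_
    rw [mul_left_comm]
    refine mul_le_mul_of_nonneg_left ?_ (abs_nonneg _)
    rw [Finset.mul_sum]
    refine Finset.sum_le_sum fun s _ => ?_
    have h1 : (((a s - b s : ℕ) : ℝ) + ((b s - a s : ℕ) : ℝ)) ≤ a s + b s := by
      exact_mod_cast (by omega : a s - b s + (b s - a s) ≤ a s + b s)
    have h2 : ((p i s).natDegree : ℝ) ≤ D i := by exact_mod_cast hp.natDegree_le i s
    rw [mul_comm]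
    gcongr
  have hMeq : M = (Φ * N - κ * w ^ (2 * N)) *
      (∏ i, ∑ a ∈ expSet (σ i) (ℓ i), ∑ b ∈ expSet (σ i) (ℓ i), g i a b) -
      Φ * ∑ e ∈ E, ∑ e' ∈ E, (∏ i, g i (e i) (e' i)) * ∑ j, lam j (e j) (e' j) := by
    rw [hM, ← sum_sum_prod_piFinset, Finset.mul_sum, Finset.mul_sum, ← Finset.sum_sub_distrib]
    refine Finset.sum_congr rfl fun e _ => ?_
    rw [Finset.mul_sum, Finset.mul_sum, ← Finset.sum_sub_distrib]
    refine Finset.sum_congr rfl fun e' _ => ?_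
    have h1 := resonatorCoeff_mul_mul_pow hp (k - 1) e e'
    have h2 : ((deg e e' : ℕ) : ℝ) = ∑ j, lam j (e j) (e' j) := by
      simp only [deg, fs, lam]
      rw [natDegree_blockMonomial hp, natDegree_blockMonomial hp]
      push_cast
      rw [← Finset.sum_add_distrib]
      refine Finset.sum_congr rfl fun i _ => ?_
      rw [← Finset.sum_add_distrib]
      exact Finset.sum_congr rfl fun s _ => by ring
    rw [h2]
    change c e * c e' * v ^ deg e e' = ∏ i, g i (e i) (e' i) at h1
    rw [← h1]
    ring
  set H := ∏ i, blockBound k (ℓ i) (p i) with hH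
  have hbpos : ∀ i, 0 < blockBound k (ℓ i) (p i) := fun i => Real.exp_pos _
  have hH0 : 0 < H := Finset.prod_pos fun i _ => hbpos i
  have hprod : |∏ i, ∑ a ∈ expSet (σ i) (ℓ i), ∑ b ∈ expSet (σ i) (ℓ i), g i a b| ≤ H := by
    rw [Finset.abs_prod]
    exact Finset.prod_le_prod (fun _ _ => abs_nonneg _) fun i _ => hh i
  have hbge : ∀ i, Real.exp (-1) ≤ blockBound k (ℓ i) (p i) := by
    intro i
    refine Real.exp_le_exp.2 ?_
    have h1 := hp.sum_le i
    have h2 : 0 ≤ ∑ s, invSqrtCard F ^ (2 * (p i s).natDegree) :=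
      Finset.sum_nonneg fun s _ => hx0 i s
    have h3 : 0 ≤ ∑ s, (invSqrtCard F ^ (2 * (p i s).natDegree)) ^ 2 :=
      Finset.sum_nonneg fun s _ => sq_nonneg _
    have h4 : 0 ≤ Real.exp (Real.exp (2 * Real.exp 1) + 1) * Real.exp (-(ℓ i : ℝ)) := by positivity
    nlinarith [mul_nonneg (sq_nonneg k) h2]
  have herase : ∀ j, ∏ i ∈ Finset.univ.erase j, blockBound k (ℓ i) (p i) ≤ Real.exp 1 * H := by
    intro j
    have h1 := Finset.mul_prod_erase Finset.univ (fun i => blockBound k (ℓ i) (p i))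
      (Finset.mem_univ j)
    have h0 : 0 ≤ ∏ i ∈ Finset.univ.erase j, blockBound k (ℓ i) (p i) :=
      Finset.prod_nonneg fun i _ => (hbpos i).le
    have h2 := mul_le_mul_of_nonneg_right (hbge j) h0
    rw [h1] at h2
    calc _ = Real.exp 1 * (Real.exp (-1) *
          ∏ i ∈ Finset.univ.erase j, blockBound k (ℓ i) (p i)) := by
          rw [← mul_assoc, ← Real.exp_add, add_neg_cancel, Real.exp_zero, one_mul]
      _ ≤ _ := by gcongr
  have hweighted := abs_sum_sum_prod_mul_sum_le (fun i => expSet (σ i) (ℓ i)) g lam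
    (fun i a b => Finset.sum_nonneg fun s _ => by positivity) hh hτ
  have hw2 : ∑ j, (D j * Real.exp (Real.exp (2 * Real.exp 1))) *
      ∏ i ∈ Finset.univ.erase j, blockBound k (ℓ i) (p i) ≤
      Real.exp (Real.exp (2 * Real.exp 1) + 1) * (∑ i, (D i : ℝ)) * H := by
    calc _ ≤ ∑ j, (D j * Real.exp (Real.exp (2 * Real.exp 1))) * (Real.exp 1 * H) := by
          gcongr with j
          exact herase j
      _ = _ := by
          rw [← Finset.sum_mul, ← Finset.sum_mul, Real.exp_add]
          ring
  have hMle : M ≤ (Φ * (N + Real.exp (Real.exp (2 * Real.exp 1) + 1) * ∑ i, (D i : ℝ)) +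
      9 * w ^ (2 * N)) * H := by
    rw [hMeq]
    have h1 := (abs_le.1 (hweighted.trans hw2)).1
    have h2 := abs_le.1 hprod
    set Z := ∏ i, ∑ a ∈ expSet (σ i) (ℓ i), ∑ b ∈ expSet (σ i) (ℓ i), g i a b
    set Y := ∑ e ∈ E, ∑ e' ∈ E, (∏ i, g i (e i) (e' i)) * ∑ j, lam j (e j) (e' j)
    have h3 : Φ * N * Z ≤ Φ * N * H := by gcongr; exact h2.2
    have h4 : -(κ * w ^ (2 * N) * Z) ≤ 9 * w ^ (2 * N) * H := by
      calc -(κ * w ^ (2 * N) * Z) = κ * w ^ (2 * N) * (-Z) := by ring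
        _ ≤ κ * w ^ (2 * N) * H := by gcongr; linarith
        _ ≤ _ := by gcongr
    have h5 : -(Φ * Y) ≤ Φ * (Real.exp (Real.exp (2 * Real.exp 1) + 1) * (∑ i, (D i : ℝ)) * H) := by
      rw [← mul_neg]
      gcongr
      linarith
    nlinarith
  have := (abs_le.1 herr).2
  linarith

/-- Mixed moments of two resonators with `a k + b (k - 1) = 2 k`: they are of the size of the mean
square of the resonator which imitates `L(1/2, χ) ^ k`. -/
theorem sum_resonator_rpow_mul_rpow_le (hQ : Irreducible Q) (hp : IsBlockSystem p D) {ℓ : ι → ℕ}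
    (hℓ1 : ∀ i, 1 ≤ ℓ i) {k a b : ℝ} (hk : 0 ≤ k) (ha : 0 ≤ a) (hb : 0 ≤ b)
    (hab : a * k + b * (k - 1) = 2 * k) {m : ℕ} (hm1 : 1 ≤ m) (hm : a + b ≤ 2 * m)
    (hℓ2 : ∀ i, Real.exp 1 * (Real.exp 1 * (64 * (k + 1))) ^ 2 * m ≤ ℓ i)
    (hℓ : m * ∑ i, ℓ i * D i < Q.natDegree) :
    ∑ χ : DirChar Q, ‖resonator p ℓ k χ‖ ^ a * ‖resonator p ℓ (k - 1) χ‖ ^ b ≤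
      numChars Q * ∏ i, Real.exp (k ^ 2 * ∑ s, invSqrtCard F ^ (2 * (p i s).natDegree) +
        (a + b + 5) * Real.exp (-(ℓ i : ℝ))) := by
  set c := Real.exp 1 * (64 * (k + 1)) with hc
  -- `β` are the coefficients of the truncated exponential, `γ` picks the dominating high power
  let β : ι → ℕ → ℝ := fun i r => if r ∈ Finset.range (ℓ i + 1) then k ^ r / r.factorial else 0
  let γ : ι → ℕ → ℝ := fun i r => if r = m * ℓ i then (c / ℓ i) ^ (m * ℓ i) else 0
  let A : ι → ℝ := fun i => Real.exp ((a + b + 4) * Real.exp (-(ℓ i : ℝ)))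
  have hR : ∑ i, m * ℓ i * D i < Q.natDegree := by
    simp_rw [mul_assoc]
    rwa [← Finset.mul_sum]
  have hsub : ∀ i, Finset.range (ℓ i + 1) ⊆ Finset.range (m * ℓ i + 1) := fun i =>
    Finset.range_mono (by have := Nat.le_mul_of_pos_left (ℓ i) hm1; omega)
  have hβ : ∀ (i : ι) (f : ℕ → ℝ) (hf : ∀ r, r ∉ Finset.range (ℓ i + 1) → f r = 0),
      ∑ r ∈ Finset.range (m * ℓ i + 1), f r = ∑ r ∈ Finset.range (ℓ i + 1), f r := by
    intro i f hf
    exact (Finset.sum_subset (hsub i) fun r _ hr => hf r hr).symm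
  have h := sum_prod_add_norm_sq_le (Q := Q) hQ hp.isPrimeFamily hp.natDegree_le hR β γ (A := A)
    fun i => (Real.exp_pos _).le
  refine le_trans (Finset.sum_le_sum fun χ _ => ?_) (h.trans ?_)
  · rw [resonator, resonator, norm_prod, norm_prod, ← Real.finsetProd_rpow _ _
      fun i _ => norm_nonneg _, ← Real.finsetProd_rpow _ _ fun i _ => norm_nonneg _,
      ← Finset.prod_mul_distrib]
    refine Finset.prod_le_prod (fun i _ => by positivity) fun i _ => ?_
    refine (norm_expTrunc_rpow_mul_le hk ha hb hab hm (hℓ1 i) _).trans (le_of_eq ?_)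
    congr 1
    · congr 3
      rw [expTrunc]
      rw [← Finset.sum_subset (hsub i)]
      · refine Finset.sum_congr rfl fun r hr => ?_
        simp only [β, if_pos hr]
        push_cast
        ring
      · intro r _ hr
        simp only [β, if_neg hr]
        simp
    · rw [Finset.sum_eq_single_of_mem (m * ℓ i) (Finset.mem_range.2 (by omega))]
      · simp only [γ, if_true]
        rw [norm_mul, Complex.norm_real, norm_pow, norm_pow, Real.norm_of_nonneg (by positivity),
          ← mul_pow, ← pow_mul, mul_comm (m * ℓ i) 2]
        congr 1
        ring
      · intro r _ hr
        simp only [γ, if_neg hr]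
        simp
  · refine mul_le_mul_of_nonneg_left ?_ (Nat.cast_nonneg _)
    have hV0 : ∀ i, 0 ≤ ∑ s, invSqrtCard F ^ (2 * (p i s).natDegree) := fun i =>
      Finset.sum_nonneg fun s _ => pow_nonneg (invSqrtCard_pos F).le _
    refine Finset.prod_le_prod (fun i _ => ?_) fun i _ => ?_
    · refine add_nonneg (mul_nonneg (Real.exp_pos _).le (Finset.sum_nonneg fun r _ => ?_))
        (Finset.sum_nonneg fun r _ => ?_)
      · have := hV0 i; positivity
      · have := hV0 i; positivity
    set V := ∑ s, invSqrtCard F ^ (2 * (p i s).natDegree) with hV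
    have hVi : 0 ≤ V := hV0 i
    have e1 : ∑ r ∈ Finset.range (m * ℓ i + 1), β i r ^ 2 * (r.factorial * V ^ r) ≤
        Real.exp (k ^ 2 * V) := by
      rw [hβ i _ fun r hr => by simp only [β, if_neg hr]; ring]
      refine le_trans (le_of_eq ?_) (sum_pow_div_factorial_le_exp (y := k ^ 2 * V) (by positivity)
        (ℓ i + 1))
      refine Finset.sum_congr rfl fun r hr => ?_
      simp only [β, if_pos hr]
      have : (r.factorial : ℝ) ≠ 0 := by positivity
      rw [mul_pow, ← pow_mul, mul_comm 2 r, pow_mul]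
      field_simp
    have e2 : ∑ r ∈ Finset.range (m * ℓ i + 1), γ i r ^ 2 * (r.factorial * V ^ r) ≤
        Real.exp (-(ℓ i : ℝ)) := by
      rw [Finset.sum_eq_single_of_mem (m * ℓ i) (Finset.mem_range.2 (by omega))
        fun r _ hr => by simp only [γ, if_neg hr]; ring]
      simp only [γ, if_true]
      exact rankin_pow_mul_factorial_le hVi (hp.sum_le i) hm1 (hℓ1 i) (hℓ2 i)
    set x := Real.exp (-(ℓ i : ℝ)) with hx
    have hx0 : 0 < x := Real.exp_pos _
    have hA1 : 1 ≤ A i := Real.one_le_exp (by positivity)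
    have he1 : 1 ≤ Real.exp (k ^ 2 * V) := Real.one_le_exp (by positivity)
    calc _ ≤ A i * Real.exp (k ^ 2 * V) + x := by gcongr
      _ ≤ A i * Real.exp (k ^ 2 * V) * (1 + x) := by
          have := one_le_mul_of_one_le_of_one_le hA1 he1
          nlinarith
      _ ≤ A i * Real.exp (k ^ 2 * V) * Real.exp x := by
          have := Real.add_one_le_exp x
          gcongr
          linarith
      _ = _ := by
          simp only [A]
          rw [← Real.exp_add, ← Real.exp_add]
          congr 1
          ring

end ResonatorMoments

/-! ### The resonator of the primes of degree less than `2 ^ J` -/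

section DyadicBlocks

theorem sum_length_mul_le (J Λ : ℕ) :
    ∑ i ∈ Finset.range J, (Λ + (J - i)) * 2 ^ (i + 1) ≤ (Λ + 2) * 2 ^ (J + 1) := by
  induction J generalizing Λ with
  | zero => simp
  | succ J ih =>
    rw [Finset.sum_range_succ]
    have h : ∀ i ∈ Finset.range J, (Λ + (J + 1 - i)) * 2 ^ (i + 1) =
        (Λ + 1 + (J - i)) * 2 ^ (i + 1) := by
      intro i hi
      have := Finset.mem_range.1 hi
      congr 1
      omega
    rw [Finset.sum_congr rfl h]
    refine (Nat.add_le_add_right (ih (Λ + 1)) _).trans (le_of_eq ?_)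
    rw [show J + 1 - J = 1 by omega, pow_succ 2 (J + 1)]
    ring

theorem sum_exp_neg_length_le (J Λ : ℕ) :
    ∑ i ∈ Finset.range J, Real.exp (-((Λ + (J - i) : ℕ) : ℝ)) ≤ Real.exp (-Λ) := by
  induction J generalizing Λ with
  | zero => simpa using (Real.exp_pos _).le
  | succ J ih =>
    rw [Finset.sum_range_succ]
    have h : ∀ i ∈ Finset.range J, Real.exp (-((Λ + (J + 1 - i) : ℕ) : ℝ)) =
        Real.exp (-((Λ + 1 + (J - i) : ℕ) : ℝ)) := by
      intro i hi
      have := Finset.mem_range.1 hi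
      rw [show Λ + (J + 1 - i) = Λ + 1 + (J - i) by omega]
    rw [Finset.sum_congr rfl h, show Λ + (J + 1 - J) = Λ + 1 by omega]
    have h1 := ih (Λ + 1)
    have h2 : Real.exp (-((Λ + 1 : ℕ) : ℝ)) = Real.exp (-Λ) * Real.exp (-1) := by
      rw [← Real.exp_add]
      congr 1
      push_cast
      ring
    have h3 : Real.exp (-1) ≤ 1 / 2 := by
      rw [Real.exp_neg, one_div]
      exact inv_anti₀ (by norm_num) (by linarith [Real.add_one_le_exp 1])
    have h4 := Real.exp_pos (-(Λ : ℝ))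
    nlinarith

/-- Error terms of size `|Q| ^ (7 / 8)` are negligible, uniformly in `w = q ^ (1/2)`. -/
theorem exists_forall_sq_add_mul_pow_le {δ : ℝ} (hδ : 0 < δ) :
    ∃ N₀ : ℕ, ∀ N : ℕ, N₀ ≤ N → ∀ w : ℝ, 4 / 3 ≤ w → ∀ E : ℕ, 4 * E ≤ 7 * N →
      ((N : ℝ) ^ 2 + 18) * w ^ E ≤ δ * w ^ (2 * N) := by
  have h := tendsto_pow_const_mul_const_pow_of_abs_lt_one 2 (r := (3 / 4 : ℝ))
    (by rw [abs_of_pos] <;> norm_num)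
  have h1 := (h.eventually (gt_mem_nhds (show (0 : ℝ) < δ / 67 by positivity))).and
    (Filter.eventually_ge_atTop 1)
  obtain ⟨n₀, hn₀⟩ := Filter.eventually_atTop.1 h1
  refine ⟨4 * n₀, fun N hN w hw E hE => ?_⟩
  obtain ⟨hn, hn1⟩ := hn₀ (N / 4) (by omega)
  set n := N / 4
  have hN4 : (N : ℝ) ≤ 4 * n + 3 := by exact_mod_cast (by omega : N ≤ 4 * n + 3)
  have hn1' : (1 : ℝ) ≤ n := by exact_mod_cast hn1
  have hw1 : 1 ≤ w := by linarith
  have h2 : (N : ℝ) ^ 2 + 18 ≤ 67 * n ^ 2 := by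
    have : (N : ℝ) ^ 2 ≤ (4 * n + 3) ^ 2 := by gcongr
    nlinarith
  have h3 : (n : ℝ) ^ 2 ≤ δ / 67 * (4 / 3) ^ n := by
    have h4 : (n : ℝ) ^ 2 = n ^ 2 * (3 / 4) ^ n * (4 / 3) ^ n := by
      rw [mul_assoc, ← mul_pow]
      norm_num
    rw [h4]
    gcongr
  have h5 : (4 / 3 : ℝ) ^ n ≤ w ^ (2 * N - E) :=
    (pow_le_pow_left₀ (by norm_num) hw n).trans (pow_le_pow_right₀ hw1 (by omega))
  calc _ ≤ δ * (4 / 3) ^ n * w ^ E := by gcongr; linarith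
    _ ≤ δ * w ^ (2 * N - E) * w ^ E := by gcongr
    _ = _ := by rw [mul_assoc, ← pow_add, Nat.sub_add_cancel (by omega)]

/-- The lengths of the truncations: longer for the blocks of small primes, so that
`∑ ℓ_i 2 ^ (i + 1)` stays `O(2 ^ J)` while the truncation errors `exp (-ℓ_i)` are summable. -/
def dyadicLength (Λ J : ℕ) (i : Fin J) : ℕ := Λ + (J - i)

theorem sum_dyadicLength_mul_le (Λ J : ℕ) :
    ∑ i, dyadicLength Λ J i * 2 ^ ((i : ℕ) + 1) ≤ (Λ + 2) * 2 ^ (J + 1) :=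
  (Fin.sum_univ_eq_sum_range (fun i => (Λ + (J - i)) * 2 ^ (i + 1)) J).trans_le
    (sum_length_mul_le J Λ)

theorem sum_exp_neg_dyadicLength_le (Λ J : ℕ) :
    ∑ i, Real.exp (-(dyadicLength Λ J i : ℝ)) ≤ Real.exp (-Λ) :=
  (Fin.sum_univ_eq_sum_range (fun i => Real.exp (-((Λ + (J - i) : ℕ) : ℝ))) J).trans_le
    (sum_exp_neg_length_le J Λ)

theorem sum_two_pow_succ_le (J : ℕ) : ∑ i : Fin J, (2 : ℝ) ^ ((i : ℕ) + 1) ≤ 2 * 2 ^ J := by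
  rw [Fin.sum_univ_eq_sum_range (fun i => (2 : ℝ) ^ (i + 1)) J]
  induction J with
  | zero => simp
  | succ J ih =>
    rw [Finset.sum_range_succ, pow_succ]
    linarith

theorem two_pow_rpow (J : ℕ) (y : ℝ) : ((2 : ℝ) ^ J) ^ y = Real.exp (Real.log (2 ^ J) * y) :=
  Real.rpow_def_of_pos (by positivity) y

theorem mul_sum_dyadicLength_le {Λ K n J N : ℕ} (hK : 48 * n * (Λ + 2) ≤ K) (hJ : K * 2 ^ J ≤ N) :
    24 * n * ∑ i, dyadicLength Λ J i * 2 ^ ((i : ℕ) + 1) ≤ N := by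
  calc _ ≤ 24 * n * ((Λ + 2) * 2 ^ (J + 1)) :=
        Nat.mul_le_mul_left _ (sum_dyadicLength_mul_le Λ J)
    _ = 48 * n * (Λ + 2) * 2 ^ J := by ring
    _ ≤ _ := (Nat.mul_le_mul_right _ hK).trans hJ

theorem mul_mul_le_of_mul_two_pow_le {Λ K n J N : ℕ} (hK : 48 * n * (Λ + 2) ≤ K)
    (hJ : K * 2 ^ J ≤ N) :
    96 * (n * J) ≤ N := by
  have h1 : J ≤ 2 ^ J := Nat.lt_two_pow_self.le
  calc 96 * (n * J) = 48 * n * 2 * J := by ring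
    _ ≤ 48 * n * (Λ + 2) * 2 ^ J := by gcongr; omega
    _ ≤ _ := (Nat.mul_le_mul_right _ hK).trans hJ

variable (F : Type u) [Field F] [Finite F]

/-- The primes of degree less than `2 ^ J`, in dyadic blocks. -/
def dyadicPrimes (J : ℕ) (i : Fin J) (P : primeBlock F i) : F[X] := P.1

theorem isBlockSystem_dyadicPrimes (J : ℕ) :
    IsBlockSystem (dyadicPrimes F J) fun i => 2 ^ ((i : ℕ) + 1) where
  isPrimeFamily :=
    { monic := fun s => (mem_primeBlock.1 s.2.2).1
      irreducible := fun s => (mem_primeBlock.1 s.2.2).2.1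
      injective := by
        rintro ⟨i, P, hP⟩ ⟨j, P', hP'⟩ h
        change P = P' at h
        subst h
        obtain ⟨-, -, h1, h2⟩ := mem_primeBlock.1 hP
        obtain ⟨-, -, h3, h4⟩ := mem_primeBlock.1 hP'
        have h5 := (Nat.pow_lt_pow_iff_right (by norm_num : 1 < 2)).1 (h1.trans_lt h4)
        have h6 := (Nat.pow_lt_pow_iff_right (by norm_num : 1 < 2)).1 (h3.trans_lt h2)
        obtain rfl : i = j := Fin.ext (by omega)
        rfl }
  natDegree_le := fun i P => (mem_primeBlock.1 P.2).2.2.2.le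
  sum_le := fun i => (Finset.sum_coe_sort (primeBlock F i)
    fun P => invSqrtCard F ^ (2 * P.natDegree)).trans_le (blockSum_le_one F i)

theorem sum_dyadicPrimes (J : ℕ) (i : Fin J) :
    ∑ P, invSqrtCard F ^ (2 * (dyadicPrimes F J i P).natDegree) = blockSum F i :=
  Finset.sum_coe_sort (primeBlock F i) fun P => invSqrtCard F ^ (2 * P.natDegree)

theorem sum_sq_dyadicPrimes (J : ℕ) (i : Fin J) :
    ∑ P, (invSqrtCard F ^ (2 * (dyadicPrimes F J i P).natDegree)) ^ 2 = blockSumSq F i :=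
  Finset.sum_coe_sort (primeBlock F i) fun P => (invSqrtCard F ^ (2 * P.natDegree)) ^ 2

/-- The factors exponential in the number of blocks are small powers of `|Q|`. -/
theorem exp_mul_le_pow (c : ℝ) (n J : ℕ) (hc : c ≤ n) :
    Real.exp (c * J) ≤ (invSqrtCard F)⁻¹ ^ (4 * (n * J)) := by
  have hw : 4 / 3 ≤ (invSqrtCard F)⁻¹ := by
    rw [le_inv_comm₀ (by norm_num) (invSqrtCard_pos F)]
    exact (invSqrtCard_le F).trans (by norm_num)
  have h1 : Real.exp 1 ≤ (invSqrtCard F)⁻¹ ^ 4 := by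
    have h2 : (4 / 3 : ℝ) ^ 4 ≤ (invSqrtCard F)⁻¹ ^ 4 := by gcongr
    have := Real.exp_one_lt_d9
    linarith [show (2.8 : ℝ) ≤ (4 / 3) ^ 4 by norm_num]
  calc Real.exp (c * J) ≤ Real.exp ((n * J : ℕ) * 1) := by
        rw [Real.exp_le_exp]
        push_cast
        rw [mul_one]
        gcongr
    _ = Real.exp 1 ^ (n * J) := Real.exp_nat_mul _ _
    _ ≤ ((invSqrtCard F)⁻¹ ^ 4) ^ (n * J) := by gcongr
    _ = _ := (pow_mul _ _ _).symm

variable {F} {Q : F[X]}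

/-- `resonator` for all primes of degree less than `2 ^ J`. -/
def dyadicResonator (Λ J : ℕ) (α : ℝ) (χ : DirChar Q) : ℂ :=
  resonator (dyadicPrimes F J) (dyadicLength Λ J) α χ

variable {k : ℝ} {Λ K n J : ℕ}

variable [Fintype (DirChar Q)]

open Classical in
/-- The twisted first moment has size at least `Φ (2 ^ J) ^ (k ^ 2)`, up to a constant. -/
theorem le_norm_sum_lPoly_dyadicResonator (hQ : Irreducible Q) (hk : 0 ≤ k) (hΛ1 : 1 ≤ Λ)
    (hΛ : Real.exp (Real.exp (k + 1 + k * Real.exp 1)) * Real.exp (-Λ) ≤ 1 / 2) (hn1 : 1 ≤ n)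
    (hn : 2 * k + 1 ≤ n) (hK : 48 * n * (Λ + 2) ≤ K) (hJ : K * 2 ^ J ≤ Q.natDegree) {δ : ℝ}
    (hδ : ∀ E : ℕ, 4 * E ≤ 7 * Q.natDegree → ((Q.natDegree : ℝ) ^ 2 + 18) *
      (invSqrtCard F)⁻¹ ^ E ≤ δ * (invSqrtCard F)⁻¹ ^ (2 * Q.natDegree)) :
    numChars Q * (Real.exp (-(4 * k ^ 2 + k ^ 4 + 1)) * (2 ^ J) ^ (k ^ 2)) -
      δ * (invSqrtCard F)⁻¹ ^ (2 * Q.natDegree) ≤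
    ‖∑ χ ∈ Finset.univ.erase (1 : DirChar Q), χ.lPoly * (dyadicResonator Λ J (k - 1) χ *
      (starRingEnd ℂ) (dyadicResonator Λ J k χ))‖ := by
  have hp := isBlockSystem_dyadicPrimes F J
  have hN : 0 < Q.natDegree := hQ.natDegree_pos
  have hw0 : 0 < (invSqrtCard F)⁻¹ := inv_pos.2 (invSqrtCard_pos F)
  have hΔ := mul_sum_dyadicLength_le hK hJ
  have hnJ := mul_mul_le_of_mul_two_pow_le hK hJ
  set Δ := ∑ i, dyadicLength Λ J i * 2 ^ ((i : ℕ) + 1) with hΔdef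
  have hnΔ : Δ ≤ n * Δ := Nat.le_mul_of_pos_left _ hn1
  rw [mul_assoc] at hΔ
  have hmain := norm_sum_lPoly_resonator_sub_le hQ hp (ℓ := dyadicLength Λ J) (by omega) hk
  have herr : 4 * Real.exp ((2 * k + 1) * Fintype.card (Fin J)) *
      (invSqrtCard F)⁻¹ ^ (Q.natDegree + 3 * Δ) ≤ δ * (invSqrtCard F)⁻¹ ^ (2 * Q.natDegree) := by
    rw [Fintype.card_fin]
    refine le_trans ?_ (hδ (4 * (n * J) + (Q.natDegree + 3 * Δ)) (by omega))
    rw [pow_add _ (4 * (n * J)), ← mul_assoc]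
    gcongr
    · nlinarith [sq_nonneg (Q.natDegree : ℝ)]
    · exact exp_mul_le_pow F _ _ _ hn
  have hprod : Real.exp (-(4 * k ^ 2 + k ^ 4 + 1)) * (2 ^ J) ^ (k ^ 2) ≤
      ∏ i, ∑ e ∈ expSet (primeBlock F (i : Fin J)) (dyadicLength Λ J i), ∏ s, firstWeight k
        (invSqrtCard F ^ (2 * (dyadicPrimes F J i s).natDegree)) (e s) := by
    have hx0 : ∀ (i : Fin J) s, 0 ≤ invSqrtCard F ^ (2 * (dyadicPrimes F J i s).natDegree) :=
      fun i s => pow_nonneg (invSqrtCard_pos F).le _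
    have hx1 : ∀ (i : Fin J) s, invSqrtCard F ^ (2 * (dyadicPrimes F J i s).natDegree) ≤ 1 :=
      fun i s => pow_le_one₀ (invSqrtCard_pos F).le ((invSqrtCard_le F).trans (by norm_num))
    set A := Real.exp (Real.exp (k + 1 + k * Real.exp 1)) with hA
    have hfac : ∀ i : Fin J, Real.exp (k ^ 2 * blockSum F i - k ^ 4 * blockSumSq F i -
        2 * A * Real.exp (-(dyadicLength Λ J i : ℝ))) ≤
        ∑ e ∈ expSet (primeBlock F (i : Fin J)) (dyadicLength Λ J i), ∏ s, firstWeight k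
          (invSqrtCard F ^ (2 * (dyadicPrimes F J i s).natDegree)) (e s) := by
      intro i
      have hle : Λ ≤ dyadicLength Λ J i := Nat.le_add_right _ _
      have h := le_sum_prod_firstWeight hk (hx0 i) (hx1 i) (hp.sum_le i)
        (ℓ := dyadicLength Λ J i) (hΛ1.trans hle) (le_trans (by gcongr) hΛ)
      rwa [sum_dyadicPrimes, sum_sq_dyadicPrimes] at h
    refine le_trans ?_ (Finset.prod_le_prod (fun i _ => (Real.exp_pos _).le) fun i _ => hfac i)
    rw [← Real.exp_sum, two_pow_rpow, ← Real.exp_add, Real.exp_le_exp, Finset.sum_sub_distrib,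
      Finset.sum_sub_distrib, ← Finset.mul_sum, ← Finset.mul_sum, ← Finset.mul_sum,
      Fin.sum_univ_eq_sum_range (fun i => blockSum F i),
      Fin.sum_univ_eq_sum_range (fun i => blockSumSq F i)]
    have h1 := mul_le_mul_of_nonneg_left (le_sum_blockSum F J) (sq_nonneg k)
    have h2 := mul_le_mul_of_nonneg_left (sum_blockSumSq_le F J) (show 0 ≤ k ^ 4 by positivity)
    have h3 : 2 * A * ∑ i, Real.exp (-(dyadicLength Λ J i : ℝ)) ≤ 1 := by
      have := mul_le_mul_of_nonneg_left (sum_exp_neg_dyadicLength_le Λ J)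
        (show 0 ≤ 2 * A by positivity)
      linarith
    linarith
  have hnorm := norm_sub_norm_le (((numChars Q * ∏ i, ∑ e ∈ expSet (primeBlock F (i : Fin J))
    (dyadicLength Λ J i), ∏ s, firstWeight k
      (invSqrtCard F ^ (2 * (dyadicPrimes F J i s).natDegree)) (e s) : ℝ) : ℂ))
    (∑ χ ∈ Finset.univ.erase (1 : DirChar Q), χ.lPoly * (dyadicResonator Λ J (k - 1) χ *
      (starRingEnd ℂ) (dyadicResonator Λ J k χ)))
  rw [norm_sub_rev, Complex.norm_real] at hnorm
  have h1 := mul_le_mul_of_nonneg_left hprod (Nat.cast_nonneg (α := ℝ) (numChars Q))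
  have h2 := hnorm.trans (hmain.trans herr)
  have h3 := Real.le_norm_self (numChars Q * ∏ i, ∑ e ∈ expSet (primeBlock F (i : Fin J))
    (dyadicLength Λ J i), ∏ s, firstWeight k
      (invSqrtCard F ^ (2 * (dyadicPrimes F J i s).natDegree)) (e s) : ℝ)
  linarith

open Classical in
/-- The twisted second moment has size at most `Φ deg Q (2 ^ J) ^ (k ^ 2 - 1)`, up to a constant. -/
theorem sum_lPoly_sq_dyadicResonator_sq_le (hQ : Irreducible Q) (hk : 0 ≤ k) (hk1 : k ≤ 1)
    (hΛ1 : 1 ≤ Λ) (hn2 : 2 ≤ n) (hK : 48 * n * (Λ + 2) ≤ K) (hJ : K * 2 ^ J ≤ Q.natDegree) {δ : ℝ}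
    (hδ : ∀ E : ℕ, 4 * E ≤ 7 * Q.natDegree → ((Q.natDegree : ℝ) ^ 2 + 18) *
      (invSqrtCard F)⁻¹ ^ E ≤ δ * (invSqrtCard F)⁻¹ ^ (2 * Q.natDegree)) :
    ∑ χ ∈ Finset.univ.erase (1 : DirChar Q),
        ‖χ.lPoly‖ ^ 2 * ‖dyadicResonator Λ J (k - 1) χ‖ ^ 2 ≤
      (numChars Q * (Q.natDegree + Real.exp (Real.exp (2 * Real.exp 1) + 1) * (2 * 2 ^ J)) +
        9 * (invSqrtCard F)⁻¹ ^ (2 * Q.natDegree)) *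
        (Real.exp (13 + Real.exp (Real.exp (2 * Real.exp 1) + 1)) * (2 ^ J) ^ (k ^ 2 - 1)) +
      δ * (invSqrtCard F)⁻¹ ^ (2 * Q.natDegree) := by
  have hp := isBlockSystem_dyadicPrimes F J
  have hN : 0 < Q.natDegree := hQ.natDegree_pos
  have hw0 : 0 < (invSqrtCard F)⁻¹ := inv_pos.2 (invSqrtCard_pos F)
  have hΔ := mul_sum_dyadicLength_le hK hJ
  have hnJ := mul_mul_le_of_mul_two_pow_le hK hJ
  set Δ := ∑ i, dyadicLength Λ J i * 2 ^ ((i : ℕ) + 1) with hΔdef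
  have hnΔ : Δ ≤ n * Δ := Nat.le_mul_of_pos_left _ (by omega)
  rw [mul_assoc] at hΔ
  have hmain := sum_lPoly_sq_resonator_sq_le hQ hp (ℓ := dyadicLength Λ J)
    (fun i => hΛ1.trans (Nat.le_add_right _ _)) (by omega) hk hk1
  have herr : Real.exp (2 * Fintype.card (Fin J)) * ((Q.natDegree : ℝ) ^ 2 + 18) *
      (invSqrtCard F)⁻¹ ^ (Q.natDegree + 6 * Δ) ≤ δ * (invSqrtCard F)⁻¹ ^ (2 * Q.natDegree) := by
    rw [Fintype.card_fin]
    refine le_trans ?_ (hδ (4 * (n * J) + (Q.natDegree + 6 * Δ)) (by omega))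
    rw [pow_add _ (4 * (n * J)), ← mul_assoc, mul_comm (Real.exp _)]
    gcongr
    exact exp_mul_le_pow F _ _ _ (by exact_mod_cast hn2)
  set A := Real.exp (Real.exp (2 * Real.exp 1) + 1) with hA
  have hA0 : 0 < A := Real.exp_pos _
  have hprod : ∏ i, blockBound k (dyadicLength Λ J i) (dyadicPrimes F J i) ≤
      Real.exp (13 + A) * (2 ^ J) ^ (k ^ 2 - 1) := by
    simp_rw [blockBound, sum_dyadicPrimes, sum_sq_dyadicPrimes]
    rw [← Real.exp_sum, two_pow_rpow, ← Real.exp_add, Real.exp_le_exp, Finset.sum_add_distrib,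
      Finset.sum_add_distrib, ← Finset.mul_sum, ← Finset.mul_sum, ← Finset.mul_sum,
      Fin.sum_univ_eq_sum_range (fun i => blockSum F i),
      Fin.sum_univ_eq_sum_range (fun i => blockSumSq F i)]
    have hk2 : k ^ 2 ≤ 1 := pow_le_one₀ hk hk1
    have h1 := mul_le_mul_of_nonneg_left (le_sum_blockSum F J) (show 0 ≤ 1 - k ^ 2 by linarith)
    have h2 := sum_blockSumSq_le F J
    have h3 : A * ∑ i, Real.exp (-(dyadicLength Λ J i : ℝ)) ≤ A * 1 := by
      gcongr
      exact (sum_exp_neg_dyadicLength_le Λ J).trans (Real.exp_le_one_iff.2 (by simp))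
    nlinarith [sq_nonneg k]
  refine hmain.trans (add_le_add (mul_le_mul ?_ hprod ?_ ?_) herr)
  · gcongr
    push_cast
    exact sum_two_pow_succ_le J
  · exact Finset.prod_nonneg fun i _ => (Real.exp_pos _).le
  · positivity

/-- The mixed moments have size at most `Φ (2 ^ J) ^ (k ^ 2)`, up to a constant. -/
theorem sum_dyadicResonator_rpow_mul_rpow_le (hQ : Irreducible Q) (hk : 0 ≤ k) {a b : ℝ}
    (ha : 0 ≤ a) (hb : 0 ≤ b) (hab : a * k + b * (k - 1) = 2 * k) {m : ℕ} (hm1 : 1 ≤ m)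
    (hm : a + b ≤ 2 * m) (hΛ1 : 1 ≤ Λ)
    (hΛ : Real.exp 1 * (Real.exp 1 * (64 * (k + 1))) ^ 2 * m ≤ Λ) (hmn : m ≤ n)
    (hK : 48 * n * (Λ + 2) ≤ K) (hJ : K * 2 ^ J ≤ Q.natDegree) :
    ∑ χ : DirChar Q, ‖dyadicResonator Λ J k χ‖ ^ a * ‖dyadicResonator Λ J (k - 1) χ‖ ^ b ≤
      numChars Q * (Real.exp (k ^ 2 + 2 * m + 5) * (2 ^ J) ^ (k ^ 2)) := by
  have hp := isBlockSystem_dyadicPrimes F J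
  have hN : 0 < Q.natDegree := hQ.natDegree_pos
  have hΔ := mul_sum_dyadicLength_le hK hJ
  set Δ := ∑ i, dyadicLength Λ J i * 2 ^ ((i : ℕ) + 1) with hΔdef
  have hnΔ : m * Δ ≤ n * Δ := Nat.mul_le_mul_right _ hmn
  rw [mul_assoc] at hΔ
  refine (sum_resonator_rpow_mul_rpow_le hQ hp (ℓ := dyadicLength Λ J)
    (fun i => hΛ1.trans (Nat.le_add_right _ _)) hk ha hb hab hm1 hm
    (fun i => hΛ.trans (by exact_mod_cast Nat.le_add_right _ _))
    (show m * Δ < Q.natDegree by omega)).trans ?_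
  refine mul_le_mul_of_nonneg_left ?_ (Nat.cast_nonneg _)
  simp_rw [sum_dyadicPrimes]
  rw [← Real.exp_sum, two_pow_rpow, ← Real.exp_add, Real.exp_le_exp, Finset.sum_add_distrib,
    ← Finset.mul_sum, ← Finset.mul_sum, Fin.sum_univ_eq_sum_range (fun i => blockSum F i)]
  have h1 := mul_le_mul_of_nonneg_left (sum_blockSum_le F J) (sq_nonneg k)
  have h2 : (a + b + 5) * ∑ i, Real.exp (-(dyadicLength Λ J i : ℝ)) ≤ (2 * m + 5) * 1 := by
    gcongr
    exact (sum_exp_neg_dyadicLength_le Λ J).trans (Real.exp_le_one_iff.2 (by simp))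
  linarith

end DyadicBlocks

/-! ### Comparison of the moments -/

section LowerBound

/-- Young's inequality with exponent `2 * k`, with a parameter. -/
theorem mul_le_rpow_div_add {k : ℝ} (hk : 1 ≤ k) {x y t : ℝ} (hx : 0 ≤ x) (hy : 0 ≤ y)
    (ht : 0 < t) (ht1 : t ≤ 1) :
    x * y ≤ x ^ (2 * k) / t ^ (2 * k) + t * y ^ (2 * k / (2 * k - 1)) := by
  have hp : 1 < 2 * k := by linarith
  have hq : 1 ≤ 2 * k / (2 * k - 1) := by
    rw [one_le_div (by linarith)]
    linarith
  have h := Real.young_inequality_of_nonneg (a := x / t) (b := t * y) (by positivity)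
    (by positivity) (Real.HolderConjugate.conjExponent hp)
  rw [Real.conjExponent] at h
  calc x * y = x / t * (t * y) := by field_simp
    _ ≤ _ := h
    _ ≤ (x / t) ^ (2 * k) + (t * y) ^ (2 * k / (2 * k - 1)) :=
        add_le_add (div_le_self (by positivity) hp.le) (div_le_self (by positivity) hq)
    _ ≤ _ := by
        rw [Real.div_rpow hx ht.le, Real.mul_rpow ht.le hy]
        gcongr
        exact (Real.rpow_le_rpow_of_exponent_ge ht ht1 hq).trans_eq (Real.rpow_one t)

/-- The weighted inequality of the means with weights `1 / 2`, `(1 - k) / 2` and `k / 2`. -/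
theorem mul_mul_le_rpow_div_add {k : ℝ} (hk : 0 < k) (hk1 : k ≤ 1) {x y z t : ℝ} (hx : 0 ≤ x)
    (hy : 0 ≤ y) (hz : 0 ≤ z) (ht : 0 < t) :
    x * (y * z) ≤ x ^ (2 * k) / t + t * (x ^ 2 * y ^ 2 + z ^ (2 / k) * y ^ 2) := by
  have h := Real.geom_mean_le_arith_mean3_weighted (w₁ := 1 / 2) (w₂ := (1 - k) / 2) (w₃ := k / 2)
    (p₁ := x ^ (2 * k) * t⁻¹) (p₂ := t * (x ^ 2 * y ^ 2)) (p₃ := t * (z ^ (2 / k) * y ^ 2))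
    (by norm_num) (by linarith) (by positivity) (by positivity) (by positivity) (by positivity)
    (by ring)
  have e1 : (x ^ (2 * k) * t⁻¹) ^ (1 / 2 : ℝ) = x ^ k * t ^ (-(1 / 2) : ℝ) := by
    rw [Real.mul_rpow (by positivity) (by positivity), ← Real.rpow_mul hx,
      Real.inv_rpow ht.le, Real.rpow_neg ht.le]
    congr 2
    ring
  have e2 : (t * (x ^ 2 * y ^ 2)) ^ ((1 - k) / 2) =
      t ^ ((1 - k) / 2) * (x ^ (1 - k) * y ^ (1 - k)) := by
    rw [Real.mul_rpow ht.le (by positivity), Real.mul_rpow (by positivity) (by positivity),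
      ← Real.rpow_natCast_mul hx, ← Real.rpow_natCast_mul hy]
    congr 3 <;> · push_cast; ring
  have e3 : (t * (z ^ (2 / k) * y ^ 2)) ^ (k / 2) = t ^ (k / 2) * (z * y ^ k) := by
    rw [Real.mul_rpow ht.le (by positivity), Real.mul_rpow (by positivity) (by positivity),
      ← Real.rpow_mul hz, ← Real.rpow_natCast_mul hy]
    congr 2
    · rw [show 2 / k * (k / 2) = 1 by field_simp, Real.rpow_one]
    · congr 1
      push_cast
      ring
  have hxx : x ^ k * x ^ (1 - k) = x := by
    rw [← Real.rpow_add_of_nonneg hx hk.le (by linarith), add_sub_cancel, Real.rpow_one]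
  have hyy : y ^ (1 - k) * y ^ k = y := by
    rw [← Real.rpow_add_of_nonneg hy (by linarith) hk.le, sub_add_cancel, Real.rpow_one]
  have htt : t ^ (-(1 / 2) : ℝ) * t ^ ((1 - k) / 2) * t ^ (k / 2) = 1 := by
    rw [← Real.rpow_add ht, ← Real.rpow_add ht]
    ring_nf
    exact Real.rpow_zero t
  have hprod : (x ^ (2 * k) * t⁻¹) ^ (1 / 2 : ℝ) * (t * (x ^ 2 * y ^ 2)) ^ ((1 - k) / 2) *
      (t * (z ^ (2 / k) * y ^ 2)) ^ (k / 2) = x * (y * z) := by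
    rw [e1, e2, e3]
    calc _ = (x ^ k * x ^ (1 - k)) * ((y ^ (1 - k) * y ^ k) * z) *
          (t ^ (-(1 / 2) : ℝ) * t ^ ((1 - k) / 2) * t ^ (k / 2)) := by ring
      _ = _ := by rw [hxx, hyy, htt, mul_one]
  rw [hprod] at h
  have h1 : 0 ≤ x ^ (2 * k) * t⁻¹ := by positivity
  have h2 : 0 ≤ t * (x ^ 2 * y ^ 2) := by positivity
  have h3 : 0 ≤ t * (z ^ (2 / k) * y ^ 2) := by positivity
  rw [div_eq_mul_inv, mul_add]
  nlinarith [mul_nonneg hk.le h2, mul_nonneg (sub_nonneg.2 hk1) h3]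

/-- Choosing the parameter `t` so that the second term absorbs at most half of the left side. -/
theorem mul_le_of_forall_le_div_add {c C s X M : ℝ} (hc : 0 < c) (hC : 0 < C) (hX : 0 ≤ X)
    (h : ∀ t : ℝ, 0 < t → t ≤ 1 → c * X ≤ M / t ^ s + t * (C * X)) :
    min 1 (c / (2 * C)) ^ s * (c / 2) * X ≤ M := by
  set t := min 1 (c / (2 * C)) with ht
  have ht0 : 0 < t := lt_min one_pos (by positivity)
  have h1 := h t ht0 (min_le_left _ _)
  have h2 : t * C ≤ c / 2 := by
    calc t * C ≤ c / (2 * C) * C := by gcongr; exact min_le_right _ _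
      _ = c / 2 := by field_simp
  have h3 : t * (C * X) ≤ c / 2 * X := by
    rw [← mul_assoc]
    gcongr
  have hts : 0 < t ^ s := Real.rpow_pos_of_pos ht0 s
  have h4 : c / 2 * X ≤ M / t ^ s := by linarith
  rw [le_div_iff₀ hts] at h4
  linarith

open Classical in
/-- The three moments which enter Hölder's inequality, each of its right order of magnitude. Here
`R` imitates `L(1/2, χ) ^ k` and `S` imitates `L(1/2, χ) ^ (k - 1)`. -/
theorem exists_moment_bounds {k : ℝ} (hk : 0 ≤ k) {m : ℕ} (hm1 : 1 ≤ m) :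
    ∃ c : ℝ, 0 < c ∧ ∃ C : ℝ, 0 < C ∧ ∃ N₀ : ℕ, ∀ (F : Type u) [Field F] [Finite F] (Q : F[X])
      [Fintype (DirChar Q)], Irreducible Q → N₀ ≤ Q.natDegree → ∃ R S : DirChar Q → ℂ,
      c * (numChars Q * (Q.natDegree : ℝ) ^ (k ^ 2)) ≤
        ‖∑ χ ∈ Finset.univ.erase (1 : DirChar Q), χ.lPoly * (S χ * (starRingEnd ℂ) (R χ))‖ ∧
      (k ≤ 1 → ∑ χ ∈ Finset.univ.erase (1 : DirChar Q), ‖χ.lPoly‖ ^ 2 * ‖S χ‖ ^ 2 ≤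
        C * (numChars Q * (Q.natDegree : ℝ) ^ (k ^ 2))) ∧
      ∀ a b : ℝ, 0 ≤ a → 0 ≤ b → a * k + b * (k - 1) = 2 * k → a + b ≤ 2 * m →
        ∑ χ : DirChar Q, ‖R χ‖ ^ a * ‖S χ‖ ^ b ≤
          C * (numChars Q * (Q.natDegree : ℝ) ^ (k ^ 2)) := by
  set A := Real.exp (Real.exp (k + 1 + k * Real.exp 1)) with hA
  set B := Real.exp 1 * (Real.exp 1 * (64 * (k + 1))) ^ 2 * m with hB
  set A' := Real.exp (Real.exp (2 * Real.exp 1) + 1) with hA'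
  have hA0 : 0 < A := Real.exp_pos _
  have hA'0 : 0 < A' := Real.exp_pos _
  have hB0 : 0 ≤ B := by positivity
  obtain ⟨Λ, hΛ⟩ := exists_nat_ge (2 * A + B + 1)
  have hΛ1 : 1 ≤ Λ := by exact_mod_cast (show (1 : ℝ) ≤ Λ by linarith)
  have hΛA : A * Real.exp (-Λ) ≤ 1 / 2 := by
    rw [Real.exp_neg, ← div_eq_mul_inv, div_le_iff₀ (Real.exp_pos _)]
    linarith [Real.add_one_le_exp (Λ : ℝ)]
  obtain ⟨n₁, hn₁⟩ := exists_nat_ge (2 * k + 1)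
  set n := n₁ + m + 2 with hn
  have hkn : 2 * k + 1 ≤ n := hn₁.trans (by exact_mod_cast (by omega : n₁ ≤ n))
  -- with `K 2 ^ J ≤ deg Q` the resonators have degree at most `deg Q / (24 n)`
  set K := 48 * n * (Λ + 2) with hK
  have hK1 : 1 ≤ K := by rw [hK]; exact Nat.mul_pos (by omega) (by omega)
  have hKr : (1 : ℝ) ≤ K := by exact_mod_cast hK1
  set c := Real.exp (-(4 * k ^ 2 + k ^ 4 + 1)) / (2 * K : ℝ) ^ (k ^ 2) with hc
  have hc0 : 0 < c := by positivity
  obtain ⟨N₁, hN₁⟩ := exists_forall_sq_add_mul_pow_le (δ := c / 4) (by positivity)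
  set C := (1 + 2 * A' + 18) * (Real.exp (13 + A') * (2 * K)) + c + Real.exp (k ^ 2 + 2 * m + 5)
    with hC
  refine ⟨c / 2, by positivity, C, by positivity, max K N₁, ?_⟩
  intro F _ _ Q _ hQ hN
  set N := Q.natDegree with hNdef
  have hNK : K ≤ N := (le_max_left _ _).trans hN
  have hN1 : (1 : ℝ) ≤ N := by exact_mod_cast hK1.trans hNK
  have hw : 4 / 3 ≤ (invSqrtCard F)⁻¹ := by
    rw [le_inv_comm₀ (by norm_num) (invSqrtCard_pos F)]
    exact (invSqrtCard_le F).trans (by norm_num)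
  set w := (invSqrtCard F)⁻¹ with hwdef
  have hδ : ∀ E : ℕ, 4 * E ≤ 7 * N → ((N : ℝ) ^ 2 + 18) * w ^ E ≤ c / 4 * w ^ (2 * N) :=
    hN₁ N ((le_max_right _ _).trans hN) w hw
  set Φ : ℝ := (numChars Q : ℝ) with hΦ
  have hΦ0 : 0 ≤ Φ := Nat.cast_nonneg _
  have hwΦ : w ^ (2 * N) ≤ 2 * Φ := by
    have h1 : Φ = w ^ (2 * N) - 1 := numChars_eq hQ
    have h2 : (2 : ℝ) ≤ w ^ 2 := by
      rw [hwdef, inv_pow, le_inv_comm₀ (by norm_num) (pow_pos (invSqrtCard_pos F) 2)]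
      exact (invSqrtCard_sq_le F).trans (by norm_num)
    have h3 : w ^ 2 ≤ w ^ (2 * N) := pow_le_pow_right₀ (by linarith) (by omega)
    linarith
  -- `2 ^ J` is `N / K` up to a factor of `2`
  set J := Nat.log 2 (N / K) with hJ
  have hNK0 : N / K ≠ 0 := (Nat.div_pos hNK hK1).ne'
  have hJ1 : K * 2 ^ J ≤ N := by
    rw [mul_comm]
    exact (Nat.le_div_iff_mul_le hK1).1 (Nat.pow_log_le_self 2 hNK0)
  have hJ2 : N ≤ 2 * K * 2 ^ J := by
    have h := (Nat.div_lt_iff_lt_mul hK1).1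
      (Nat.lt_pow_succ_log_self (b := 2) (by norm_num) (N / K))
    rw [Nat.succ_eq_add_one, pow_succ] at h
    nlinarith
  set T : ℝ := 2 ^ J with hT
  have hT0 : 0 < T := by positivity
  have hTN : T ≤ N := by
    have : (K : ℝ) * T ≤ N := by rw [hT]; exact_mod_cast hJ1
    nlinarith
  have hNT : (N : ℝ) ≤ 2 * K * T := by rw [hT]; exact_mod_cast hJ2
  have hk2 : 0 ≤ k ^ 2 := sq_nonneg k
  set Y := (N : ℝ) ^ (k ^ 2) with hY
  have hY1 : 1 ≤ Y := Real.one_le_rpow hN1 hk2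
  have hTY : T ^ (k ^ 2) ≤ Y := Real.rpow_le_rpow hT0.le hTN hk2
  have hYT : Y ≤ (2 * K : ℝ) ^ (k ^ 2) * T ^ (k ^ 2) := by
    rw [← Real.mul_rpow (by positivity) hT0.le]
    exact Real.rpow_le_rpow (by positivity) hNT hk2
  have hΦY : Φ ≤ Φ * Y := le_mul_of_one_le_right hΦ0 hY1
  have hK' : 48 * n * (Λ + 2) ≤ K := le_rfl
  refine ⟨dyadicResonator Λ J k, dyadicResonator Λ J (k - 1), ?_, fun hk1 => ?_,
    fun a b ha hb hab habm => ?_⟩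
  · refine le_trans ?_ (le_norm_sum_lPoly_dyadicResonator hQ hk hΛ1 hΛA (by omega) hkn hK' hJ1 hδ)
    have h1 : c * Y ≤ Real.exp (-(4 * k ^ 2 + k ^ 4 + 1)) * T ^ (k ^ 2) := by
      rw [hc, div_mul_eq_mul_div, div_le_iff₀ (by positivity), mul_assoc, mul_comm (T ^ (k ^ 2))]
      gcongr
    have h2 := mul_le_mul_of_nonneg_left h1 hΦ0
    have h3 : c / 4 * w ^ (2 * N) ≤ c / 4 * (2 * (Φ * Y)) := by gcongr; linarith
    linarith
  · refine (sum_lPoly_sq_dyadicResonator_sq_le hQ hk hk1 hΛ1 (by omega) hK' hJ1 hδ).trans ?_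
    have h1 : N * T ^ (k ^ 2 - 1) ≤ 2 * K * Y := by
      rw [Real.rpow_sub_one hT0.ne', mul_div_assoc', div_le_iff₀ hT0]
      calc (N : ℝ) * T ^ (k ^ 2) ≤ 2 * K * T * Y := by gcongr
        _ = _ := by ring
    have h2 : Φ * (N + A' * (2 * T)) + 9 * w ^ (2 * N) ≤ (1 + 2 * A' + 18) * (Φ * N) := by
      have e1 : Φ * (A' * (2 * T)) ≤ Φ * (A' * (2 * N)) := by gcongr
      have e2 : Φ ≤ Φ * N := le_mul_of_one_le_right hΦ0 hN1
      linarith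
    have h3 : (Φ * (N + A' * (2 * T)) + 9 * w ^ (2 * N)) *
        (Real.exp (13 + A') * T ^ (k ^ 2 - 1)) ≤
        (1 + 2 * A' + 18) * (Real.exp (13 + A') * (2 * K)) * (Φ * Y) := by
      calc _ ≤ (1 + 2 * A' + 18) * (Φ * N) * (Real.exp (13 + A') * T ^ (k ^ 2 - 1)) := by gcongr
        _ = (1 + 2 * A' + 18) * Real.exp (13 + A') * Φ * (N * T ^ (k ^ 2 - 1)) := by ring
        _ ≤ (1 + 2 * A' + 18) * Real.exp (13 + A') * Φ * (2 * K * Y) := by gcongr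
        _ = _ := by ring
    have h4 : c / 4 * w ^ (2 * N) ≤ c / 4 * (2 * (Φ * Y)) := by gcongr; linarith
    have h5 : 0 ≤ Real.exp (k ^ 2 + 2 * m + 5) * (Φ * Y) := by positivity
    have h6 : 0 ≤ c * (Φ * Y) := by positivity
    rw [hC, add_mul, add_mul]
    linarith
  · refine (sum_dyadicResonator_rpow_mul_rpow_le hQ hk ha hb hab hm1 habm hΛ1
      (by linarith) (by omega) hK' hJ1).trans ?_
    calc _ ≤ Φ * (Real.exp (k ^ 2 + 2 * m + 5) * Y) := by gcongr
      _ = Real.exp (k ^ 2 + 2 * m + 5) * (Φ * Y) := by ring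
      _ ≤ _ := by
        gcongr
        rw [hC]
        exact le_add_of_nonneg_left (by positivity)

open Classical in
/-- The lower bound for the moment, over the non-principal characters, for `k > 0`. -/
theorem exists_mul_le_sum_lPoly_rpow {k : ℝ} (hk : 0 < k) :
    ∃ c : ℝ, 0 < c ∧ ∃ N₀ : ℕ, ∀ (F : Type u) [Field F] [Finite F] (Q : F[X])
      [Fintype (DirChar Q)], Irreducible Q → N₀ ≤ Q.natDegree →
      c * (numChars Q * (Q.natDegree : ℝ) ^ (k ^ 2)) ≤
        ∑ χ ∈ Finset.univ.erase (1 : DirChar Q), ‖χ.lPoly‖ ^ (2 * k) := by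
  -- the exponents used below satisfy `a + b ≤ 2 / k + 2` or `a + b ≤ 4`
  obtain ⟨m, hm⟩ := exists_nat_ge (1 / k + 2)
  have hk' : 0 < 1 / k := by positivity
  have hm1 : 1 ≤ m := by exact_mod_cast (show (1 : ℝ) ≤ m by linarith)
  obtain ⟨c, hc, C, hC, N₀, h⟩ := exists_moment_bounds.{u} hk.le hm1
  have hnorm : ∀ {F : Type u} [Field F] [Finite F] (Q : F[X]) [Fintype (DirChar Q)]
      (R S : DirChar Q → ℂ), ‖∑ χ ∈ Finset.univ.erase (1 : DirChar Q), χ.lPoly * (S χ *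
        (starRingEnd ℂ) (R χ))‖ ≤ ∑ χ ∈ Finset.univ.erase (1 : DirChar Q),
          ‖χ.lPoly‖ * (‖S χ‖ * ‖R χ‖) := by
    intro F _ _ Q _ R S
    refine (norm_sum_le _ _).trans_eq (Finset.sum_congr rfl fun χ _ => ?_)
    rw [norm_mul, norm_mul, RCLike.norm_conj]
  rcases le_total k 1 with hk1 | hk1
  · refine ⟨min 1 (c / (2 * (C + C))) ^ (1 : ℝ) * (c / 2), by positivity, N₀, ?_⟩
    intro F _ _ Q _ hQ hN
    obtain ⟨R, S, h1, h2, h3⟩ := h F Q hQ hN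
    have h3' := h3 (2 / k) 2 (by positivity) (by norm_num) (by field_simp; ring)
      (by rw [← mul_one_div]; linarith)
    refine mul_le_of_forall_le_div_add hc (by positivity) (by positivity) fun t ht ht1 => ?_
    rw [Real.rpow_one]
    refine h1.trans ((hnorm Q R S).trans ?_)
    calc _ ≤ ∑ χ ∈ Finset.univ.erase (1 : DirChar Q), (‖χ.lPoly‖ ^ (2 * k) / t +
          t * (‖χ.lPoly‖ ^ 2 * ‖S χ‖ ^ 2 + ‖R χ‖ ^ (2 / k) * ‖S χ‖ ^ 2)) :=
          Finset.sum_le_sum fun χ _ => mul_mul_le_rpow_div_add hk hk1 (norm_nonneg _)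
            (norm_nonneg _) (norm_nonneg _) ht
      _ = (∑ χ ∈ Finset.univ.erase (1 : DirChar Q), ‖χ.lPoly‖ ^ (2 * k)) / t +
          t * (∑ χ ∈ Finset.univ.erase (1 : DirChar Q), ‖χ.lPoly‖ ^ 2 * ‖S χ‖ ^ 2 +
            ∑ χ ∈ Finset.univ.erase (1 : DirChar Q), ‖R χ‖ ^ (2 / k) * ‖S χ‖ ^ 2) := by
          rw [Finset.sum_add_distrib, Finset.sum_div, ← Finset.mul_sum, Finset.sum_add_distrib]
      _ ≤ _ := by
          rw [add_mul C C]
          gcongr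
          · exact h2 hk1
          · refine le_trans (Finset.sum_le_sum_of_subset_of_nonneg (Finset.erase_subset _ _)
              fun χ _ _ => by positivity) (le_trans (le_of_eq ?_) h3')
            simp only [Real.rpow_two]
  · refine ⟨min 1 (c / (2 * C)) ^ (2 * k) * (c / 2), by positivity, N₀, ?_⟩
    intro F _ _ Q _ hQ hN
    obtain ⟨R, S, h1, -, h3⟩ := h F Q hQ hN
    set r := 2 * k / (2 * k - 1) with hr
    have hr0 : 0 ≤ r := div_nonneg (by linarith) (by linarith)
    have hr2 : r ≤ 2 := by
      rw [hr, div_le_iff₀ (by linarith)]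
      linarith
    have hrk : r * (2 * k - 1) = 2 * k := div_mul_cancel₀ _ (by linarith)
    have h3' := h3 r r hr0 hr0 (by linarith) (by linarith)
    refine mul_le_of_forall_le_div_add hc hC (by positivity) fun t ht ht1 => ?_
    refine h1.trans ((hnorm Q R S).trans ?_)
    calc _ ≤ ∑ χ ∈ Finset.univ.erase (1 : DirChar Q), (‖χ.lPoly‖ ^ (2 * k) / t ^ (2 * k) +
          t * (‖S χ‖ * ‖R χ‖) ^ r) :=
          Finset.sum_le_sum fun χ _ => mul_le_rpow_div_add hk1 (norm_nonneg _)
            (by positivity) ht ht1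
      _ = (∑ χ ∈ Finset.univ.erase (1 : DirChar Q), ‖χ.lPoly‖ ^ (2 * k)) / t ^ (2 * k) +
          t * ∑ χ ∈ Finset.univ.erase (1 : DirChar Q), (‖S χ‖ * ‖R χ‖) ^ r := by
          rw [Finset.sum_add_distrib, Finset.sum_div, ← Finset.mul_sum]
      _ ≤ _ := by
          gcongr
          refine le_trans (Finset.sum_le_sum_of_subset_of_nonneg (Finset.erase_subset _ _)
            fun χ _ _ => by positivity) (le_trans (le_of_eq ?_) h3')
          refine Finset.sum_congr rfl fun χ _ => ?_
          rw [Real.mul_rpow (norm_nonneg _) (norm_nonneg _), mul_comm]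

variable {F : Type u} [Field F] {Q : F[X]}

open Classical in
theorem primitiveChars_eq (hQ : Irreducible Q) [Fintype (DirChar Q)] :
    primitiveChars Q = ((Finset.univ.erase 1 : Finset (DirChar Q)) : Set (DirChar Q)) := by
  ext χ
  simp [primitiveChars, isPrimitive_iff_ne_one hQ]

variable [Finite F]

theorem card_dirChar (hQ : Q ≠ 0) [Fintype (DirChar Q)] :
    Fintype.card (DirChar Q) = numChars Q := by
  have := finite_quotient hQ
  have hNZ : NeZero ((Monoid.exponent (F[X] ⧸ Ideal.span {Q})ˣ : ℕ) : ℂ) :=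
    ⟨by exact_mod_cast Monoid.exponent_ne_zero_of_finite⟩
  rw [← Nat.card_eq_fintype_card, numChars]
  exact MulChar.card_eq_card_units_of_hasEnoughRootsOfUnity _ _

theorem phiStar_le_numChars (hQ : Irreducible Q) : phiStar Q ≤ numChars Q := by
  classical
  have := finite_dirChar hQ.ne_zero
  have := Fintype.ofFinite (DirChar Q)
  rw [phiStar, primitiveChars_eq hQ, Set.ncard_coe_finset, ← card_dirChar hQ.ne_zero]
  exact Finset.card_le_univ _

open Classical in
theorem moment_eq_sum (hQ : Irreducible Q) [Fintype (DirChar Q)] (k : ℝ) :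
    moment Q k = ∑ χ ∈ Finset.univ.erase (1 : DirChar Q), ‖χ.lPoly‖ ^ (2 * k) := by
  rw [moment, primitiveChars_eq hQ, finsum_mem_coe_finset]
  exact Finset.sum_congr rfl fun χ hχ => by
    rw [L_half_eq_lPoly hQ.ne_zero (Finset.ne_of_mem_erase hχ)]

theorem moment_zero (hQ : Irreducible Q) : moment Q 0 = phiStar Q := by
  classical
  have := finite_dirChar hQ.ne_zero
  have := Fintype.ofFinite (DirChar Q)
  rw [moment_eq_sum hQ, phiStar, primitiveChars_eq hQ, Set.ncard_coe_finset]
  simp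

end LowerBound

end FFMoments

end

theorem proposition1p2 (k : ℝ) (hk : 0 ≤ k) :
    ∃ c : ℝ, 0 < c ∧ ∀ (F : Type*) [Field F] [Finite F],
      ∃ X₀ : ℝ, ∀ Q : F[X], Q.Monic → Irreducible Q → X₀ ≤ polyNorm Q →
        c * (phiStar Q : ℝ) * (Real.logb (Nat.card F) (polyNorm Q)) ^ (k ^ 2) ≤ moment Q k := by
  rcases hk.eq_or_lt with rfl | hk
  · refine ⟨1, one_pos, fun F _ _ => ⟨0, fun Q _ hQ _ => ?_⟩⟩
    simp [moment_zero hQ]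
  obtain ⟨c, hc, N₀, h⟩ := exists_mul_le_sum_lPoly_rpow hk
  refine ⟨c, hc, fun F _ _ => ⟨(Nat.card F : ℝ) ^ N₀, fun Q _ hQ hX => ?_⟩⟩
  have hq : (1 : ℝ) < Nat.card F := by exact_mod_cast Finite.one_lt_card
  rw [polyNorm, if_neg hQ.ne_zero] at hX ⊢
  have hN : N₀ ≤ Q.natDegree := (pow_le_pow_iff_right₀ hq).1 hX
  have := finite_dirChar hQ.ne_zero
  have := Fintype.ofFinite (DirChar Q)
  rw [Real.logb_pow, Real.logb_self_eq_one hq, mul_one, moment_eq_sum hQ]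
  refine le_trans ?_ (h F Q hQ hN)
  rw [mul_assoc]
  gcongr
  exact_mod_cast phiStar_le_numChars hQ
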